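/- Let $R$ be one of the reduced irreducible root systems $A_n$ ($n\ge 1$), $B_n$, $C_n$ ($n\ge 2$), $D_n$ ($n\ge 4$), $E_6,E_7,E_8,F_4,G_2$ in Bourbaki's realisation in $\mathbb{R}^N$, with inner product $(\varepsilon_i,\varepsilon_j)=\delta_{ij}$. Let $\mathfrak{a}$ be the real span of $R$, identified with its dual by the inner product, $\mathfrak{h}=\mathbb{C}\otimes\mathfrak{a}$ with the bilinearly extended form $(\cdot,\cdot)$, $Q=\mathbb{Z}R$, $H=\mathrm{Hom}(Q,\mathbb{C}^\times)$, with characters $e^\alpha$, and $H^\circ=\{h\in H: e^\alpha(h)\neq 1\ \forall \alpha\in R\}$. Let $W$ be the Weyl group, $\kappa=(k_\alpha)_{\alpha\in R}\in\mathbb{C}^R$ a $W$-invariant function, $a^\kappa:\mathfrak{h}\times\mathfrak{h}\to\mathbb{C}$ a $W$-invariant symmetric bilinear form and $b^\kappa:\mathfrak{h}\times\mathfrak{h}\to\mathfrak{h}$ a $W$-equivariant symmetric bilinear map, with associated translation invariant tensors $A^\kappa$ and $(B^\kappa)^*(\zeta)(u,v)=\zeta(b^\kappa(u,v))$. Consider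 on the cotangent bundle of $H^\circ\times\mathbb{C}^\times$ (with coordinate $t$ on $\mathbb{C}^\times$) the connection $\tilde\nabla^\kappa=\tilde\nabla^0+\tilde\Omega^\kappa$, where $\tilde\nabla^0$ is the translation invariant connection and $$\tilde\Omega^\kappa(\zeta)=\frac12\sum_{\alpha>0}k_\alpha\frac{e^\alpha+1}{e^\alpha-1}\,\zeta(\partial_{\alpha^\vee})\,d\alpha\otimes d\alpha+(B^\kappa)^*(\zeta)-\zeta\otimes\frac{dt}{t}-\frac{dt}{t}\otimes\zeta\quad(\zeta\in\Omega_{H^\circ}),\qquad \tilde\Omega^\kappa\Big(\frac{dt}{t}\Big)=A^\kappa-\frac{dt}{t}\otimes\frac{dt}{t}.$$ Write $k=k_{\alpha_1}$ and, for $B_n$, $C_n$, $F_4$, $G_2$, $k'=k_{\alpha_n}$, with $\alpha_1,\dots,\alpha_n$ Bourbaki's simple roots (so $k$ belongs to the long roots for $B_n$, $F_4$ and to the short roots for $C_n$, $G_2$). For $A_n$ let $k'\in\mathbb{C}$ be a further parameter and $$b^\kappa(u,v)=\frac12k'\sum_{i<j}\alpha_{ij}(u)\,\alpha_{ij}(v)\,\Big(\varepsilon_i+\varepsilon_j-\frac{2}{n+1}\sum_l\varepsilon_l\Big),\qquad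 \alpha_{ij}=\varepsilon_i-\varepsilon_j ;$$ for the other types $b^\kappa$ is arbitrary as above. Then for every type except $A_1$ the connection $\tilde\nabla^\kappa$ is flat if and only if $a^\kappa=c\,(\cdot,\cdot)$, where \begin{align*} A_n:&\ c=\tfrac{n+1}{4}(k^2-k'^2);\qquad B_n:\ c=(n-2)k^2+kk';\qquad C_n:\ c=(n-2)k^2+2kk';\qquad D_n:\ c=(n-2)k^2;\\ E_6,E_7,E_8:&\ c=6k^2,\ 12k^2,\ 30k^2;\qquad F_4:\ c=(k+k')(2k+k');\qquad G_2:\ c=\tfrac34(k+3k')(k+k'). \end{align*} For $A_1$ the connection $\tilde\nabla^\kappa$ is flat for $a^\kappa=c\,(\cdot,\cdot)$ with the same $c=\tfrac{n+1}{4}(k^2-k'^2)$. -/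

import Mathlib

noncomputable section

open scoped Classical

namespace ToricConnection

/-! ### The irreducible reduced root systems, realised in `ℝ^N` -/

/-- The standard orthonormal basis vector `ε_i` of `ℝ^N` (indexed from `0`). -/
def ε {N : ℕ} (i : Fin N) : Fin N → ℝ := Pi.single i 1

/-- The vectors `± ε_i ± ε_j`, `i ≠ j`. -/
def pmRoots (n : ℕ) : Finset (Fin n → ℝ) :=
  ((Finset.univ : Finset ((Fin n × Fin n) × (ℤˣ × ℤˣ))).filter (fun p => p.1.1 ≠ p.1.2)).image
    (fun p => ((p.2.1 : ℤ) : ℝ) • ε p.1.1 + ((p.2.2 : ℤ) : ℝ) • ε p.1.2)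

/-- The vectors `½ (± ε_1 ± ⋯ ± ε_n)` with prescribed sign vectors. -/
def halfVectors (n : ℕ) (S : Finset (Fin n → ℤˣ)) : Finset (Fin n → ℝ) :=
  S.image (fun s i => (((s i : ℤˣ) : ℤ) : ℝ) / 2)

/-- `A_n`: the vectors `ε_i - ε_j`, `i ≠ j`, in `ℝ^{n+1}`. -/
def rootsA (n : ℕ) : Finset (Fin (n + 1) → ℝ) :=
  ((Finset.univ : Finset (Fin (n + 1) × Fin (n + 1))).filter (fun p => p.1 ≠ p.2)).image
    (fun p => ε p.1 - ε p.2)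

/-- `B_n`: the vectors `± ε_i ± ε_j` and `± ε_i`. -/
def rootsB (n : ℕ) : Finset (Fin n → ℝ) :=
  pmRoots n ∪ (Finset.univ : Finset (Fin n × ℤˣ)).image (fun p => ((p.2 : ℤ) : ℝ) • ε p.1)

/-- `C_n`: the vectors `± ε_i ± ε_j` and `± 2 ε_i`. -/
def rootsC (n : ℕ) : Finset (Fin n → ℝ) :=
  pmRoots n ∪ (Finset.univ : Finset (Fin n × ℤˣ)).image (fun p => (2 * ((p.2 : ℤ) : ℝ)) • ε p.1)

/-- `D_n`: the vectors `± ε_i ± ε_j`. -/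
def rootsD (n : ℕ) : Finset (Fin n → ℝ) := pmRoots n

/-- `E_8`: the vectors `± ε_i ± ε_j` and `½ ∑ ± ε_i` with an even number of minus signs. -/
def rootsE8 : Finset (Fin 8 → ℝ) :=
  pmRoots 8 ∪ halfVectors 8 (Finset.univ.filter (fun s => ∏ i, s i = 1))

/-- `E_7`: the roots of `E_8` orthogonal to `ε_7 + ε_8`. -/
def rootsE7 : Finset (Fin 8 → ℝ) := rootsE8.filter (fun α => α 6 = -α 7)

/-- `E_6`: the roots of `E_8` whose last three coordinates satisfy `x_6 = x_7 = - x_8`. -/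
def rootsE6 : Finset (Fin 8 → ℝ) := rootsE8.filter (fun α => α 5 = α 6 ∧ α 6 = -α 7)

/-- `F_4`: the vectors `± ε_i`, `± ε_i ± ε_j` and `½ (± ε_1 ± ε_2 ± ε_3 ± ε_4)`. -/
def rootsF4 : Finset (Fin 4 → ℝ) := rootsB 4 ∪ halfVectors 4 Finset.univ

/-- `G_2`: the vectors `ε_i - ε_j`, `i ≠ j`, and `± (2 ε_i - ε_j - ε_k)` in `ℝ^3`
(note `2 ε_i - ε_j - ε_k = 3 ε_i - (ε_1 + ε_2 + ε_3)`). -/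
def rootsG2 : Finset (Fin 3 → ℝ) :=
  rootsA 2 ∪ (Finset.univ : Finset (Fin 3 × ℤˣ)).image
    (fun p => ((p.2 : ℤ) : ℝ) • ((3 : ℝ) • ε p.1 - ∑ j, ε j))

/-! ### The torus, its Lie algebra and the Weyl group -/

section General

variable {N : ℕ} (R : Finset (Fin N → ℝ))

/-- A vector of `ℝ^N`, seen in `ℂ^N`. -/
def cplx (x : Fin N → ℝ) : Fin N → ℂ := fun i => (x i : ℂ)

/-- The Lie algebra `𝔥 = ℂ ⊗ 𝔞`, where `𝔞` is the real span of `R`: the complex span of `R`. -/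
abbrev LieAlg : Submodule ℂ (Fin N → ℂ) := Submodule.span ℂ (cplx '' (R : Set (Fin N → ℝ)))

/-- The complex bilinear extension to `𝔥` of the inner product with `(ε_i, ε_j) = δ_ij`. -/
def stdForm : LieAlg R →ₗ[ℂ] LieAlg R →ₗ[ℂ] ℂ :=
  LinearMap.mk₂ ℂ (fun u v => ∑ i, (u : Fin N → ℂ) i * (v : Fin N → ℂ) i)
    (fun u u' v => by simp [add_mul, Finset.sum_add_distrib])
    (fun c u v => by simp [Finset.mul_sum, mul_assoc])
    (fun u v v' => by simp [mul_add, Finset.sum_add_distrib])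
    (fun c u v => by simp [Finset.mul_sum, mul_left_comm])

/-- A vector `x ∈ ℝ^N` as the linear form `(x, ·)` on `𝔥`. -/
def asForm (x : Fin N → ℝ) : LieAlg R →L[ℂ] ℂ :=
  ∑ i, (x i : ℂ) • (ContinuousLinearMap.proj i).comp (LieAlg R).subtypeL

/-- The coroot `α^∨ = 2 α / (α, α)` in `𝔥`. -/
def coroot (α : R) : LieAlg R :=
  ((2 / ∑ i, α.1 i * α.1 i : ℝ) : ℂ) • ⟨cplx α.1, Submodule.subset_span ⟨α.1, α.2, rfl⟩⟩

/-- The reflection `s_α` acting on `𝔥`. -/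
def reflection (α : R) (v : LieAlg R) : LieAlg R := v - asForm R α.1 v • coroot R α

/-- The reflection `s_α` acting on (co)vectors of `ℝ^N`. -/
def realReflection (α β : Fin N → ℝ) : Fin N → ℝ :=
  β - (2 * (∑ i, β i * α i) / ∑ i, α i * α i) • α

/-- `κ = (k_α)` is a multiplicity parameter: it is invariant under the Weyl group (equivalently,
under the reflections in the roots). Only the values on `R` are used. -/
def IsMultiplicity (k : (Fin N → ℝ) → ℂ) : Prop :=
  ∀ α ∈ R, ∀ β ∈ R, k (realReflection α β) = k β

/-- Symmetric bilinear forms on `𝔥` that are invariant under the Weyl group. -/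
def IsInvariantForm (a : LieAlg R →ₗ[ℂ] LieAlg R →ₗ[ℂ] ℂ) : Prop :=
  (∀ u v, a u v = a v u) ∧
    ∀ (α : R) (u v : LieAlg R), a (reflection R α u) (reflection R α v) = a u v

/-- Symmetric bilinear maps `𝔥 × 𝔥 → 𝔥` that are equivariant under the Weyl group. -/
def IsEquivariantMap (b : LieAlg R →ₗ[ℂ] LieAlg R →ₗ[ℂ] LieAlg R) : Prop :=
  (∀ u v, b u v = b v u) ∧
    ∀ (α : R) (u v : LieAlg R),
      b (reflection R α u) (reflection R α v) = reflection R α (b u v)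

/-- The root lattice `Q = ℤ R`. -/
abbrev RootLattice : AddSubgroup (Fin N → ℝ) := AddSubgroup.closure (R : Set (Fin N → ℝ))

/-- The adjoint torus `H = Hom(Q, ℂ^×)`. -/
abbrev Torus : Type := Multiplicative (RootLattice R) →* ℂˣ

/-- The character `e^α` of `H` defined by a root `α`. -/
def rootChar (α : R) (h : Torus R) : ℂ :=
  (h (Multiplicative.ofAdd ⟨α.1, AddSubgroup.subset_closure α.2⟩) : ℂˣ)

/-- The exponential map `𝔥 → H`, determined by `e^φ (exp v) = exp (φ(v))` for `φ ∈ Q`. -/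
def torusExp (v : LieAlg R) : Torus R where
  toFun q := Units.mk0 (Complex.exp (asForm R (q.toAdd : Fin N → ℝ) v)) (Complex.exp_ne_zero _)
  map_one' := by
    ext
    simp [asForm]
  map_mul' q r := by
    ext
    simp [asForm, ← Complex.exp_add, add_mul, Finset.sum_add_distrib]

/-! ### The connection on the cotangent bundle of `H° × ℂ^×`

The cotangent bundle of the complex Lie group `H × ℂ^×` is trivialised by the translation invariant
differentials: a translation invariant differential is a linear form on the Lie algebra `𝔥 × ℂ`,
where the form `(v, s) ↦ α(v)` corresponds to `dα` and `(v, s) ↦ s` to `dt/t`. The translation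
invariant vector field defined by `(v, s)` is `∂_v + s t ∂/∂t`. -/

/-- The group `H × ℂ^×`. -/
abbrev Total : Type := Torus R × ℂˣ

/-- The Lie algebra `𝔥 × ℂ` of `H × ℂ^×`. -/
abbrev TotalLie : Type := LieAlg R × ℂ

/-- The dual of the Lie algebra of `H × ℂ^×`: the fibre of the cotangent bundle. -/
abbrev Cotangent : Type := TotalLie R →L[ℂ] ℂ

/-- The exponential map of `H × ℂ^×`. -/
def totalExp (ξ : TotalLie R) : Total R :=
  (torusExp R ξ.1, Units.mk0 (Complex.exp ξ.2) (Complex.exp_ne_zero _))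

/-- The complement `H° × ℂ^×` of the mirrors `e^α = 1`. -/
def complement : Set (Total R) := {x | ∀ α : R, rootChar R α x.1 ≠ 1}

/-- A differential is holomorphic near `x` if it is so in the exponential chart around `x`. -/
def HolomorphicNear (ω : Total R → Cotangent R) (x : Total R) : Prop :=
  AnalyticAt ℂ (fun ξ : TotalLie R => ω (x * totalExp R ξ)) 0

/-- The derivative of a differential along the translation invariant vector field `ξ`, i.e. the
covariant derivative for the translation invariant connection. -/
def invDeriv (ξ : TotalLie R) (ω : Total R → Cotangent R) (x : Total R) : Cotangent R :=
  deriv (fun s : ℂ => ω (x * totalExp R (s • ξ))) 0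

/-- The component in `𝔥*` of a cotangent vector. -/
def basePart (ω : Cotangent R) : LieAlg R →L[ℂ] ℂ :=
  ω.comp (ContinuousLinearMap.inl ℂ (LieAlg R) ℂ)

/-- The coefficient of `dt/t` in a cotangent vector. -/
def fibrePart (ω : Cotangent R) : ℂ := ω (0, 1)

/-- The pull-back to `H × ℂ^×` of a translation invariant differential on `H`. -/
def pull (φ : LieAlg R →L[ℂ] ℂ) : Cotangent R := φ.comp (ContinuousLinearMap.fst ℂ (LieAlg R) ℂ)

/-- The differential `dt/t`. -/
def dtt : Cotangent R := ContinuousLinearMap.snd ℂ (LieAlg R) ℂ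

variable (k : (Fin N → ℝ) → ℂ) (a : LieAlg R →ₗ[ℂ] LieAlg R →ₗ[ℂ] ℂ)
  (b : LieAlg R →ₗ[ℂ] LieAlg R →ₗ[ℂ] LieAlg R)

/-- The value at `x`, contracted with the vector `ξ` in its first tensor slot, of the connection
form: on `ζ ∈ 𝔥*` it is
`½ ∑_{α > 0} k_α (e^α + 1)/(e^α - 1) ζ(α^∨) dα ⊗ dα + B^*(ζ) - ζ ⊗ dt/t - dt/t ⊗ ζ`
with `B^*(ζ)(u, v) = ζ(b(u, v))`, and on `dt/t` it is `A - dt/t ⊗ dt/t` with `A(u, v) = a(u, v)`.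
The summand of the root sum is the same for `α` and `-α`, so `½ ∑_{α > 0}` is `¼ ∑_{α ∈ R}`. -/
def connForm (x : Total R) (ξ : TotalLie R) (ω : Cotangent R) : Cotangent R :=
  ((1 / 4 : ℂ) • ∑ α : R,
      (k α.1 * ((rootChar R α x.1 + 1) / (rootChar R α x.1 - 1)) *
        basePart R ω (coroot R α) * asForm R α.1 ξ.1) • pull R (asForm R α.1))
    + pull R ((basePart R ω).comp (LinearMap.toContinuousLinearMap (b ξ.1)))
    - basePart R ω ξ.1 • dtt R
    - ξ.2 • pull R (basePart R ω)
    + fibrePart R ω • (pull R (LinearMap.toContinuousLinearMap (a ξ.1)) - ξ.2 • dtt R)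

/-- The covariant derivative of a differential along the translation invariant vector field `ξ`. -/
def covDeriv (ξ : TotalLie R) (ω : Total R → Cotangent R) (x : Total R) : Cotangent R :=
  invDeriv R ξ ω x + connForm R k a b x ξ (ω x)

/-- The curvature applied to a differential `ω` and evaluated on two translation invariant vector
fields `ξ`, `η` (the Lie bracket of which vanishes). -/
def curvature (ξ η : TotalLie R) (ω : Total R → Cotangent R) (x : Total R) : Cotangent R :=
  covDeriv R k a b ξ (covDeriv R k a b η ω) x - covDeriv R k a b η (covDeriv R k a b ξ ω) x

/-- The connection on the cotangent bundle of `H° × ℂ^×` is flat: its curvature annihilates every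
local holomorphic differential. -/
def IsFlat : Prop :=
  ∀ x ∈ complement R, ∀ ω : Total R → Cotangent R, HolomorphicNear R ω x →
    ∀ ξ η : TotalLie R, curvature R k a b ξ η ω x = 0

end General

/-! ### The equivariant bilinear map in type `A_n` -/

theorem primed_mem (n : ℕ) (i j : Fin (n + 1)) :
    cplx (ε i + ε j - (2 / ((n : ℝ) + 1)) • ∑ l, ε l) ∈ LieAlg (rootsA n) := by
  have key : ∀ i l : Fin (n + 1), cplx (ε i - ε l) ∈ LieAlg (rootsA n) := by
    intro i l
    by_cases h : i = l
    · subst h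
      have : cplx (ε i - ε i : Fin (n + 1) → ℝ) = 0 := by
        ext m
        simp [cplx]
      rw [this]
      exact Submodule.zero_mem _
    · refine Submodule.subset_span ⟨_, ?_, rfl⟩
      simp only [rootsA, Finset.coe_image, Set.mem_image, Finset.mem_coe, Finset.mem_filter,
        Finset.mem_univ, true_and]
      exact ⟨(i, l), h, rfl⟩
  have eq : cplx (ε i + ε j - (2 / ((n : ℝ) + 1)) • ∑ l, ε l) =
      (1 / ((n : ℂ) + 1)) • ∑ l : Fin (n + 1), (cplx (ε i - ε l) + cplx (ε j - ε l)) := by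
    have hn : ((n : ℂ) + 1) ≠ 0 := by exact_mod_cast Nat.succ_ne_zero n
    ext m
    simp only [cplx, Pi.sub_apply, Pi.add_apply, Pi.smul_apply, Finset.sum_apply, smul_eq_mul,
      Complex.ofReal_sub, Complex.ofReal_add, Complex.ofReal_mul, Complex.ofReal_div,
      Complex.ofReal_sum, Finset.sum_add_distrib, Finset.sum_sub_distrib, Finset.sum_const,
      Finset.card_univ, Fintype.card_fin, nsmul_eq_mul]
    push_cast
    field_simp
    ring
  rw [eq]
  exact Submodule.smul_mem _ _ (Submodule.sum_mem _ fun l _ => Submodule.add_mem _ (key i l) (key j l))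

/-- For the root `α = ε_i - ε_j` of `A_n`, the vector
`α' = ε_i + ε_j - 2/(n+1) ∑_l ε_l` of `𝔥`. -/
def primed (n : ℕ) (i j : Fin (n + 1)) : LieAlg (rootsA n) :=
  ⟨cplx (ε i + ε j - (2 / ((n : ℝ) + 1)) • ∑ l, ε l), primed_mem n i j⟩

/-- The map `b(u, v) = ½ k' ∑_{α > 0} α(u) α(v) α'` in type `A_n`; the positive roots are
`ε_i - ε_j` with `i < j`. -/
def bA (n : ℕ) (k' : ℂ) :
    LieAlg (rootsA n) →ₗ[ℂ] LieAlg (rootsA n) →ₗ[ℂ] LieAlg (rootsA n) :=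
  (k' / 2) • ∑ p ∈ (Finset.univ : Finset (Fin (n + 1) × Fin (n + 1))).filter (fun p => p.1 < p.2),
    (asForm (rootsA n) (ε p.1 - ε p.2)).toLinearMap.smulRight
      ((asForm (rootsA n) (ε p.1 - ε p.2)).toLinearMap.smulRight (primed n p.1 p.2))

end ToricConnection

end

/-! In the trivialisation by invariant differentials the connection is `d + Ω`, where `Ω` is a
constant part plus one term `f(e^α) dα ⊗ dα` for each root. Since `f(e^α) dα` is closed, `dΩ` does
not contribute, and the curvature is the pointwise commutator of `Ω` with itself. Dually, `Ω` is a
commutative product `u·w = ¼ ∑ k_α f_α α(u) α(w) α^∨ + b(u, w)` on `𝔥`, with `f_α = (e^α + 1)/(e^α -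
1) = coth(α/2)`. Flatness says that `v·(u·w) - u·(v·w) = a(u,w) v - a(v,w) u` and that the product
is self-adjoint for `a` (`isFlat_iff`). In rank at least two the first identity determines `a`.
Everything thus rests on showing that the commutator on the left is `c` times the same expression in
the inner product, and on finding `c`.

For `b = 0` the commutator is a sum over pairs of roots of `f_α f_β` times a constant times the
square of the bivector `α ∧ β` (`stdForm_commutator`). If `α + β + γ = 0`, the bivectors `α ∧ β`, `β
∧ γ`, `γ ∧ α` coincide, and the addition theorem of the hyperbolic cotangent reads `f_α f_β + f_β
f_γ + f_γ f_α = -1`. The coefficients of the pairs can be distributed over such triples with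
cyclically invariant weights. Hence `f_α f_β` may be replaced by any expression that is odd in `β`
and has the same cyclic sum `-1`; a multiple of `(α, β)` depending only on the two lengths will do
(`sum_pairs_eq_zero`, `sum_coth_eq`). This removes the dependence on the point and leaves sums of
`(α, β)² (α ∧ β)²`, which follow from the second and fourth moments of the roots of each length
(`hasPairSum_of_moments`). The constant `c` is read off from these moments, type by type.

Outside type `A_n` there is no nonzero `b`, because each root spans `𝔥` together with the roots
orthogonal to it (`equivariant_eq_zero`). In type `A_n` the map `b` is a multiple of the
coordinatewise product projected to sum zero. Its own commutator is again a multiple of the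
curvature tensor of the inner product, and the mixed terms cancel root by root (`bA_commutator`,
`mixed_commutator_A`). -/

noncomputable section

open scoped Classical

namespace ToricConnection

/-! ### Curvature as a commutator of the connection form -/

section Reduction

variable {N : ℕ} (R : Finset (Fin N → ℝ))

instance cotangentNormedAddCommGroup : NormedAddCommGroup (Cotangent R) :=
  ContinuousLinearMap.toNormedAddCommGroup

instance cotangentNormedSpace : NormedSpace ℂ (Cotangent R) :=
  ContinuousLinearMap.toNormedSpace

/-- The function `(e^α + 1) / (e^α - 1)` on the torus, extended by zero to all vectors `α`. -/
def cothChar (x : Total R) (α : Fin N → ℝ) : ℂ :=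
  if h : α ∈ R then (rootChar R ⟨α, h⟩ x.1 + 1) / (rootChar R ⟨α, h⟩ x.1 - 1) else 0

theorem cothChar_coe (x : Total R) (α : R) :
    cothChar R x α.1 = (rootChar R α x.1 + 1) / (rootChar R α x.1 - 1) := by
  simp [cothChar, α.2]

/-- The symmetric product on `𝔥` that is dual to the connection form. -/
def fibreProduct (k : (Fin N → ℝ) → ℂ) (b : LieAlg R →ₗ[ℂ] LieAlg R →ₗ[ℂ] LieAlg R)
    (x : Total R) (u w : LieAlg R) : LieAlg R :=
  (1 / 4 : ℂ) • ∑ α : R, (k α.1 * cothChar R x α.1 * asForm R α.1 u * asForm R α.1 w) • coroot R α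
    + b u w

variable (k : (Fin N → ℝ) → ℂ) (a : LieAlg R →ₗ[ℂ] LieAlg R →ₗ[ℂ] ℂ)
  (b : LieAlg R →ₗ[ℂ] LieAlg R →ₗ[ℂ] LieAlg R)

/-- Evaluation on a tangent vector transposes the connection form: the root sum and `B^*` merge into
a single product on `𝔥`, in which all later computations take place. -/
theorem connForm_apply (x : Total R) (ξ η : TotalLie R) (ω : Cotangent R) :
    connForm R k a b x ξ ω η =
      basePart R ω (fibreProduct R k b x ξ.1 η.1) - basePart R ω ξ.1 * η.2
        - ξ.2 * basePart R ω η.1 + fibrePart R ω * (a ξ.1 η.1 - ξ.2 * η.2) := by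
  have h : (connForm R k a b x ξ ω) η =
      (1 / 4 : ℂ) * ∑ α : R, (k α.1 * ((rootChar R α x.1 + 1) / (rootChar R α x.1 - 1)) *
        basePart R ω (coroot R α) * asForm R α.1 ξ.1) * asForm R α.1 η.1
      + basePart R ω (b ξ.1 η.1) - basePart R ω ξ.1 * η.2 - ξ.2 * basePart R ω η.1
      + fibrePart R ω * (a ξ.1 η.1 - ξ.2 * η.2) := by
    simp only [connForm, pull, dtt, add_apply, sub_apply,
      smul_apply, sum_apply, smul_eq_mul,
      ContinuousLinearMap.comp_apply, ContinuousLinearMap.coe_fst', ContinuousLinearMap.coe_snd',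
      LinearMap.coe_toContinuousLinearMap']
  rw [h, fibreProduct, map_add, map_smul, map_sum]
  congr 4
  simp only [smul_eq_mul, map_smul, cothChar_coe]
  congr 1
  exact Finset.sum_congr rfl fun α _ => by ring

theorem connForm_add (x : Total R) (ξ : TotalLie R) (ω ω' : Cotangent R) :
    connForm R k a b x ξ (ω + ω') = connForm R k a b x ξ ω + connForm R k a b x ξ ω' := by
  ext η
  all_goals
    simp only [connForm_apply, add_apply, ContinuousLinearMap.comp_apply,
      basePart, fibrePart]
    ring

theorem basePart_connForm (x : Total R) (ξ : TotalLie R) (ω : Cotangent R) (w : LieAlg R) :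
    basePart R (connForm R k a b x ξ ω) w =
      basePart R ω (fibreProduct R k b x ξ.1 w) - ξ.2 * basePart R ω w
        + fibrePart R ω * a ξ.1 w := by
  have := connForm_apply R k a b x ξ (w, 0) ω
  simp only [mul_zero, sub_zero] at this
  exact this

theorem fibrePart_connForm (x : Total R) (ξ : TotalLie R) (ω : Cotangent R) :
    fibrePart R (connForm R k a b x ξ ω) = -basePart R ω ξ.1 - ξ.2 * fibrePart R ω := by
  have := connForm_apply R k a b x ξ (0, 1) ω
  rw [fibrePart, this]
  simp [fibreProduct]
  ring

theorem total_mul_one (x : Total R) : x * 1 = x :=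
  Prod.ext (MonoidHom.ext fun _ => mul_one _) (mul_one _)

theorem total_mul_assoc (x y z : Total R) : x * y * z = x * (y * z) :=
  Prod.ext (MonoidHom.ext fun _ => mul_assoc _ _ _) (mul_assoc _ _ _)

theorem totalExp_add (ξ η : TotalLie R) : totalExp R (ξ + η) = totalExp R ξ * totalExp R η := by
  refine Prod.ext ?_ ?_
  · refine MonoidHom.ext fun q => Units.ext ?_
    simp [totalExp, torusExp, Complex.exp_add]
  · refine Units.ext ?_
    simp [totalExp, Complex.exp_add]

theorem totalExp_zero : totalExp R 0 = 1 := by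
  refine Prod.ext ?_ ?_
  · refine MonoidHom.ext fun q => Units.ext ?_
    simp [totalExp, torusExp]
  · refine Units.ext ?_
    simp [totalExp]

theorem rootChar_mul_totalExp (α : R) (x : Total R) (ξ : TotalLie R) :
    rootChar R α (x * totalExp R ξ).1 = rootChar R α x.1 * Complex.exp (asForm R α.1 ξ.1) := by
  simp [rootChar, totalExp, torusExp]

/-- The summand of the connection form that belongs to a root, as a linear map. -/
def rootTerm (α : R) (η : TotalLie R) : Cotangent R →L[ℂ] Cotangent R :=
  LinearMap.toContinuousLinearMap
    { toFun := fun ω => (1 / 4 * k α.1 * basePart R ω (coroot R α) * asForm R α.1 η.1) •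
        pull R (asForm R α.1)
      map_add' := fun ω ω' => by
        refine ContinuousLinearMap.ext fun θ => ?_
        simp [basePart, pull]; ring
      map_smul' := fun c ω => by
        refine ContinuousLinearMap.ext fun θ => ?_
        simp [basePart, pull]; ring }

theorem rootTerm_apply (α : R) (η : TotalLie R) (ω : Cotangent R) :
    rootTerm R k α η ω = (1 / 4 * k α.1 * basePart R ω (coroot R α) * asForm R α.1 η.1) •
      pull R (asForm R α.1) := rfl

/-- The part of the connection form that is independent of the point. -/
def constTerm (η : TotalLie R) : Cotangent R →L[ℂ] Cotangent R :=
  LinearMap.toContinuousLinearMap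
    { toFun := fun ω => pull R ((basePart R ω).comp (LinearMap.toContinuousLinearMap (b η.1)))
        - basePart R ω η.1 • dtt R - η.2 • pull R (basePart R ω)
        + fibrePart R ω • (pull R (LinearMap.toContinuousLinearMap (a η.1)) - η.2 • dtt R)
      map_add' := fun ω ω' => by
        refine ContinuousLinearMap.ext fun θ => ?_
        simp [basePart, fibrePart, pull, dtt]; ring
      map_smul' := fun c ω => by
        refine ContinuousLinearMap.ext fun θ => ?_
        simp [basePart, fibrePart, pull, dtt]; ring }

/-- This separates the scalar functions of the point from constant endomorphisms, so that only
scalars have to be differentiated. -/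
theorem connForm_eq (x : Total R) (η : TotalLie R) (ω : Cotangent R) :
    connForm R k a b x η ω = ∑ α : R, ((rootChar R α x.1 + 1) / (rootChar R α x.1 - 1)) •
      rootTerm R k α η ω + constTerm R a b η ω := by
  have h : constTerm R a b η ω =
      pull R ((basePart R ω).comp (LinearMap.toContinuousLinearMap (b η.1)))
        - basePart R ω η.1 • dtt R - η.2 • pull R (basePart R ω)
        + fibrePart R ω • (pull R (LinearMap.toContinuousLinearMap (a η.1)) - η.2 • dtt R) := rfl
  rw [h]
  refine ContinuousLinearMap.ext fun θ => ?_
  simp only [connForm, rootTerm_apply, add_apply, sub_apply, smul_apply, sum_apply, smul_eq_mul]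
  rw [Finset.mul_sum, add_sub_assoc, add_sub_assoc, add_assoc]
  congr 1
  exact Finset.sum_congr rfl fun α _ => by ring

/-- The derivative at the point `x` along `ξ` of the connection form contracted with `η`. -/
def connFormDeriv (x : Total R) (ξ η : TotalLie R) (ω : Cotangent R) : Cotangent R :=
  ∑ α : R, (deriv (fun z : ℂ => (rootChar R α x.1 * Complex.exp z + 1) /
    (rootChar R α x.1 * Complex.exp z - 1)) 0 * asForm R α.1 ξ.1) • rootTerm R k α η ω

/-- Differentiation along `ξ` produces the factor `α(ξ)` next to the factor `α(η)` already present.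
This is the closedness of `f(e^α) dα`, which removes `dΩ` from the curvature. -/
theorem connFormDeriv_symm (x : Total R) (ξ η : TotalLie R) (ω : Cotangent R) :
    connFormDeriv R k x ξ η ω = connFormDeriv R k x η ξ ω := by
  refine Finset.sum_congr rfl fun α _ => ?_
  simp only [rootTerm_apply, smul_smul]
  congr 1
  ring

theorem hasDerivAt_connForm {x : Total R} (hx : x ∈ complement R) (ξ η : TotalLie R)
    {ω : ℂ → Cotangent R} {ω' : Cotangent R} (hω : HasDerivAt ω ω' 0) :
    HasDerivAt (fun s : ℂ => connForm R k a b (x * totalExp R (s • ξ)) η (ω s))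
      (connFormDeriv R k x ξ η (ω 0) + connForm R k a b x η ω') 0 := by
  have hf : ∀ α : R, HasDerivAt
      (fun s : ℂ => ((rootChar R α (x * totalExp R (s • ξ)).1 + 1) /
        (rootChar R α (x * totalExp R (s • ξ)).1 - 1)))
      (deriv (fun z : ℂ => (rootChar R α x.1 * Complex.exp z + 1) /
        (rootChar R α x.1 * Complex.exp z - 1)) 0 * asForm R α.1 ξ.1) 0 := by
    intro α
    have hd : DifferentiableAt ℂ (fun z : ℂ => (rootChar R α x.1 * Complex.exp z + 1) /
        (rootChar R α x.1 * Complex.exp z - 1)) 0 := by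
      refine DifferentiableAt.div (by fun_prop) (by fun_prop) ?_
      simpa [sub_eq_zero] using hx α
    have hl : HasDerivAt (fun s : ℂ => s * asForm R α.1 ξ.1) (asForm R α.1 ξ.1) 0 := by
      simpa using (hasDerivAt_id (0 : ℂ)).mul_const (asForm R α.1 ξ.1)
    have h0 : (0 : ℂ) = 0 * asForm R α.1 ξ.1 := by simp
    have hc := HasDerivAt.comp (0 : ℂ) (h₂ := fun z : ℂ => (rootChar R α x.1 * Complex.exp z + 1) /
        (rootChar R α x.1 * Complex.exp z - 1)) (by rw [← h0]; exact hd.hasDerivAt) hl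
    refine hc.congr_of_eventuallyEq (Filter.Eventually.of_forall fun s => ?_)
    simp only [rootChar_mul_totalExp, Function.comp, Prod.smul_fst, map_smul, smul_eq_mul]
  have hsum : HasDerivAt (fun s : ℂ =>
      ∑ α : R, ((rootChar R α (x * totalExp R (s • ξ)).1 + 1) /
        (rootChar R α (x * totalExp R (s • ξ)).1 - 1)) • rootTerm R k α η (ω s))
      (∑ α : R, (((rootChar R α (x * totalExp R ((0 : ℂ) • ξ)).1 + 1) /
        (rootChar R α (x * totalExp R ((0 : ℂ) • ξ)).1 - 1)) • rootTerm R k α η ω' +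
        (deriv (fun z : ℂ => (rootChar R α x.1 * Complex.exp z + 1) /
          (rootChar R α x.1 * Complex.exp z - 1)) 0 * asForm R α.1 ξ.1) •
          rootTerm R k α η (ω 0))) 0 :=
    HasDerivAt.fun_sum fun α _ => (hf α).smul ((rootTerm R k α η).hasFDerivAt.comp_hasDerivAt 0 hω)
  have hall := hsum.add ((constTerm R a b η).hasFDerivAt.comp_hasDerivAt 0 hω)
  simp only [connForm_eq, connFormDeriv]
  refine hall.congr_deriv ?_
  simp only [Finset.sum_add_distrib, zero_smul, totalExp_zero, total_mul_one]
  abel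

omit R k a b in
-- Symmetry of the second derivative, stated through derivatives along lines because covariant
-- derivatives are defined that way.
theorem AnalyticAt.exists_derivatives {E F : Type*} [NormedAddCommGroup E] [NormedSpace ℂ E]
    [NormedAddCommGroup F] [NormedSpace ℂ F] [CompleteSpace F] {φ : E → F}
    (hφ : AnalyticAt ℂ φ 0) :
    ∃ (D : E → F) (D₂ : E → E → F), (∀ ξ, HasDerivAt (fun s : ℂ => φ (s • ξ)) (D ξ) 0) ∧
      (∀ ξ η, D₂ ξ η = D₂ η ξ) ∧
      ∀ ξ η, HasDerivAt (fun s : ℂ => deriv (fun r : ℂ => φ (s • ξ + r • η)) 0) (D₂ ξ η) 0 := by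
  have hline : ∀ (θ ζ : E), HasDerivAt (fun s : ℂ => θ + s • ζ) ζ 0 := by
    intro θ ζ
    simpa using ((hasDerivAt_id (0 : ℂ)).smul_const ζ).const_add θ
  have hinv : ∀ (θ ζ : E), DifferentiableAt ℂ φ θ →
      HasDerivAt (fun r : ℂ => φ (θ + r • ζ)) (fderiv ℂ φ θ ζ) 0 := by
    intro θ ζ hd
    have h0 : HasFDerivAt φ (fderiv ℂ φ θ) (θ + (0 : ℂ) • ζ) := by simpa using hd.hasFDerivAt
    exact h0.comp_hasDerivAt (0 : ℂ) (hline θ ζ)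
  have hev : ∀ᶠ θ in nhds (0 : E), DifferentiableAt ℂ φ θ :=
    hφ.eventually_analyticAt.mono fun θ h => h.differentiableAt
  refine ⟨fun ξ => fderiv ℂ φ 0 ξ, fun ξ η => fderiv ℂ (fderiv ℂ φ) 0 ξ η, fun ξ => ?_,
    fun ξ η => hφ.contDiffAt.isSymmSndFDerivAt_of_omega ξ η, fun ξ η => ?_⟩
  · simpa using hinv 0 ξ hφ.differentiableAt
  · have hl0 : HasDerivAt (fun s : ℂ => s • ξ) ξ 0 := by simpa using hline 0 ξ
    have h0 : HasFDerivAt (fderiv ℂ φ) (fderiv ℂ (fderiv ℂ φ) 0) ((0 : ℂ) • ξ) := by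
      simpa using hφ.fderiv.differentiableAt.hasFDerivAt
    have h2 : HasDerivAt (fun s : ℂ => fderiv ℂ φ (s • ξ)) (fderiv ℂ (fderiv ℂ φ) 0 ξ) 0 :=
      h0.comp_hasDerivAt (0 : ℂ) hl0
    have h1 : HasDerivAt (fun s : ℂ => fderiv ℂ φ (s • ξ) η) (fderiv ℂ (fderiv ℂ φ) 0 ξ η) 0 := by
      simpa using h2.clm_apply (hasDerivAt_const (0 : ℂ) η)
    have hcont : Filter.Tendsto (fun s : ℂ => s • ξ) (nhds 0) (nhds (0 : E)) := by
      simpa using hl0.continuousAt.tendsto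
    refine h1.congr_of_eventuallyEq ?_
    -- The inner `deriv` equals the value of `fderiv` only where `φ` is differentiable, hence only
    -- for `s` near `0`.
    filter_upwards [hcont.eventually hev] with s hs
    exact (hinv _ _ hs).deriv

/-- The connection is torsion free and the translation invariant connection is flat: only the
commutator of the connection form contributes to the curvature. -/
theorem curvature_eq {x : Total R} (hx : x ∈ complement R) {ω : Total R → Cotangent R}
    (hω : HolomorphicNear R ω x) (ξ η : TotalLie R) :
    curvature R k a b ξ η ω x =
      connForm R k a b x ξ (connForm R k a b x η (ω x)) -
        connForm R k a b x η (connForm R k a b x ξ (ω x)) := by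
  obtain ⟨D, D₂, hD, hsymm, hD₂⟩ := AnalyticAt.exists_derivatives hω
  have hx1 : x * totalExp R 0 = x := by rw [totalExp_zero, total_mul_one]
  have key : ∀ ξ η : TotalLie R, covDeriv R k a b ξ (covDeriv R k a b η ω) x =
      D₂ ξ η + connFormDeriv R k x ξ η (ω x)
        + connForm R k a b x η (D ξ) + connForm R k a b x ξ (D η)
        + connForm R k a b x ξ (connForm R k a b x η (ω x)) := by
    intro ξ η
    have h4 := (hD₂ ξ η).add (hasDerivAt_connForm R k a b hx ξ η (hD ξ))
    have h5 : HasDerivAt (fun s : ℂ => covDeriv R k a b η ω (x * totalExp R (s • ξ)))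
        (D₂ ξ η + (connFormDeriv R k x ξ η (ω (x * totalExp R ((0 : ℂ) • ξ))) +
          connForm R k a b x η (D ξ))) 0 := by
      refine h4.congr_of_eventuallyEq (Filter.Eventually.of_forall fun s => ?_)
      simp only [covDeriv, invDeriv, totalExp_add, Pi.add_apply, total_mul_assoc]
    have h6 : invDeriv R η ω x = D η := (hD η).deriv
    rw [covDeriv, invDeriv, h5.deriv, covDeriv, h6, connForm_add, zero_smul, hx1]
    abel
  rw [curvature, key, key, hsymm, connFormDeriv_symm]
  abel

/-- A vector `(0, s)` acts as the scalar `-s`, so only the `𝔥`-components of `ξ` and `η` survive.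
The terms with `θ.2` cancel because the product and `a` are symmetric. -/
theorem connForm_commutator_apply (x : Total R) (ξ η θ : TotalLie R) (ω : Cotangent R)
    (ha : ∀ u v, a u v = a v u) (hb : ∀ u v, b u v = b v u) :
    (connForm R k a b x ξ (connForm R k a b x η ω) -
        connForm R k a b x η (connForm R k a b x ξ ω)) θ =
      basePart R ω (fibreProduct R k b x η.1 (fibreProduct R k b x ξ.1 θ.1)
        - fibreProduct R k b x ξ.1 (fibreProduct R k b x η.1 θ.1)
        - (a ξ.1 θ.1 • η.1 - a η.1 θ.1 • ξ.1))
      + fibrePart R ω * (a η.1 (fibreProduct R k b x ξ.1 θ.1)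
        - a ξ.1 (fibreProduct R k b x η.1 θ.1)) := by
  have hp : fibreProduct R k b x ξ.1 η.1 = fibreProduct R k b x η.1 ξ.1 := by
    simp only [fibreProduct, hb ξ.1 η.1]
    congr 2
    exact Finset.sum_congr rfl fun α _ => by congr 1; ring
  rw [sub_apply]
  simp only [connForm_apply, basePart_connForm, fibrePart_connForm, map_sub, map_smul, smul_eq_mul,
    hp, ha ξ.1 η.1]
  ring

end Reduction

end ToricConnection
end

noncomputable section

open scoped Classical

namespace ToricConnection

/-! ### Flatness in terms of the product on the Lie algebra -/

section Flatness

variable {N : ℕ} (R : Finset (Fin N → ℝ)) (k : (Fin N → ℝ) → ℂ)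
  (a : LieAlg R →ₗ[ℂ] LieAlg R →ₗ[ℂ] ℂ) (b : LieAlg R →ₗ[ℂ] LieAlg R →ₗ[ℂ] LieAlg R)

/-- The curvature is tensorial, so constant differentials test it. Pull-backs of coordinates detect
the vector identity, and `dt/t` detects the self-adjointness for `a`. -/
theorem isFlat_iff (ha : ∀ u v, a u v = a v u) (hb : ∀ u v, b u v = b v u) :
    IsFlat R k a b ↔ ∀ x ∈ complement R, ∀ u v w : LieAlg R,
      fibreProduct R k b x v (fibreProduct R k b x u w)
          - fibreProduct R k b x u (fibreProduct R k b x v w) = a u w • v - a v w • u ∧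
        a v (fibreProduct R k b x u w) = a u (fibreProduct R k b x v w) := by
  constructor
  · intro h x hx u v w
    have key : ∀ ω : Cotangent R,
        basePart R ω (fibreProduct R k b x v (fibreProduct R k b x u w)
          - fibreProduct R k b x u (fibreProduct R k b x v w) - (a u w • v - a v w • u))
        + fibrePart R ω * (a v (fibreProduct R k b x u w) - a u (fibreProduct R k b x v w)) = 0 := by
      intro ω
      have hol : HolomorphicNear R (fun _ => ω) x := analyticAt_const
      have h0 := h x hx _ hol (u, 0) (v, 0)
      rw [curvature_eq R k a b hx hol] at h0
      have h1 := connForm_commutator_apply R k a b x (u, 0) (v, 0) (w, 0) ω ha hb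
      rw [h0] at h1
      exact h1.symm
    constructor
    · rw [← sub_eq_zero]
      refine Subtype.ext (funext fun i => ?_)
      have := key (pull R ((ContinuousLinearMap.proj i).comp (LieAlg R).subtypeL))
      have hf : fibrePart R (pull R ((ContinuousLinearMap.proj i).comp (LieAlg R).subtypeL)) = 0 := by
        change ((0 : LieAlg R) : Fin N → ℂ) i = 0
        rfl
      rw [hf, zero_mul, add_zero] at this
      exact this
    · have := key (dtt R)
      have hf : fibrePart R (dtt R) = 1 := rfl
      have hb0 : ∀ y, basePart R (dtt R) y = 0 := fun y => rfl
      rw [hf, hb0, one_mul, zero_add] at this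
      exact sub_eq_zero.mp this
  · intro h x hx ω hω ξ η
    rw [curvature_eq R k a b hx hω]
    refine ContinuousLinearMap.ext fun θ => ?_
    obtain ⟨h1, h2⟩ := h x hx ξ.1 η.1 θ.1
    rw [connForm_commutator_apply R k a b x ξ η θ _ ha hb, h1, h2, sub_self, sub_self, map_zero,
      mul_zero, add_zero]
    rfl

theorem asForm_apply (x : Fin N → ℝ) (v : LieAlg R) :
    asForm R x v = ∑ i, (x i : ℂ) * (v : Fin N → ℂ) i := by
  simp [asForm]

/-- A vector off the finitely many root hyperplanes is scaled until all `|α(v)| < 1`. Then `α(v)` is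
nonzero and smaller than the period `2π i`, so `exp(α(v)) ≠ 1`. -/
theorem exists_mem_complement (h0 : (0 : Fin N → ℝ) ∉ R) : (complement R).Nonempty := by
  have hne : ∀ α : R, ∃ v, (asForm R α.1).toLinearMap v ≠ 0 := by
    intro α
    refine ⟨⟨cplx α.1, Submodule.subset_span ⟨α.1, α.2, rfl⟩⟩, ?_⟩
    have hα : (∑ i, α.1 i * α.1 i) ≠ 0 := by
      intro h
      rw [Finset.sum_eq_zero_iff_of_nonneg (fun i _ => mul_self_nonneg _)] at h
      exact h0 ((funext fun i => mul_self_eq_zero.mp (h i (Finset.mem_univ i)) : α.1 = 0) ▸ α.2)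
    change asForm R α.1 _ ≠ 0
    rw [asForm_apply]
    simp only [cplx]
    exact_mod_cast hα
  obtain ⟨v, hv⟩ := Module.Dual.exists_forall_ne_zero_of_forall_exists
    (fun α : R => (asForm R α.1).toLinearMap) hne
  set S : ℝ := 1 + ∑ α : R, ‖asForm R α.1 v‖ with hS
  have hSpos : 0 < S := by positivity
  have hlt : ∀ α : R, ‖asForm R α.1 v‖ < S := by
    intro α
    have := Finset.single_le_sum (f := fun α : R => ‖asForm R α.1 v‖)
      (fun i _ => norm_nonneg _) (Finset.mem_univ α)
    linarith
  refine ⟨(torusExp R (((S⁻¹ : ℝ) : ℂ) • v), 1), fun α => ?_⟩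
  have hval : rootChar R α (torusExp R (((S⁻¹ : ℝ) : ℂ) • v)) =
      Complex.exp (((S⁻¹ : ℝ) : ℂ) * asForm R α.1 v) := by
    simp [rootChar, torusExp]
  rw [hval, Ne, Complex.exp_eq_one_iff]
  rintro ⟨m, hm⟩
  have hnorm : ‖((S⁻¹ : ℝ) : ℂ) * asForm R α.1 v‖ < 1 := by
    rw [norm_mul, Complex.norm_real, Real.norm_of_nonneg (by positivity), inv_mul_lt_one₀ hSpos]
    exact hlt α
  have hm0 : m = 0 := by
    by_contra hm0
    rw [hm] at hnorm
    have h1 : (1 : ℝ) ≤ |(m : ℝ)| := by exact_mod_cast Int.one_le_abs hm0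
    have h2 : ‖(m : ℂ) * (2 * Real.pi * Complex.I)‖ = |(m : ℝ)| * (2 * Real.pi) := by
      rw [norm_mul, Complex.norm_intCast]
      simp [abs_of_pos Real.pi_pos]
    rw [h2] at hnorm
    nlinarith [Real.pi_gt_three]
  rw [hm0, Int.cast_zero, zero_mul] at hm
  rcases mul_eq_zero.mp hm with h | h
  · exact hSpos.ne' (by simpa using h)
  · exact hv α h

theorem stdForm_apply (u v : LieAlg R) :
    stdForm R u v = ∑ i, (u : Fin N → ℂ) i * (v : Fin N → ℂ) i := rfl

theorem stdForm_symm (u v : LieAlg R) : stdForm R u v = stdForm R v u := by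
  simp only [stdForm_apply, mul_comm]

theorem stdForm_coroot (α : R) (v : LieAlg R) :
    stdForm R v (coroot R α) = ((2 / ∑ i, α.1 i * α.1 i : ℝ) : ℂ) * asForm R α.1 v := by
  rw [coroot, map_smul, smul_eq_mul, asForm_apply, stdForm_apply]
  simp only [cplx, mul_comm]

variable {R k a b} in
/-- If the curvature of the fibrewise product is that of the form `c • (·, ·)`, then flatness of the
connection means that the form is `c • (·, ·)`. -/
theorem isFlat_of_eq_smul_stdForm {c : ℂ} (hb : ∀ u v, b u v = b v u)
    (hbs : ∀ u v w, stdForm R v (b u w) = stdForm R u (b v w))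
    (hc : ∀ x ∈ complement R, ∀ u v w : LieAlg R,
      fibreProduct R k b x v (fibreProduct R k b x u w)
          - fibreProduct R k b x u (fibreProduct R k b x v w) =
        c • (stdForm R u w • v - stdForm R v w • u))
    (ha : a = c • stdForm R) : IsFlat R k a b := by
  subst ha
  rw [isFlat_iff R k _ b (fun u v => by simp [stdForm_symm R u v]) hb]
  intro x hx u v w
  refine ⟨?_, ?_⟩
  · rw [hc x hx]
    simp [smul_sub, smul_smul]
  · simp only [LinearMap.smul_apply, fibreProduct, map_add, map_smul, map_sum, stdForm_coroot,
      hbs u v w]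
    congr 2
    exact Finset.sum_congr rfl fun α _ => by simp only [smul_eq_mul]; ring

variable {R k a b} in
-- The difference `d = a - c (·,·)` satisfies `d(u,w) v = d(v,w) u`. Two independent roots give
-- `d(β, w) = 0` for one root `β`, and taking `v = β` then kills `d`. A single point of the
-- complement is enough.
theorem eq_smul_stdForm_of_isFlat {c : ℂ} (ha : ∀ u v, a u v = a v u) (hb : ∀ u v, b u v = b v u)
    (hc : ∀ x ∈ complement R, ∀ u v w : LieAlg R,
      fibreProduct R k b x v (fibreProduct R k b x u w)
          - fibreProduct R k b x u (fibreProduct R k b x v w) =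
        c • (stdForm R u w • v - stdForm R v w • u))
    (h0 : (0 : Fin N → ℝ) ∉ R)
    (hind : ∃ α ∈ R, ∃ β ∈ R, ∀ s t : ℂ, s • cplx α = t • cplx β → s = 0 ∧ t = 0)
    (h : IsFlat R k a b) : a = c • stdForm R := by
  rw [isFlat_iff R k a b ha hb] at h
  obtain ⟨x, hx⟩ := exists_mem_complement R h0
  have key : ∀ u v w : LieAlg R, (a - c • stdForm R) u w • v = (a - c • stdForm R) v w • u := by
    intro u v w
    have := (h x hx u v w).1
    rw [hc x hx] at this
    simp only [LinearMap.sub_apply, LinearMap.smul_apply, smul_eq_mul]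
    linear_combination (norm := module) (-1 : ℂ) • this
  obtain ⟨α, hα, β, hβ, hαβ⟩ := hind
  set α' : LieAlg R := ⟨cplx α, Submodule.subset_span ⟨α, hα, rfl⟩⟩ with hα'
  set β' : LieAlg R := ⟨cplx β, Submodule.subset_span ⟨β, hβ, rfl⟩⟩ with hβ'
  have hzero : ∀ w, (a - c • stdForm R) β' w = 0 := fun w =>
    (hαβ _ _ (congrArg Subtype.val (key β' α' w))).1
  have hne : β' ≠ 0 := by
    intro h
    have h1 : cplx β = 0 := congrArg Subtype.val h
    have := (hαβ 0 1 (by rw [h1]; simp)).2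
    exact one_ne_zero this
  rw [← sub_eq_zero]
  refine LinearMap.ext fun u => LinearMap.ext fun w => ?_
  have h1 := key β' u w
  rw [hzero, zero_smul] at h1
  exact (smul_eq_zero.mp h1.symm).resolve_right hne

end Flatness

end ToricConnection
end

noncomputable section

open scoped Classical

namespace ToricConnection

open Matrix

/-! ### Sums over triples of roots with sum zero -/

section Triples

/-- Sums over pairs of roots of terms that come from triples of roots with sum zero. -/
theorem sum_pairs_eq_zero {V : Type*} [AddCommGroup V] (R : Finset V) (hneg : ∀ α ∈ R, -α ∈ R)
    (m w F X : V → V → ℂ)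
    (hm : ∀ α ∈ R, ∀ β ∈ R, m α β * X α β =
      ((if α + β ∈ R then w α β else 0) - (if α - β ∈ R then w α (-β) else 0)) * X α β)
    (hw : ∀ α β, w β (-(α + β)) = w α β)
    (hX : ∀ α β, X β (-(α + β)) = X α β) (hXn : ∀ α β, X α (-β) = X α β)
    (hFn : ∀ α ∈ R, ∀ β ∈ R, F α (-β) = -F α β)
    (hF : ∀ α ∈ R, ∀ β ∈ R, α + β ∈ R →
      F α β + F β (-(α + β)) + F (-(α + β)) α = 0) :
    ∑ α ∈ R, ∑ β ∈ R, m α β * F α β * X α β = 0 := by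
  set G : V → V → ℂ := fun α β => (if α + β ∈ R then w α β else 0) * F α β * X α β with hG
  have hneg' : ∀ α, -α ∈ R ↔ α ∈ R := fun α => ⟨fun h => by simpa using hneg _ h, hneg α⟩
  have h1 : ∑ α ∈ R, ∑ β ∈ R, m α β * F α β * X α β =
      ∑ α ∈ R, ∑ β ∈ R, G α β + ∑ α ∈ R, ∑ β ∈ R, G α (-β) := by
    rw [← Finset.sum_add_distrib]
    refine Finset.sum_congr rfl fun α hα => ?_
    rw [← Finset.sum_add_distrib]
    refine Finset.sum_congr rfl fun β hβ => ?_
    have := hm α hα β hβ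
    simp only [hG, ← sub_eq_add_neg, hXn, hFn α hα β hβ]
    linear_combination F α β * this
  have h2 : ∑ α ∈ R, ∑ β ∈ R, G α (-β) = ∑ α ∈ R, ∑ β ∈ R, G α β := by
    refine Finset.sum_congr rfl fun α _ => ?_
    exact Finset.sum_nbij' (fun β => -β) (fun β => -β) hneg hneg (fun _ _ => neg_neg _)
      (fun _ _ => neg_neg _) (fun _ _ => rfl)
  set P : Finset (V × V) := (R ×ˢ R).filter (fun p => p.1 + p.2 ∈ R) with hP
  have h3 : ∑ α ∈ R, ∑ β ∈ R, G α β = ∑ p ∈ P, w p.1 p.2 * F p.1 p.2 * X p.1 p.2 := by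
    rw [← Finset.sum_product', hP, Finset.sum_filter]
    refine Finset.sum_congr rfl fun p _ => ?_
    simp only [hG]
    split_ifs <;> ring
  have hmem : ∀ p : V × V, p ∈ P ↔ p.1 ∈ R ∧ p.2 ∈ R ∧ p.1 + p.2 ∈ R := by
    intro p
    simp [hP, and_assoc]
  -- With `γ = -(α + β)`, the rotation `(α, β) ↦ (β, γ)` permutes the pairs whose sum is a root.
  have rot : ∀ g : V × V → ℂ, ∑ p ∈ P, g p = ∑ p ∈ P, g (p.2, -(p.1 + p.2)) := by
    intro g
    symm
    refine Finset.sum_nbij' (fun p => (p.2, -(p.1 + p.2))) (fun p => (-(p.1 + p.2), p.1))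
      ?_ ?_ ?_ ?_ (fun _ _ => rfl)
    · intro p hp
      obtain ⟨h1, h2, h3⟩ := (hmem p).mp hp
      refine (hmem _).mpr ⟨h2, hneg _ h3, ?_⟩
      have : p.2 + -(p.1 + p.2) = -p.1 := by abel
      simpa only [this] using hneg _ h1
    · intro p hp
      obtain ⟨h1, h2, h3⟩ := (hmem p).mp hp
      refine (hmem _).mpr ⟨hneg _ h3, h1, ?_⟩
      have : -(p.1 + p.2) + p.1 = -p.2 := by abel
      simpa only [this] using hneg _ h2
    · intro p _
      refine Prod.ext ?_ rfl
      change -(p.2 + -(p.1 + p.2)) = p.1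
      abel
    · intro p _
      refine Prod.ext rfl ?_
      change -(-(p.1 + p.2) + p.1) = p.2
      abel
  set g : V × V → ℂ := fun p => w p.1 p.2 * F p.1 p.2 * X p.1 p.2 with hg
  -- Three copies of the sum are rotated against each other. As `w` and `X` are invariant, the
  -- cyclic sum of `F` factors out, and it vanishes.
  have h4 : ∑ p ∈ P, g p + ∑ p ∈ P, g p + ∑ p ∈ P, g p = 0 := by
    have r1 := rot g
    have r2 := rot (fun p => g (p.2, -(p.1 + p.2)))
    have e : ∑ p ∈ P, g p + ∑ p ∈ P, g p + ∑ p ∈ P, g p = ∑ p ∈ P,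
        (g p + g (p.2, -(p.1 + p.2)) + g (-(p.1 + p.2), -(p.2 + -(p.1 + p.2)))) := by
      rw [Finset.sum_add_distrib, Finset.sum_add_distrib, ← r2, ← r1]
    rw [e]
    refine Finset.sum_eq_zero fun p hp => ?_
    obtain ⟨m1, m2, m3⟩ := (hmem p).mp hp
    have hp1 : -(p.2 + -(p.1 + p.2)) = p.1 := by abel
    have w3 := hw p.2 (-(p.1 + p.2))
    have X3 := hX p.2 (-(p.1 + p.2))
    rw [hp1] at w3 X3
    simp only [hg, hp1, w3, X3, hw, hX]
    linear_combination (w p.1 p.2 * X p.1 p.2) * hF p.1 m1 p.2 m2 m3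
  have h5 : ∑ p ∈ P, g p = 0 := by
    linear_combination (1 / 3 : ℂ) * h4
  rw [h1, h2, h3]
  simp only [hg] at h5
  rw [h5, add_zero]

end Triples

end ToricConnection
end

noncomputable section

open scoped Classical

namespace ToricConnection

open Matrix

/-- A finite set of nonzero vectors that is stable under its reflections and crystallographic. -/
structure IsCrystallographic {N : ℕ} (R : Finset (Fin N → ℝ)) : Prop where
  refl : ∀ α ∈ R, ∀ β ∈ R, realReflection α β ∈ R
  int : ∀ α ∈ R, ∀ β ∈ R, ∃ m : ℤ, 2 * (β ⬝ᵥ α) = m * (α ⬝ᵥ α)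
  ne_zero : (0 : Fin N → ℝ) ∉ R

/-! ### Inner products, linear forms and bivectors -/

section Dot

variable {N : ℕ}

theorem realReflection_eq (α β : Fin N → ℝ) :
    realReflection α β = β - (2 * (β ⬝ᵥ α) / (α ⬝ᵥ α)) • α := rfl

theorem dot_self_pos {α : Fin N → ℝ} (h : α ≠ 0) : 0 < α ⬝ᵥ α := by
  refine lt_of_le_of_ne (Finset.sum_nonneg fun i _ => mul_self_nonneg _) fun h0 => h ?_
  exact dotProduct_self_eq_zero.mp h0.symm

theorem dot_add_self (α β : Fin N → ℝ) :
    (α + β) ⬝ᵥ (α + β) = α ⬝ᵥ α + 2 * (α ⬝ᵥ β) + β ⬝ᵥ β := by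
  simp only [add_dotProduct, dotProduct_add, dotProduct_comm β α]; ring

theorem dot_sub_self (α β : Fin N → ℝ) :
    (α - β) ⬝ᵥ (α - β) = α ⬝ᵥ α - 2 * (α ⬝ᵥ β) + β ⬝ᵥ β := by
  simp only [sub_dotProduct, dotProduct_sub, dotProduct_comm β α]; ring

theorem realReflection_of_dot {α β : Fin N → ℝ} {c : ℝ} (hα : α ≠ 0)
    (h : 2 * (β ⬝ᵥ α) = c * (α ⬝ᵥ α)) : realReflection α β = β - c • α := by
  rw [realReflection_eq, h, mul_div_assoc, div_self (dot_self_pos hα).ne', mul_one]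

theorem IsCrystallographic.neg {R : Finset (Fin N → ℝ)} (hR : IsCrystallographic R)
    {α : Fin N → ℝ} (h : α ∈ R) : -α ∈ R := by
  have h0 : α ≠ 0 := fun h0 => hR.ne_zero (h0 ▸ h)
  have := hR.refl α h α h
  rw [realReflection_of_dot h0 rfl] at this
  convert this using 1
  module

/-- The linear form `(α, ·)` on `ℂ^N` defined by a real vector. -/
def lin (α : Fin N → ℝ) (u : Fin N → ℂ) : ℂ := cplx α ⬝ᵥ u

theorem lin_add (α β : Fin N → ℝ) (u : Fin N → ℂ) : lin (α + β) u = lin α u + lin β u := by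
  simp [lin, cplx, dotProduct, add_mul, Finset.sum_add_distrib]

theorem lin_neg (α : Fin N → ℝ) (u : Fin N → ℂ) : lin (-α) u = -lin α u := by
  simp [lin, cplx, dotProduct]

/-- The product of two copies of the bivector `α ∧ β`, evaluated on `(u, v)` and `(w, t)`. -/
def bivectorSquare (u v w t : Fin N → ℂ) (α β : Fin N → ℝ) : ℂ :=
  (lin α v * lin β u - lin α u * lin β v) * (lin β w * lin α t - lin α w * lin β t)

/-- For `α + β + γ = 0` one has `β ∧ γ = -(β ∧ α) = α ∧ β`. -/
theorem bivectorSquare_rot (u v w t : Fin N → ℂ) (α β : Fin N → ℝ) :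
    bivectorSquare u v w t β (-(α + β)) = bivectorSquare u v w t α β := by
  simp only [bivectorSquare, lin_add, lin_neg]; ring

theorem bivectorSquare_neg (u v w t : Fin N → ℂ) (α β : Fin N → ℝ) :
    bivectorSquare u v w t α (-β) = bivectorSquare u v w t α β := by
  simp only [bivectorSquare, lin_neg]; ring

theorem bivectorSquare_self (u v w t : Fin N → ℂ) (α : Fin N → ℝ) :
    bivectorSquare u v w t α α = 0 := by
  simp only [bivectorSquare]; ring

end Dot

/-- A function on a set of vectors that satisfies the functional equation of the hyperbolic
cotangent. -/
structure IsCoth {N : ℕ} (R : Finset (Fin N → ℝ)) (f : (Fin N → ℝ) → ℂ) : Prop where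
  neg : ∀ α ∈ R, f (-α) = -f α
  add : ∀ α ∈ R, ∀ β ∈ R, α + β ∈ R → f (α + β) * (f α + f β) = f α * f β + 1

/-! ### Elimination of the hyperbolic cotangents when the length ratio is two -/

section TwoLengths

variable {N : ℕ} {R : Finset (Fin N → ℝ)}

/-- Reduction of a sum over pairs of roots with coefficients `f α * f β` to a constant one, given
weights for the triples of roots with sum zero. -/
theorem sum_coth_eq (hR : IsCrystallographic R) {f : (Fin N → ℝ) → ℂ} (hf : IsCoth R f)
    (m w : (Fin N → ℝ) → (Fin N → ℝ) → ℂ) (t : ℝ → ℝ → ℝ) (u v x y : Fin N → ℂ)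
    (hm : ∀ α ∈ R, ∀ β ∈ R, α ≠ β → α ≠ -β → m α β =
      (if α + β ∈ R then w α β else 0) - (if α - β ∈ R then w α (-β) else 0))
    (hw : ∀ α β, w β (-(α + β)) = w α β)
    (ht : ∀ α ∈ R, ∀ β ∈ R, α + β ∈ R → ∀ a b c : ℝ, α ⬝ᵥ α = a → β ⬝ᵥ β = b →
      (α + β) ⬝ᵥ (α + β) = c →
      t a b * (c - a - b) / 2 + t b c * (a - b - c) / 2 + t c a * (b - a - c) / 2 = -1) :
    ∑ α ∈ R, ∑ β ∈ R, m α β * (f α * f β) * bivectorSquare u v x y α β =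
      ∑ α ∈ R, ∑ β ∈ R, m α β * ((t (α ⬝ᵥ α) (β ⬝ᵥ β) * (α ⬝ᵥ β) : ℝ) : ℂ) *
        bivectorSquare u v x y α β := by
  rw [← sub_eq_zero, ← Finset.sum_sub_distrib]
  simp only [← Finset.sum_sub_distrib, ← sub_mul, ← mul_sub]
  refine sum_pairs_eq_zero R (fun α h => hR.neg h) m w
    (fun α β => f α * f β - ((t (α ⬝ᵥ α) (β ⬝ᵥ β) * (α ⬝ᵥ β) : ℝ) : ℂ))
    (bivectorSquare u v x y) ?_ hw (bivectorSquare_rot u v x y) (bivectorSquare_neg u v x y) ?_ ?_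
  · intro α hα β hβ
    -- The bivector vanishes for `α = ±β`, so the weights need not account for these pairs.
    by_cases h1 : α = β
    · rw [h1, bivectorSquare_self, mul_zero, mul_zero]
    by_cases h2 : α = -β
    · rw [h2, ← bivectorSquare_neg, bivectorSquare_self, mul_zero, mul_zero]
    rw [hm α hα β hβ h1 h2]
    split_ifs <;> rfl
  · intro α hα β hβ
    simp only [hf.neg β hβ, dotProduct_neg, neg_dotProduct, neg_neg]
    push_cast
    ring
  · intro α hα β hβ hαβ
    have h1 := ht α hα β hβ hαβ _ _ _ rfl rfl rfl
    have h2 := hf.add α hα β hβ hαβ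
    have e := dot_add_self α β
    simp only [hf.neg _ hαβ, dotProduct_neg, neg_dotProduct, neg_neg]
    -- In a triple with sum zero the three inner products are determined by the three squared
    -- lengths, which turns `ht` into a statement about inner products.
    have e1 : t (α ⬝ᵥ α) (β ⬝ᵥ β) * (α ⬝ᵥ β) + t (β ⬝ᵥ β) ((α + β) ⬝ᵥ (α + β)) * -(β ⬝ᵥ (α + β))
        + t ((α + β) ⬝ᵥ (α + β)) (α ⬝ᵥ α) * -((α + β) ⬝ᵥ α) = -1 := by
      rw [← h1]
      have d1 : α ⬝ᵥ β = ((α + β) ⬝ᵥ (α + β) - α ⬝ᵥ α - β ⬝ᵥ β) / 2 := by rw [e]; ring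
      have d2 : -(β ⬝ᵥ (α + β)) = (α ⬝ᵥ α - β ⬝ᵥ β - (α + β) ⬝ᵥ (α + β)) / 2 := by
        rw [e, dotProduct_add, dotProduct_comm β α]; ring
      have d3 : -((α + β) ⬝ᵥ α) = (β ⬝ᵥ β - α ⬝ᵥ α - (α + β) ⬝ᵥ (α + β)) / 2 := by
        rw [e, add_dotProduct, dotProduct_comm β α]; ring
      rw [d2, d3]
      conv_lhs => rw [d1]
      ring
    have e2 := congrArg (fun r : ℝ => (r : ℂ)) e1
    push_cast at e2 ⊢
    linear_combination -h2 - e2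

/-- The coefficient of the pair `α, β` in the curvature. -/
def pairCoeff (κ : (Fin N → ℝ) → ℂ) (α β : Fin N → ℝ) : ℂ :=
  κ α * κ β * ((α ⬝ᵥ β / ((α ⬝ᵥ α) * (β ⬝ᵥ β)) : ℝ) : ℂ)

/-- Weights for the triples of roots with sum zero in a root system with squared lengths `ℓ` and
`2 ℓ`. -/
def weightTwo (ℓ : ℝ) (k k' : ℂ) (α β : Fin N → ℝ) : ℂ :=
  if α ⬝ᵥ α = ℓ ∧ β ⬝ᵥ β = ℓ ∧ (α + β) ⬝ᵥ (α + β) = ℓ then -k ^ 2 / (2 * ℓ)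
  else if α ⬝ᵥ α = 2 * ℓ ∧ β ⬝ᵥ β = 2 * ℓ ∧ (α + β) ⬝ᵥ (α + β) = 2 * ℓ then -k' ^ 2 / (4 * ℓ)
  else -(k * k') / (2 * ℓ)

theorem weightTwo_rot (ℓ : ℝ) (k k' : ℂ) (α β : Fin N → ℝ) :
    weightTwo ℓ k k' β (-(α + β)) = weightTwo ℓ k k' α β := by
  have e : β + -(α + β) = -α := by abel
  simp only [weightTwo, e, neg_dotProduct, dotProduct_neg, neg_neg]
  congr 1
  · exact propext ⟨fun h => ⟨h.2.2, h.1, h.2.1⟩, fun h => ⟨h.2.1, h.2.2, h.1⟩⟩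
  · congr 1
    exact propext ⟨fun h => ⟨h.2.2, h.1, h.2.1⟩, fun h => ⟨h.2.1, h.2.2, h.1⟩⟩

/-- For nonorthogonal roots exactly one of `α ± β` is a root, and the weight of that triple is the
coefficient up to sign. For orthogonal roots the coefficient is zero: two short ones have `α + β`
and `α - β` both in `R` or both outside, with equal weights that cancel, and in the other cases
neither is a root. -/
theorem pairCoeff_eq_weightTwo (hR : IsCrystallographic R) {ℓ : ℝ} (hℓ : 0 < ℓ) {k k' : ℂ}
    {κ : (Fin N → ℝ) → ℂ} (hlen : ∀ α ∈ R, α ⬝ᵥ α = ℓ ∧ κ α = k ∨ α ⬝ᵥ α = 2 * ℓ ∧ κ α = k')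
    {α β : Fin N → ℝ} (hα : α ∈ R) (hβ : β ∈ R) (h1 : α ≠ β) (h2 : α ≠ -β) :
    pairCoeff κ α β = (if α + β ∈ R then weightTwo ℓ k k' α β else 0) -
      (if α - β ∈ R then weightTwo ℓ k k' α (-β) else 0) := by
  have hα0 : α ≠ 0 := fun h0 => hR.ne_zero (h0 ▸ hα)
  have hβ0 : β ≠ 0 := fun h0 => hR.ne_zero (h0 ▸ hβ)
  have hsub := dot_self_pos (sub_ne_zero.mpr h1)
  have hadd := dot_self_pos (fun h => h2 (eq_neg_of_add_eq_zero_left h) : α + β ≠ 0)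
  have ea := dot_add_self α β
  have es := dot_sub_self α β
  have hnot : ∀ γ : Fin N → ℝ, γ ⬝ᵥ γ ≠ ℓ → γ ⬝ᵥ γ ≠ 2 * ℓ → γ ∉ R := fun γ n1 n2 h => by
    rcases hlen γ h with h | h
    · exact n1 h.1
    · exact n2 h.1
  have hℓC : (ℓ : ℂ) ≠ 0 := by exact_mod_cast hℓ.ne'
  obtain ⟨mα, hmα⟩ := hR.int α hα β hβ
  obtain ⟨mβ, hmβ⟩ := hR.int β hβ α hα
  have rα := hR.refl α hα β hβ
  have rβ := hR.refl β hβ α hα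
  rw [realReflection_of_dot hα0 hmα] at rα
  rw [realReflection_of_dot hβ0 hmβ] at rβ
  rw [dotProduct_comm β α] at hmα
  simp only [weightTwo, pairCoeff, ← sub_eq_add_neg, neg_dotProduct, dotProduct_neg, neg_neg]
  rcases hlen α hα with ⟨ha, ka⟩ | ⟨ha, ka⟩ <;> rcases hlen β hβ with ⟨hb, kb⟩ | ⟨hb, kb⟩
  all_goals rw [ka, kb]
  all_goals rw [ha] at hmα ea es ⊢
  all_goals rw [hb] at hmβ ea es ⊢
  -- The Cartan integer is taken against a longest root of the pair. Then it lies in `{-1, 0, 1}`,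
  -- as otherwise one of `α ± β` would have squared length at most zero.
  · have : mβ < 2 := by
      by_contra! h
      have : (2 : ℝ) ≤ mβ := by exact_mod_cast h
      nlinarith
    have : -2 < mβ := by
      by_contra! h
      have : (mβ : ℝ) ≤ -2 := by exact_mod_cast h
      nlinarith
    interval_cases mβ
    · have hmem : α + β ∈ R := by convert rβ using 1; push_cast; module
      have hD : α ⬝ᵥ β = -(ℓ / 2) := by push_cast at hmβ; linarith
      have hn : α - β ∉ R := hnot _ (by rw [es, hD]; intro h; linarith)
        (by rw [es, hD]; intro h; linarith)
      have ha' : (α + β) ⬝ᵥ (α + β) = ℓ := by rw [ea, hD]; ring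
      rw [if_pos hmem, if_neg hn, if_pos ⟨rfl, rfl, ha'⟩, hD]
      push_cast
      field_simp
      ring
    · have hD : α ⬝ᵥ β = 0 := by push_cast at hmβ; linarith
      -- For orthogonal `α`, `β` the reflection in `β` exchanges `α + β` and `α - β`.
      have hiff : α + β ∈ R ↔ α - β ∈ R := by
        constructor
        · intro h
          have := hR.refl β hβ _ h
          rw [realReflection_of_dot (c := 2) hβ0 (by rw [add_dotProduct, hD, hb]; ring)] at this
          convert this using 1; module
        · intro h
          have := hR.refl β hβ _ h
          rw [realReflection_of_dot (c := -2) hβ0 (by rw [sub_dotProduct, hD, hb]; ring)] at this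
          convert this using 1; module
      have ha' : (α + β) ⬝ᵥ (α + β) = (α - β) ⬝ᵥ (α - β) := by rw [ea, es, hD]; ring
      rw [hD, ha']
      simp only [hiff]
      simp
    · have hmem : α - β ∈ R := by convert rβ using 1; push_cast; module
      have hD : α ⬝ᵥ β = ℓ / 2 := by push_cast at hmβ; linarith
      have hn : α + β ∉ R := hnot _ (by rw [ea, hD]; intro h; linarith)
        (by rw [ea, hD]; intro h; linarith)
      have ha' : (α - β) ⬝ᵥ (α - β) = ℓ := by rw [es, hD]; ring
      rw [if_pos hmem, if_neg hn, if_pos ⟨rfl, rfl, ha'⟩, hD]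
      push_cast
      field_simp
      ring
  · have e2 := dot_sub_self β ((2 : ℝ) • α)
    have e3 := dot_add_self β ((2 : ℝ) • α)
    have p2 : 0 ≤ (β - (2 : ℝ) • α) ⬝ᵥ (β - (2 : ℝ) • α) :=
      Finset.sum_nonneg fun i _ => mul_self_nonneg _
    have p3 : 0 ≤ (β + (2 : ℝ) • α) ⬝ᵥ (β + (2 : ℝ) • α) :=
      Finset.sum_nonneg fun i _ => mul_self_nonneg _
    simp only [dotProduct_smul, smul_dotProduct, dotProduct_comm β α, ha, hb, smul_eq_mul] at e2 e3
    have : mβ < 2 := by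
      by_contra! h
      have : (2 : ℝ) ≤ mβ := by exact_mod_cast h
      nlinarith
    have : -2 < mβ := by
      by_contra! h
      have : (mβ : ℝ) ≤ -2 := by exact_mod_cast h
      nlinarith
    interval_cases mβ
    · have hmem : α + β ∈ R := by convert rβ using 1; push_cast; module
      have hD : α ⬝ᵥ β = -ℓ := by push_cast at hmβ; linarith
      have hn : α - β ∉ R := hnot _ (by rw [es, hD]; intro h; linarith)
        (by rw [es, hD]; intro h; linarith)
      rw [if_pos hmem, if_neg hn, if_neg (fun h => by linarith [h.2.1]),
        if_neg (fun h => by linarith [h.1]), hD]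
      push_cast
      field_simp
      ring
    · have hD : α ⬝ᵥ β = 0 := by push_cast at hmβ; linarith
      have hn : α - β ∉ R := hnot _ (by rw [es, hD]; intro h; linarith)
        (by rw [es, hD]; intro h; linarith)
      have hn' : α + β ∉ R := hnot _ (by rw [ea, hD]; intro h; linarith)
        (by rw [ea, hD]; intro h; linarith)
      rw [if_neg hn, if_neg hn', hD]
      simp
    · have hmem : α - β ∈ R := by convert rβ using 1; push_cast; module
      have hD : α ⬝ᵥ β = ℓ := by push_cast at hmβ; linarith
      have hn : α + β ∉ R := hnot _ (by rw [ea, hD]; intro h; linarith)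
        (by rw [ea, hD]; intro h; linarith)
      rw [if_pos hmem, if_neg hn, if_neg (fun h => by linarith [h.2.1]),
        if_neg (fun h => by linarith [h.1]), hD]
      push_cast
      field_simp
      ring
  · have e2 := dot_sub_self α ((2 : ℝ) • β)
    have e3 := dot_add_self α ((2 : ℝ) • β)
    have p2 : 0 ≤ (α - (2 : ℝ) • β) ⬝ᵥ (α - (2 : ℝ) • β) :=
      Finset.sum_nonneg fun i _ => mul_self_nonneg _
    have p3 : 0 ≤ (α + (2 : ℝ) • β) ⬝ᵥ (α + (2 : ℝ) • β) :=
      Finset.sum_nonneg fun i _ => mul_self_nonneg _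
    simp only [dotProduct_smul, smul_dotProduct, ha, hb, smul_eq_mul] at e2 e3
    have : mα < 2 := by
      by_contra! h
      have : (2 : ℝ) ≤ mα := by exact_mod_cast h
      nlinarith
    have : -2 < mα := by
      by_contra! h
      have : (mα : ℝ) ≤ -2 := by exact_mod_cast h
      nlinarith
    interval_cases mα
    · have hmem : α + β ∈ R := by convert rα using 1; push_cast; module
      have hD : α ⬝ᵥ β = -ℓ := by push_cast at hmα; linarith
      have hn : α - β ∉ R := hnot _ (by rw [es, hD]; intro h; linarith)
        (by rw [es, hD]; intro h; linarith)
      rw [if_pos hmem, if_neg hn, if_neg (fun h => by linarith [h.1]),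
        if_neg (fun h => by linarith [h.2.1]), hD]
      push_cast
      field_simp
      ring
    · have hD : α ⬝ᵥ β = 0 := by push_cast at hmα; linarith
      have hn : α - β ∉ R := hnot _ (by rw [es, hD]; intro h; linarith)
        (by rw [es, hD]; intro h; linarith)
      have hn' : α + β ∉ R := hnot _ (by rw [ea, hD]; intro h; linarith)
        (by rw [ea, hD]; intro h; linarith)
      rw [if_neg hn, if_neg hn', hD]
      simp
    · have hmem : α - β ∈ R := by
        have := hR.neg rα
        convert this using 1; push_cast; module
      have hD : α ⬝ᵥ β = ℓ := by push_cast at hmα; linarith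
      have hn : α + β ∉ R := hnot _ (by rw [ea, hD]; intro h; linarith)
        (by rw [ea, hD]; intro h; linarith)
      rw [if_pos hmem, if_neg hn, if_neg (fun h => by linarith [h.1]),
        if_neg (fun h => by linarith [h.2.1]), hD]
      push_cast
      field_simp
      ring
  · have : mβ < 2 := by
      by_contra! h
      have : (2 : ℝ) ≤ mβ := by exact_mod_cast h
      nlinarith
    have : -2 < mβ := by
      by_contra! h
      have : (mβ : ℝ) ≤ -2 := by exact_mod_cast h
      nlinarith
    interval_cases mβ
    · have hmem : α + β ∈ R := by convert rβ using 1; push_cast; module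
      have hD : α ⬝ᵥ β = -ℓ := by push_cast at hmβ; linarith
      have hn : α - β ∉ R := hnot _ (by rw [es, hD]; intro h; linarith)
        (by rw [es, hD]; intro h; linarith)
      have ha' : (α + β) ⬝ᵥ (α + β) = 2 * ℓ := by rw [ea, hD]; ring
      rw [if_pos hmem, if_neg hn, if_neg (fun h => by linarith [h.1]), if_pos ⟨rfl, rfl, ha'⟩, hD]
      push_cast
      field_simp
      ring
    · have hD : α ⬝ᵥ β = 0 := by push_cast at hmβ; linarith
      have hn : α - β ∉ R := hnot _ (by rw [es, hD]; intro h; linarith)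
        (by rw [es, hD]; intro h; linarith)
      have hn' : α + β ∉ R := hnot _ (by rw [ea, hD]; intro h; linarith)
        (by rw [ea, hD]; intro h; linarith)
      rw [if_neg hn, if_neg hn', hD]
      simp
    · have hmem : α - β ∈ R := by convert rβ using 1; push_cast; module
      have hD : α ⬝ᵥ β = ℓ := by push_cast at hmβ; linarith
      have hn : α + β ∉ R := hnot _ (by rw [ea, hD]; intro h; linarith)
        (by rw [ea, hD]; intro h; linarith)
      have ha' : (α - β) ⬝ᵥ (α - β) = 2 * ℓ := by rw [es, hD]; ring
      rw [if_pos hmem, if_neg hn, if_neg (fun h => by linarith [h.1]), if_pos ⟨rfl, rfl, ha'⟩, hD]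
      push_cast
      field_simp
      ring

/-- Scale factors that make the sum of the inner products over a triple of roots with sum zero
equal to `-1`, for squared lengths `ℓ` and `2 ℓ`. -/
def scaleTwo (ℓ a b : ℝ) : ℝ :=
  if a = ℓ ∧ b = ℓ then 2 / (3 * ℓ) else if a = 2 * ℓ ∧ b = 2 * ℓ then 1 / (3 * ℓ) else 1 / (2 * ℓ)

/-- The inner products in a triple are three times `-ℓ/2` (all short), three times `-ℓ` (all long),
or `0, -ℓ, -ℓ` (one long root). One short and two long roots are impossible: the Cartan integer
against a long root would be half-integral. -/
theorem scaleTwo_sum (hR : IsCrystallographic R) {ℓ : ℝ} (hℓ : 0 < ℓ)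
    (hlen : ∀ α ∈ R, α ⬝ᵥ α = ℓ ∨ α ⬝ᵥ α = 2 * ℓ)
    {α β : Fin N → ℝ} (hα : α ∈ R) (hβ : β ∈ R) (hαβ : α + β ∈ R) {a b c : ℝ}
    (ha : α ⬝ᵥ α = a) (hb : β ⬝ᵥ β = b) (hc : (α + β) ⬝ᵥ (α + β) = c) :
    scaleTwo ℓ a b * (c - a - b) / 2 + scaleTwo ℓ b c * (a - b - c) / 2
      + scaleTwo ℓ c a * (b - a - c) / 2 = -1 := by
  obtain ⟨mα, hmα⟩ := hR.int α hα β hβ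
  obtain ⟨mβ, hmβ⟩ := hR.int β hβ α hα
  have e := dot_add_self α β
  rw [dotProduct_comm β α] at hmα
  have h12 : ¬ ℓ = 2 * ℓ := fun h => by linarith
  have h21 : ¬ 2 * ℓ = ℓ := fun h => by linarith
  have odd : ∀ m : ℤ, (2 : ℝ) * m ≠ -3 := by
    intro m h
    have : 2 * m = -3 := by exact_mod_cast h
    omega
  have odd' : ∀ m : ℤ, (2 : ℝ) * m ≠ -1 := by
    intro m h
    have : 2 * m = -1 := by exact_mod_cast h
    omega
  rcases hlen α hα with h1 | h1 <;> rcases hlen β hβ with h2 | h2 <;>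
    rcases hlen _ hαβ with h3 | h3 <;>
    rw [h1] at ha hmα e <;> rw [h2] at hb hmβ e <;> rw [h3] at hc e <;> subst ha hb hc <;>
    simp only [scaleTwo, and_self, if_true, h12, h21, and_false, false_and, if_false]
  · field_simp; ring
  · field_simp; ring
  · field_simp; ring
  · exact absurd (mul_right_cancel₀ hℓ.ne' (by linarith : (2 * (mβ : ℝ)) * ℓ = -1 * ℓ)) (odd' _)
  · field_simp; ring
  · exact absurd (mul_right_cancel₀ hℓ.ne' (by linarith : (2 * (mα : ℝ)) * ℓ = -1 * ℓ)) (odd' _)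
  · exact absurd (mul_right_cancel₀ hℓ.ne' (by linarith : (2 * (mα : ℝ)) * ℓ = -3 * ℓ)) (odd _)
  · field_simp; ring

theorem sum_coth_two_lengths (hR : IsCrystallographic R) {f : (Fin N → ℝ) → ℂ} (hf : IsCoth R f)
    {ℓ : ℝ} (hℓ : 0 < ℓ) {k k' : ℂ} {κ : (Fin N → ℝ) → ℂ}
    (hlen : ∀ α ∈ R, α ⬝ᵥ α = ℓ ∧ κ α = k ∨ α ⬝ᵥ α = 2 * ℓ ∧ κ α = k') (u v x y : Fin N → ℂ) :
    ∑ α ∈ R, ∑ β ∈ R, pairCoeff κ α β * (f α * f β) * bivectorSquare u v x y α β =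
      ∑ α ∈ R, ∑ β ∈ R, pairCoeff κ α β *
        ((scaleTwo ℓ (α ⬝ᵥ α) (β ⬝ᵥ β) * (α ⬝ᵥ β) : ℝ) : ℂ) * bivectorSquare u v x y α β :=
  sum_coth_eq hR hf _ (weightTwo ℓ k k') (scaleTwo ℓ) u v x y
    (fun _ hα _ hβ h1 h2 => pairCoeff_eq_weightTwo hR hℓ hlen hα hβ h1 h2) (weightTwo_rot ℓ k k')
    (fun _ hα _ hβ hαβ _ _ _ ha hb hc => scaleTwo_sum hR hℓ
      (fun α hα => (hlen α hα).imp And.left And.left) hα hβ hαβ ha hb hc)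

end TwoLengths

end ToricConnection
end

noncomputable section

open scoped Classical

namespace ToricConnection

open Matrix

/-! ### The commutator of the product as a sum over pairs of roots -/

section Curvature

variable {N : ℕ} (R : Finset (Fin N → ℝ))

theorem asForm_eq_lin (x : Fin N → ℝ) (v : LieAlg R) : asForm R x v = lin x v := by
  rw [asForm_apply]; rfl

theorem stdForm_eq (u v : LieAlg R) : stdForm R u v = (u : Fin N → ℂ) ⬝ᵥ (v : Fin N → ℂ) := rfl

theorem cplx_dotProduct (α β : Fin N → ℝ) : cplx α ⬝ᵥ cplx β = ((α ⬝ᵥ β : ℝ) : ℂ) := by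
  simp [cplx, dotProduct]

theorem lin_cplx (α β : Fin N → ℝ) : lin α (cplx β) = ((α ⬝ᵥ β : ℝ) : ℂ) := cplx_dotProduct α β

/-- A root as an element of `𝔥`. -/
def rootVec (α : R) : LieAlg R := ⟨cplx α.1, Submodule.subset_span ⟨α.1, α.2, rfl⟩⟩

theorem coroot_eq (α : R) : coroot R α = ((2 / (α.1 ⬝ᵥ α.1) : ℝ) : ℂ) • rootVec R α := rfl

variable {R} in
theorem conj_mem_lieAlg {u : Fin N → ℂ} (hu : u ∈ LieAlg R) : star u ∈ LieAlg R := by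
  induction hu using Submodule.span_induction with
  | mem x hx =>
    obtain ⟨α, hα, rfl⟩ := hx
    refine Submodule.subset_span ⟨α, hα, ?_⟩
    ext i
    simp [cplx]
  | zero => simp
  | add x y _ _ hx hy => rw [star_add]; exact Submodule.add_mem _ hx hy
  | smul c x _ hx => rw [star_smul]; exact Submodule.smul_mem _ _ hx

open scoped ComplexOrder in
/-- The complexified inner product is nondegenerate on `𝔥`. -/
theorem eq_zero_of_stdForm {v : LieAlg R} (h : ∀ t, stdForm R v t = 0) : v = 0 := by
  -- The bilinear form is tested on the complex conjugate of `v`, which lies in `𝔥` because the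
  -- roots are real; this gives the Hermitian norm.
  have := h ⟨star (v : Fin N → ℂ), conj_mem_lieAlg v.2⟩
  rw [stdForm_eq] at this
  exact Subtype.ext (dotProduct_self_star_eq_zero (R := ℂ).mp this)

theorem ext_stdForm {v w : LieAlg R} (h : ∀ t, stdForm R v t = stdForm R w t) : v = w := by
  rw [← sub_eq_zero]
  exact eq_zero_of_stdForm R fun t => by rw [map_sub, LinearMap.sub_apply, h, sub_self]

theorem eq_zero_of_asForm {v : LieAlg R} (h : ∀ α : R, asForm R α.1 v = 0) : v = 0 := by
  refine eq_zero_of_stdForm R fun t => ?_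
  rw [stdForm_symm, stdForm_eq]
  obtain ⟨t, ht⟩ := t
  induction ht using Submodule.span_induction with
  | mem x hx =>
    obtain ⟨α, hα, rfl⟩ := hx
    have := h ⟨α, hα⟩
    rwa [asForm_eq_lin] at this
  | zero => simp
  | add x y _ _ hx hy =>
    simp only [add_dotProduct] at hx hy ⊢
    rw [hx, hy, add_zero]
  | smul c x _ hx =>
    simp only [smul_dotProduct] at hx ⊢
    rw [hx, smul_zero]

theorem exists_stdForm_eq (φ : LieAlg R →ₗ[ℂ] ℂ) : ∃ z, stdForm R z = φ := by
  have hinj : Function.Injective (stdForm R) := by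
    rw [← LinearMap.ker_eq_bot, LinearMap.ker_eq_bot']
    exact fun v hv => eq_zero_of_stdForm R fun t => by rw [hv]; rfl
  have hd : Module.finrank ℂ (LieAlg R) = Module.finrank ℂ (LieAlg R →ₗ[ℂ] ℂ) :=
    (Subspace.dual_finrank_eq (K := ℂ) (V := LieAlg R)).symm
  exact (LinearMap.injective_iff_surjective_of_finrank_eq_finrank hd).mp hinj φ

theorem span_eq_top_of_orthogonal {S : Set (LieAlg R)}
    (h : ∀ v, (∀ w ∈ S, stdForm R w v = 0) → v = 0) : Submodule.span ℂ S = ⊤ := by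
  by_contra hne
  obtain ⟨φ, hφ, hle⟩ := Submodule.exists_le_ker_of_lt_top _ (lt_top_iff_ne_top.mpr hne)
  obtain ⟨z, rfl⟩ := exists_stdForm_eq R φ
  refine hφ ?_
  rw [h z fun w hw => ?_, map_zero]
  rw [stdForm_symm]
  exact hle (Submodule.subset_span hw)

section Product

variable (k : (Fin N → ℝ) → ℂ) (b : LieAlg R →ₗ[ℂ] LieAlg R →ₗ[ℂ] LieAlg R)

theorem stdForm_fibreProduct_zero (x : Total R) (u w t : LieAlg R) :
    stdForm R (fibreProduct R k 0 x u w) t = 1 / 2 * ∑ α ∈ R,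
      k α * cothChar R x α / ((α ⬝ᵥ α : ℝ) : ℂ) * lin α u * lin α w * lin α t := by
  rw [stdForm_symm, ← Finset.sum_coe_sort]
  simp only [fibreProduct, LinearMap.zero_apply, add_zero, map_smul, map_sum, stdForm_coroot,
    asForm_eq_lin, smul_eq_mul, Finset.mul_sum]
  refine Finset.sum_congr rfl fun α _ => ?_
  change _ * (_ * (((2 / (α.1 ⬝ᵥ α.1) : ℝ) : ℂ) * _)) = _
  push_cast
  ring

theorem lin_fibreProduct_zero (x : Total R) (u w : LieAlg R) {β : Fin N → ℝ} (hβ : β ∈ R) :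
    lin β (fibreProduct R k 0 x u w) = 1 / 2 * ∑ α ∈ R,
      k α * cothChar R x α / ((α ⬝ᵥ α : ℝ) : ℂ) * lin α u * lin α w * ((β ⬝ᵥ α : ℝ) : ℂ) := by
  have h := stdForm_fibreProduct_zero R k x u w (rootVec R ⟨β, hβ⟩)
  rw [stdForm_symm] at h
  refine h.trans ?_
  refine congrArg _ (Finset.sum_congr rfl fun α _ => ?_)
  rw [rootVec, lin_cplx, dotProduct_comm β]

/-- Composing two products contracts `α^∨` with `β` and leaves the factor `(α, β)`. Antisymmetry in
`u, v` yields the first bivector; averaging over the exchange of `α` and `β` antisymmetrises the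
remaining factor in `w, t` and accounts for `1/8 = 1/4 · 1/2`. -/
theorem stdForm_commutator (x : Total R) (u v w t : LieAlg R) :
    stdForm R (fibreProduct R k 0 x v (fibreProduct R k 0 x u w)
      - fibreProduct R k 0 x u (fibreProduct R k 0 x v w)) t =
    1 / 8 * ∑ α ∈ R, ∑ β ∈ R, pairCoeff k α β * (cothChar R x α * cothChar R x β) *
      bivectorSquare u v w t α β := by
  set c : (Fin N → ℝ) → ℂ := fun α => k α * cothChar R x α / ((α ⬝ᵥ α : ℝ) : ℂ) with hc
  set Y : (Fin N → ℝ) → (Fin N → ℝ) → ℂ := fun α β =>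
    c α * c β * ((α ⬝ᵥ β : ℝ) : ℂ) * (lin α v * lin β u - lin α u * lin β v) * lin α t * lin β w
    with hY
  have h1 : stdForm R (fibreProduct R k 0 x v (fibreProduct R k 0 x u w)
      - fibreProduct R k 0 x u (fibreProduct R k 0 x v w)) t =
      1 / 4 * ∑ α ∈ R, ∑ β ∈ R, Y α β := by
    rw [map_sub, LinearMap.sub_apply, stdForm_fibreProduct_zero, stdForm_fibreProduct_zero,
      ← mul_sub, ← Finset.sum_sub_distrib, Finset.mul_sum, Finset.mul_sum]
    refine Finset.sum_congr rfl fun α hα => ?_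
    rw [lin_fibreProduct_zero R k x u w hα, lin_fibreProduct_zero R k x v w hα]
    simp only [Finset.mul_sum, Finset.sum_mul, ← Finset.sum_sub_distrib]
    refine Finset.sum_congr rfl fun β _ => ?_
    simp only [hY, hc]
    ring
  have h2 : ∑ α ∈ R, ∑ β ∈ R, Y α β = ∑ α ∈ R, ∑ β ∈ R, Y β α := Finset.sum_comm
  have h3 : ∑ α ∈ R, ∑ β ∈ R, pairCoeff k α β * (cothChar R x α * cothChar R x β) *
      bivectorSquare u v w t α β = ∑ α ∈ R, ∑ β ∈ R, Y α β + ∑ α ∈ R, ∑ β ∈ R, Y β α := by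
    simp only [← Finset.sum_add_distrib]
    refine Finset.sum_congr rfl fun α _ => Finset.sum_congr rfl fun β _ => ?_
    simp only [hY, hc, pairCoeff, bivectorSquare, dotProduct_comm β α]
    push_cast
    ring
  rw [h1, h3, ← h2]
  ring

end Product

theorem isCoth_cothChar (hR : IsCrystallographic R) {x : Total R} (hx : x ∈ complement R) :
    IsCoth R (cothChar R x) := by
  have hne : ∀ α : R, rootChar R α x.1 ≠ 0 := fun α => Units.ne_zero _
  refine ⟨fun α hα => ?_, fun α hα β hβ hαβ => ?_⟩
  · have hn := hR.neg hα
    have hmul : rootChar R ⟨-α, hn⟩ x.1 * rootChar R ⟨α, hα⟩ x.1 = 1 := by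
      rw [rootChar, rootChar, ← Units.val_mul, ← map_mul, ← ofAdd_add]
      have : (⟨-α, AddSubgroup.subset_closure hn⟩ : RootLattice R)
          + ⟨α, AddSubgroup.subset_closure hα⟩ = 0 := Subtype.ext (neg_add_cancel α)
      rw [this, ofAdd_zero, map_one, Units.val_one]
    have h1 := hx ⟨α, hα⟩
    have h2 := hx ⟨-α, hn⟩
    rw [cothChar, cothChar, dif_pos hα, dif_pos hn, ← neg_div,
      div_eq_div_iff (sub_ne_zero.mpr h2) (sub_ne_zero.mpr h1)]
    linear_combination 2 * hmul
  · have hmul : rootChar R ⟨α + β, hαβ⟩ x.1 = rootChar R ⟨α, hα⟩ x.1 * rootChar R ⟨β, hβ⟩ x.1 := by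
      rw [rootChar, rootChar, rootChar, ← Units.val_mul, ← map_mul, ← ofAdd_add]
      rfl
    have h1 := sub_ne_zero.mpr (hx ⟨α, hα⟩)
    have h2 := sub_ne_zero.mpr (hx ⟨β, hβ⟩)
    have h3 := sub_ne_zero.mpr (hx ⟨α + β, hαβ⟩)
    rw [hmul] at h3
    rw [cothChar, cothChar, cothChar, dif_pos hα, dif_pos hβ, dif_pos hαβ, hmul]
    field_simp
    ring

/-- The curvature of the product without the term `b`, from the sums over pairs of roots. -/
theorem commutator_eq_of_sum (hR : IsCrystallographic R) {κ : (Fin N → ℝ) → ℂ} {c : ℂ}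
    (h : ∀ f, IsCoth R f → ∀ u ∈ LieAlg R, ∀ v ∈ LieAlg R, ∀ w ∈ LieAlg R, ∀ t ∈ LieAlg R,
      ∑ α ∈ R, ∑ β ∈ R, pairCoeff κ α β * (f α * f β) * bivectorSquare u v w t α β =
        8 * c * ((u ⬝ᵥ w) * (v ⬝ᵥ t) - (v ⬝ᵥ w) * (u ⬝ᵥ t)))
    {x : Total R} (hx : x ∈ complement R) (u v w : LieAlg R) :
    fibreProduct R κ 0 x v (fibreProduct R κ 0 x u w)
      - fibreProduct R κ 0 x u (fibreProduct R κ 0 x v w) =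
        c • (stdForm R u w • v - stdForm R v w • u) := by
  refine ext_stdForm R fun t => ?_
  rw [stdForm_commutator, h _ (isCoth_cothChar R hR hx) u u.2 v v.2 w w.2 t t.2]
  simp only [map_smul, map_sub, LinearMap.smul_apply, LinearMap.sub_apply, stdForm_eq, smul_eq_mul]
  ring

end Curvature

/-! ### Vanishing of equivariant symmetric bilinear maps -/

section Equivariant

variable {N : ℕ} (R : Finset (Fin N → ℝ))

theorem reflection_of_asForm_eq_zero {α : R} {v : LieAlg R} (h : asForm R α.1 v = 0) :
    reflection R α v = v := by
  rw [reflection, h, zero_smul, sub_zero]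

variable {R} in
theorem reflection_rootVec (hR : IsCrystallographic R) (α : R) :
    reflection R α (rootVec R α) = -rootVec R α := by
  have h0 : α.1 ≠ 0 := fun h => hR.ne_zero (h ▸ α.2)
  have h1 : ((α.1 ⬝ᵥ α.1 : ℝ) : ℂ) ≠ 0 := by exact_mod_cast (dot_self_pos h0).ne'
  have : asForm R α.1 (rootVec R α) = ((α.1 ⬝ᵥ α.1 : ℝ) : ℂ) := by
    rw [asForm_eq_lin, rootVec, lin_cplx]
  rw [reflection, this, coroot_eq, smul_smul]
  have h2 : ((α.1 ⬝ᵥ α.1 : ℝ) : ℂ) * ((2 / (α.1 ⬝ᵥ α.1) : ℝ) : ℂ) = 2 := by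
    push_cast
    field_simp
  rw [h2]
  module

theorem asForm_rootVec (α β : R) :
    asForm R α.1 (rootVec R β) = ((α.1 ⬝ᵥ β.1 : ℝ) : ℂ) := by
  rw [asForm_eq_lin, rootVec, lin_cplx]

theorem stdForm_rootVec (α : R) (v : LieAlg R) : stdForm R (rootVec R α) v = asForm R α.1 v := by
  rw [asForm_eq_lin]; rfl

variable {R} in
/-- If every root spans `𝔥` together with the roots orthogonal to it, then there are no nonzero
equivariant symmetric bilinear maps. -/
theorem equivariant_eq_zero (hR : IsCrystallographic R)
    {b : LieAlg R →ₗ[ℂ] LieAlg R →ₗ[ℂ] LieAlg R} (hb : IsEquivariantMap R b)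
    (h : ∀ α : R, ∀ v : LieAlg R, asForm R α.1 v = 0 →
      (∀ β : R, α.1 ⬝ᵥ β.1 = 0 → asForm R β.1 v = 0) → v = 0) : b = 0 := by
  -- The `-1`-eigenspace of `s_α` is the line of `α^∨`.
  have anti : ∀ (α : R) (z : LieAlg R), reflection R α z = -z →
      z = ((1 / 2 : ℂ) * asForm R α.1 z) • coroot R α := by
    intro α z hz
    rw [reflection, sub_eq_iff_eq_add] at hz
    have h2 : z + z = asForm R α.1 z • coroot R α := by nth_rewrite 1 [hz]; abel
    rw [mul_smul, ← h2]
    module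
  -- For orthogonal `α`, `β` both `s_α` and `s_β` negate `b(α, β)`, which therefore lies on two
  -- orthogonal lines.
  have horth : ∀ α β : R, α.1 ⬝ᵥ β.1 = 0 → b (rootVec R α) (rootVec R β) = 0 := by
    intro α β hαβ
    set z := b (rootVec R α) (rootVec R β) with hz
    have hβα : β.1 ⬝ᵥ α.1 = 0 := by rw [dotProduct_comm, hαβ]
    have h1 : reflection R α z = -z := by
      rw [hz, ← hb.2, reflection_rootVec hR, reflection_of_asForm_eq_zero, map_neg,
        LinearMap.neg_apply]
      rw [asForm_rootVec, hαβ, Complex.ofReal_zero]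
    have h2 : reflection R β z = -z := by
      rw [hz, ← hb.2, reflection_rootVec hR, reflection_of_asForm_eq_zero, map_neg]
      rw [asForm_rootVec, hβα, Complex.ofReal_zero]
    have h3 : asForm R α.1 z = 0 := by
      rw [anti β z h2, map_smul, coroot_eq, map_smul, asForm_rootVec, hαβ]
      simp
    rw [anti α z h1, h3, mul_zero, zero_smul]
  -- `b(α, α)` is fixed by `s_α` and by `s_β` for each `β` orthogonal to `α`, hence is orthogonal to
  -- all these roots, and `h` applies.
  have hself : ∀ α : R, b (rootVec R α) (rootVec R α) = 0 := by
    intro α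
    have hfix : ∀ β : R, reflection R β (b (rootVec R α) (rootVec R α)) =
        b (rootVec R α) (rootVec R α) → asForm R β.1 (b (rootVec R α) (rootVec R α)) = 0 := by
      intro β hβ
      rw [reflection, sub_eq_self] at hβ
      refine (smul_eq_zero.mp hβ).resolve_right fun h0 => ?_
      have h1 : β.1 ≠ 0 := fun h => hR.ne_zero (h ▸ β.2)
      have h2 : asForm R β.1 (coroot R β) = 2 := by
        have h3 : ((β.1 ⬝ᵥ β.1 : ℝ) : ℂ) ≠ 0 := by exact_mod_cast (dot_self_pos h1).ne'
        rw [coroot_eq, map_smul, asForm_rootVec, smul_eq_mul]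
        push_cast
        field_simp
      rw [h0, map_zero] at h2
      exact two_ne_zero h2.symm
    refine h α _ (hfix α ?_) fun β hβ => hfix β ?_
    · rw [← hb.2, reflection_rootVec hR, map_neg, map_neg, LinearMap.neg_apply, neg_neg]
    · rw [← hb.2, reflection_of_asForm_eq_zero]
      rw [asForm_rootVec, dotProduct_comm, hβ, Complex.ofReal_zero]
  have hroot : ∀ α : R, b (rootVec R α) = 0 := by
    intro α
    set S : Set (LieAlg R) := {w | ∃ β : R, w = rootVec R β ∧ (β = α ∨ α.1 ⬝ᵥ β.1 = 0)} with hS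
    have hspan : Submodule.span ℂ S = ⊤ := by
      refine span_eq_top_of_orthogonal R fun v hv => h α v ?_ fun β hβ => ?_
      · rw [← stdForm_rootVec]; exact hv _ ⟨α, rfl, Or.inl rfl⟩
      · rw [← stdForm_rootVec]; exact hv _ ⟨β, rfl, Or.inr hβ⟩
    refine LinearMap.ext_on hspan ?_
    rintro w ⟨β, rfl, rfl | hβ⟩
    · exact hself β
    · exact horth α β hβ
  have hspan : Submodule.span ℂ (Set.range (rootVec R)) = ⊤ := by
    refine span_eq_top_of_orthogonal R fun v hv => eq_zero_of_asForm R fun α => ?_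
    rw [← stdForm_rootVec]
    exact hv _ ⟨α, rfl⟩
  refine LinearMap.ext_on hspan ?_
  rintro w ⟨α, rfl⟩
  exact hroot α

end Equivariant

end ToricConnection
end

noncomputable section

open scoped Classical

namespace ToricConnection

open Matrix

/-! ### Pair sums from second and fourth moments -/

section Moments

variable {N : ℕ} (R : Finset (Fin N → ℝ))

/-- The sum over pairs `α ∈ A`, `β ∈ B` of the squares of `(α, β) • α ∧ β`. -/
def pairSum (A B : Finset (Fin N → ℝ)) (u v w t : Fin N → ℂ) : ℂ :=
  ∑ α ∈ A, ∑ β ∈ B, ((α ⬝ᵥ β : ℝ) : ℂ) ^ 2 * bivectorSquare u v w t α β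

/-- The sum `pairSum` is `2 g` times the curvature tensor of the inner product. -/
def HasPairSum (A B : Finset (Fin N → ℝ)) (g : ℂ) : Prop :=
  ∀ u ∈ LieAlg R, ∀ v ∈ LieAlg R, ∀ w ∈ LieAlg R, ∀ t ∈ LieAlg R,
    pairSum A B u v w t = 2 * g * ((u ⬝ᵥ w) * (v ⬝ᵥ t) - (v ⬝ᵥ w) * (u ⬝ᵥ t))

/-- The second moment of `A` is `ν` times the inner product. -/
def HasSecondMoment (A : Finset (Fin N → ℝ)) (ν : ℝ) : Prop :=
  ∀ y ∈ LieAlg R, ∀ z ∈ LieAlg R, ∑ α ∈ A, lin α y * lin α z = ν * (y ⬝ᵥ z)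

/-- The fourth moment of `B` is `C` times the symmetrised square of the inner product plus `d`
times the sum of the fourth powers of the coordinates. -/
def HasFourthMoment (B : Finset (Fin N → ℝ)) (C d : ℝ) : Prop :=
  ∀ α ∈ R, ∀ y ∈ LieAlg R, ∀ z ∈ LieAlg R,
    ∑ β ∈ B, ((α ⬝ᵥ β : ℝ) : ℂ) ^ 2 * (lin β y * lin β z) =
      C * ((α ⬝ᵥ α : ℝ) * (y ⬝ᵥ z) + 2 * (lin α y * lin α z))
        + d * ∑ m, (α m : ℂ) ^ 2 * (y m * z m)

variable {R}

/-- The square of the bivector expands into four products, each summed over `β` by the fourth moment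
of `B` and then over `α` by the second moment of `A`. The terms totally symmetric in `u, v, w, t`
(the quartic sum over `A` and the sum over coordinates) cancel between the four; only products of
two inner products remain. In `hd` the factor `d` stands on both sides, so that the condition is
empty for `d = 0`. -/
theorem hasPairSum_of_moments {A B : Finset (Fin N → ℝ)} (hA : A ⊆ R) {q ν C d e f : ℝ}
    (hq : ∀ α ∈ A, α ⬝ᵥ α = q) (h2 : HasSecondMoment R A ν) (h4 : HasFourthMoment R B C d)
    (hd : ∀ m, ∀ y ∈ LieAlg R, ∀ z ∈ LieAlg R,
      d * ∑ α ∈ A, (α m : ℂ) ^ 2 * (lin α y * lin α z) = d * (e * (y m * z m) + f * (y ⬝ᵥ z))) :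
    HasPairSum R A B ((C * q * ν + d * f : ℝ) : ℂ) := by
  have key : ∀ u ∈ LieAlg R, ∀ w ∈ LieAlg R, ∀ v ∈ LieAlg R, ∀ t ∈ LieAlg R,
      ∑ α ∈ A, ∑ β ∈ B, ((α ⬝ᵥ β : ℝ) : ℂ) ^ 2 * ((lin α u * lin α w) * (lin β v * lin β t)) =
        (C * q * ν + d * f : ℝ) * ((u ⬝ᵥ w) * (v ⬝ᵥ t)) +
        (2 * C * ∑ α ∈ A, lin α u * lin α w * lin α v * lin α t
          + d * e * ∑ m, u m * w m * v m * t m) := by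
    intro u hu w hw v hv t ht
    have h1 : ∀ α ∈ A, ∑ β ∈ B, ((α ⬝ᵥ β : ℝ) : ℂ) ^ 2 *
        ((lin α u * lin α w) * (lin β v * lin β t)) =
        C * q * (v ⬝ᵥ t) * (lin α u * lin α w) + 2 * C * (lin α u * lin α w * lin α v * lin α t)
          + ∑ m, (v m * t m) * (d * ((α m : ℂ) ^ 2 * (lin α u * lin α w))) := by
      intro α hα
      have := h4 α (hA hα) v hv t ht
      rw [hq α hα] at this
      calc _ = (lin α u * lin α w) *
            ∑ β ∈ B, ((α ⬝ᵥ β : ℝ) : ℂ) ^ 2 * (lin β v * lin β t) := by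
            rw [Finset.mul_sum]
            exact Finset.sum_congr rfl fun β _ => by ring
        _ = _ := by
            have e1 : ∑ m, (v m * t m) * (d * ((α m : ℂ) ^ 2 * (lin α u * lin α w))) =
                (lin α u * lin α w) * (d * ∑ m, (α m : ℂ) ^ 2 * (v m * t m)) := by
              rw [Finset.mul_sum, Finset.mul_sum]
              exact Finset.sum_congr rfl fun m _ => by ring
            rw [this, e1]
            ring
    rw [Finset.sum_congr rfl h1, Finset.sum_add_distrib, Finset.sum_add_distrib, ← Finset.mul_sum,
      ← Finset.mul_sum, h2 u hu w hw, Finset.sum_comm]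
    simp only [← Finset.mul_sum, hd _ u hu w hw]
    have e2 : ∑ m, v m * t m * (d * (e * (u m * w m) + f * (u ⬝ᵥ w))) =
        d * e * ∑ m, u m * w m * v m * t m + d * f * (u ⬝ᵥ w) * (v ⬝ᵥ t) := by
      rw [show v ⬝ᵥ t = ∑ m, v m * t m from rfl, Finset.mul_sum, Finset.mul_sum,
        ← Finset.sum_add_distrib]
      exact Finset.sum_congr rfl fun m _ => by ring
    rw [e2]
    push_cast
    ring
  intro u hu v hv w hw t ht
  have e : pairSum A B u v w t =
      ∑ α ∈ A, ∑ β ∈ B, ((α ⬝ᵥ β : ℝ) : ℂ) ^ 2 * ((lin α v * lin α t) * (lin β u * lin β w))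
      - ∑ α ∈ A, ∑ β ∈ B, ((α ⬝ᵥ β : ℝ) : ℂ) ^ 2 * ((lin α v * lin α w) * (lin β u * lin β t))
      - ∑ α ∈ A, ∑ β ∈ B, ((α ⬝ᵥ β : ℝ) : ℂ) ^ 2 * ((lin α u * lin α t) * (lin β v * lin β w))
      + ∑ α ∈ A, ∑ β ∈ B, ((α ⬝ᵥ β : ℝ) : ℂ) ^ 2 * ((lin α u * lin α w) * (lin β v * lin β t)) := by
    simp only [pairSum, ← Finset.sum_sub_distrib, ← Finset.sum_add_distrib]
    refine Finset.sum_congr rfl fun α _ => Finset.sum_congr rfl fun β _ => ?_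
    simp only [bivectorSquare]
    ring
  rw [e, key v hv t ht u hu w hw, key v hv w hw u hu t ht, key u hu t ht v hv w hw,
    key u hu w hw v hv t ht]
  have s1 : ∀ a b c d : Fin N → ℂ, ∑ α ∈ A, lin α a * lin α b * lin α c * lin α d =
      ∑ α ∈ A, lin α a * lin α d * lin α b * lin α c := fun a b c d =>
    Finset.sum_congr rfl fun α _ => by ring
  have s2 : ∑ α ∈ A, lin α v * lin α t * lin α u * lin α w =
      ∑ α ∈ A, lin α u * lin α w * lin α v * lin α t :=
    Finset.sum_congr rfl fun α _ => by ring
  have s3 : ∑ α ∈ A, lin α v * lin α w * lin α u * lin α t =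
      ∑ α ∈ A, lin α u * lin α w * lin α v * lin α t :=
    Finset.sum_congr rfl fun α _ => by ring
  have s4 : ∑ α ∈ A, lin α u * lin α t * lin α v * lin α w =
      ∑ α ∈ A, lin α u * lin α w * lin α v * lin α t :=
    Finset.sum_congr rfl fun α _ => by ring
  have m2 : ∑ m, v m * t m * u m * w m = ∑ m, u m * w m * v m * t m :=
    Finset.sum_congr rfl fun α _ => by ring
  have m3 : ∑ m, v m * w m * u m * t m = ∑ m, u m * w m * v m * t m :=
    Finset.sum_congr rfl fun α _ => by ring
  have m4 : ∑ m, u m * t m * v m * w m = ∑ m, u m * w m * v m * t m :=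
    Finset.sum_congr rfl fun α _ => by ring
  rw [s2, s3, s4, m2, m3, m4]
  ring

theorem pairSum_comm (A B : Finset (Fin N → ℝ)) (u v w t : Fin N → ℂ) :
    pairSum A B u v w t = pairSum B A u v w t := by
  rw [pairSum, Finset.sum_comm]
  refine Finset.sum_congr rfl fun α _ => Finset.sum_congr rfl fun β _ => ?_
  simp only [bivectorSquare, dotProduct_comm β α]
  ring

/-- The curvature of the product for root systems with squared lengths `ℓ` and `2 ℓ`. -/
theorem sum_coth_eq_of_pairSums (hR : IsCrystallographic R) {S T : Finset (Fin N → ℝ)}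
    (hST : R = S ∪ T) {ℓ : ℝ} (hℓ : 0 < ℓ) {κ : (Fin N → ℝ) → ℂ} {k k' : ℂ}
    (hS : ∀ α ∈ S, α ⬝ᵥ α = ℓ ∧ κ α = k) (hT : ∀ α ∈ T, α ⬝ᵥ α = 2 * ℓ ∧ κ α = k')
    {gS gM gT c : ℂ} (hSS : HasPairSum R S S gS) (hTS : HasPairSum R T S gM)
    (hTT : HasPairSum R T T gT)
    (hc : k ^ 2 * (8 * gS) + k * k' * (6 * gM) + k' ^ 2 * gT = 48 * ℓ ^ 3 * c)
    {f : (Fin N → ℝ) → ℂ} (hf : IsCoth R f) (u : Fin N → ℂ) (hu : u ∈ LieAlg R)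
    (v : Fin N → ℂ) (hv : v ∈ LieAlg R) (w : Fin N → ℂ) (hw : w ∈ LieAlg R)
    (t : Fin N → ℂ) (ht : t ∈ LieAlg R) :
    ∑ α ∈ R, ∑ β ∈ R, pairCoeff κ α β * (f α * f β) * bivectorSquare u v w t α β =
      8 * c * ((u ⬝ᵥ w) * (v ⬝ᵥ t) - (v ⬝ᵥ w) * (u ⬝ᵥ t)) := by
  have hℓC : (ℓ : ℂ) ≠ 0 := by exact_mod_cast hℓ.ne'
  have hlen : ∀ α ∈ R, α ⬝ᵥ α = ℓ ∧ κ α = k ∨ α ⬝ᵥ α = 2 * ℓ ∧ κ α = k' := by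
    intro α hα
    rw [hST, Finset.mem_union] at hα
    exact hα.imp (hS α) (hT α)
  have h12 : ¬ ℓ = 2 * ℓ := fun h => by linarith
  have h21 : ¬ 2 * ℓ = ℓ := fun h => by linarith
  have hdisj : Disjoint S T := Finset.disjoint_left.mpr fun α h1 h2 =>
    h12 ((hS α h1).1.symm.trans (hT α h2).1)
  rw [sum_coth_two_lengths hR hf hℓ hlen]
  set G : (Fin N → ℝ) → (Fin N → ℝ) → ℂ := fun α β => pairCoeff κ α β *
    ((scaleTwo ℓ (α ⬝ᵥ α) (β ⬝ᵥ β) * (α ⬝ᵥ β) : ℝ) : ℂ) * bivectorSquare u v w t α β with hG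
  -- Each constant is the inverse product of the squared lengths, from `pairCoeff`, times the value
  -- of `scaleTwo`: here `1/ℓ² · 2/(3ℓ)`, below `1/(4ℓ²) · 1/(3ℓ)` and `1/(2ℓ²) · 1/(2ℓ)`.
  have gSS : ∑ α ∈ S, ∑ β ∈ S, G α β = k ^ 2 * (2 / (3 * ℓ ^ 3)) * pairSum S S u v w t := by
    simp only [pairSum, Finset.mul_sum]
    refine Finset.sum_congr rfl fun α hα => Finset.sum_congr rfl fun β hβ => ?_
    obtain ⟨h1, h2⟩ := hS α hα
    obtain ⟨h3, h4⟩ := hS β hβ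
    simp only [hG, pairCoeff, h1, h2, h3, h4, scaleTwo, and_self, if_true]
    push_cast
    field_simp
  have gTT : ∑ α ∈ T, ∑ β ∈ T, G α β = k' ^ 2 * (1 / (12 * ℓ ^ 3)) * pairSum T T u v w t := by
    simp only [pairSum, Finset.mul_sum]
    refine Finset.sum_congr rfl fun α hα => Finset.sum_congr rfl fun β hβ => ?_
    obtain ⟨h1, h2⟩ := hT α hα
    obtain ⟨h3, h4⟩ := hT β hβ
    simp only [hG, pairCoeff, h1, h2, h3, h4, scaleTwo, and_self, if_true, h21, if_false]
    push_cast
    field_simp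
    ring
  have gST : ∑ α ∈ S, ∑ β ∈ T, G α β = k * k' * (1 / (4 * ℓ ^ 3)) * pairSum S T u v w t := by
    simp only [pairSum, Finset.mul_sum]
    refine Finset.sum_congr rfl fun α hα => Finset.sum_congr rfl fun β hβ => ?_
    obtain ⟨h1, h2⟩ := hS α hα
    obtain ⟨h3, h4⟩ := hT β hβ
    simp only [hG, pairCoeff, h1, h2, h3, h4, scaleTwo, h21, h12, and_false, false_and, if_false]
    push_cast
    field_simp
    ring
  have gTS : ∑ α ∈ T, ∑ β ∈ S, G α β = k * k' * (1 / (4 * ℓ ^ 3)) * pairSum T S u v w t := by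
    simp only [pairSum, Finset.mul_sum]
    refine Finset.sum_congr rfl fun α hα => Finset.sum_congr rfl fun β hβ => ?_
    obtain ⟨h1, h2⟩ := hT α hα
    obtain ⟨h3, h4⟩ := hS β hβ
    simp only [hG, pairCoeff, h1, h2, h3, h4, scaleTwo, h21, h12, and_false, false_and, if_false]
    push_cast
    field_simp
    ring
  have split : ∑ α ∈ R, ∑ β ∈ R, G α β =
      (∑ α ∈ S, ∑ β ∈ S, G α β + ∑ α ∈ S, ∑ β ∈ T, G α β)
        + (∑ α ∈ T, ∑ β ∈ S, G α β + ∑ α ∈ T, ∑ β ∈ T, G α β) := by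
    rw [hST, Finset.sum_union hdisj]
    simp only [Finset.sum_union hdisj, Finset.sum_add_distrib]
  -- Each pair sum carries a factor `2` and the mixed one occurs twice; multiplication by `6 ℓ³`
  -- produces the coefficients `8`, `6`, `1` and `48` of `hc`.
  rw [split, gSS, gTT, gST, gTS, pairSum_comm S T, hSS u hu v hv w hw t ht,
    hTS u hu v hv w hw t ht, hTT u hu v hv w hw t ht]
  field_simp
  linear_combination 24 * ((u ⬝ᵥ w) * (v ⬝ᵥ t) - (v ⬝ᵥ w) * (u ⬝ᵥ t)) * hc

theorem HasPairSum.empty_left (B : Finset (Fin N → ℝ)) : HasPairSum R ∅ B 0 := by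
  intro u _ v _ w _ t _
  simp [pairSum]

/-- Flatness for root systems without equivariant symmetric bilinear maps. -/
theorem isFlat_iff_of_sum (hR : IsCrystallographic R) {κ : (Fin N → ℝ) → ℂ} {c : ℂ}
    {a : LieAlg R →ₗ[ℂ] LieAlg R →ₗ[ℂ] ℂ} {b : LieAlg R →ₗ[ℂ] LieAlg R →ₗ[ℂ] LieAlg R}
    (ha : IsInvariantForm R a) (hb : IsEquivariantMap R b)
    (hsum : ∀ f, IsCoth R f → ∀ u ∈ LieAlg R, ∀ v ∈ LieAlg R, ∀ w ∈ LieAlg R, ∀ t ∈ LieAlg R,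
      ∑ α ∈ R, ∑ β ∈ R, pairCoeff κ α β * (f α * f β) * bivectorSquare u v w t α β =
        8 * c * ((u ⬝ᵥ w) * (v ⬝ᵥ t) - (v ⬝ᵥ w) * (u ⬝ᵥ t)))
    (horth : ∀ α : R, ∀ v : LieAlg R, asForm R α.1 v = 0 →
      (∀ β : R, α.1 ⬝ᵥ β.1 = 0 → asForm R β.1 v = 0) → v = 0)
    (hind : ∃ α ∈ R, ∃ β ∈ R, ∀ s t : ℂ, s • cplx α = t • cplx β → s = 0 ∧ t = 0) :
    IsFlat R κ a b ↔ a = c • stdForm R := by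
  obtain rfl : b = 0 := equivariant_eq_zero hR hb horth
  have hc : ∀ x ∈ complement R, ∀ u v w : LieAlg R,
      fibreProduct R κ 0 x v (fibreProduct R κ 0 x u w)
        - fibreProduct R κ 0 x u (fibreProduct R κ 0 x v w) =
          c • (stdForm R u w • v - stdForm R v w • u) :=
    fun x hx u v w => commutator_eq_of_sum R hR hsum hx u v w
  exact ⟨eq_smul_stdForm_of_isFlat ha.1 hb.1 hc hR.ne_zero hind,
    isFlat_of_eq_smul_stdForm hb.1 (fun u v w => by simp) hc⟩

end Moments

/-! ### Constancy of multiplicities, and roots orthogonal to a given root -/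

section Multiplicities

variable {N : ℕ} {R : Finset (Fin N → ℝ)}

theorem IsMultiplicity.neg {κ : (Fin N → ℝ) → ℂ} (hκ : IsMultiplicity R κ)
    (hR : IsCrystallographic R) {α : Fin N → ℝ} (h : α ∈ R) : κ (-α) = κ α := by
  have h0 : α ≠ 0 := fun h0 => hR.ne_zero (h0 ▸ h)
  have := hκ α h α h
  rw [realReflection_of_dot h0 rfl] at this
  rw [← this]
  congr 1
  module

/-- Nonorthogonal roots of the same length have the same multiplicity. -/
theorem IsMultiplicity.eq_of_dot_ne_zero {κ : (Fin N → ℝ) → ℂ} (hκ : IsMultiplicity R κ)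
    (hR : IsCrystallographic R) {α β : Fin N → ℝ} (hα : α ∈ R) (hβ : β ∈ R)
    (hlen : α ⬝ᵥ α = β ⬝ᵥ β) (hne : α ⬝ᵥ β ≠ 0) : κ α = κ β := by
  by_cases h1 : α = β
  · rw [h1]
  by_cases h2 : α = -β
  · rw [h2, hκ.neg hR hβ]
  have hα0 : α ≠ 0 := fun h0 => hR.ne_zero (h0 ▸ hα)
  have hβ0 : β ≠ 0 := fun h0 => hR.ne_zero (h0 ▸ hβ)
  have hpos := dot_self_pos hβ0
  have hsub := dot_self_pos (sub_ne_zero.mpr h1)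
  have hadd := dot_self_pos (fun h => h2 (eq_neg_of_add_eq_zero_left h) : α + β ≠ 0)
  rw [dot_sub_self, hlen] at hsub
  rw [dot_add_self, hlen] at hadd
  obtain ⟨m, hm⟩ := hR.int β hβ α hα
  have rα := hκ α hα β hβ
  have rβ := hκ β hβ α hα
  have hm' : 2 * (β ⬝ᵥ α) = m * (α ⬝ᵥ α) := by rw [dotProduct_comm, hlen, hm]
  rw [realReflection_of_dot hα0 hm'] at rα
  rw [realReflection_of_dot hβ0 hm] at rβ
  have : m < 2 := by
    by_contra! h
    have : (2 : ℝ) ≤ m := by exact_mod_cast h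
    nlinarith
  have : -2 < m := by
    by_contra! h
    have : (m : ℝ) ≤ -2 := by exact_mod_cast h
    nlinarith
  interval_cases m
  -- For `m = -1` both `s_α β` and `s_β α` equal `α + β`; for `m = 1` below they are `β - α` and `α
  -- - β`, which differ by a sign.
  · rw [← rα, ← rβ]
    congr 1
    push_cast
    module
  · exact absurd (by push_cast at hm; linarith) hne
  · have h3 := hR.refl β hβ α hα
    rw [realReflection_of_dot hβ0 hm] at h3
    rw [← rα, ← rβ, ← hκ.neg hR h3]
    congr 1
    push_cast
    module

/-- The multiplicity is constant on a set of roots of the same length with fourth moment bounded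
below. -/
theorem IsMultiplicity.eq_of_fourthMoment {κ : (Fin N → ℝ) → ℂ} (hκ : IsMultiplicity R κ)
    (hR : IsCrystallographic R) {S : Finset (Fin N → ℝ)} (hS : S ⊆ R) {ℓ : ℝ}
    (hlen : ∀ α ∈ S, α ⬝ᵥ α = ℓ) {C d : ℝ} (hC : 0 < C) (hd : 0 ≤ d)
    (h4 : HasFourthMoment R S C d) {α β : Fin N → ℝ} (hα : α ∈ S) (hβ : β ∈ S) : κ α = κ β := by
  by_cases hαβ : α ⬝ᵥ β = 0
  swap
  · exact hκ.eq_of_dot_ne_zero hR (hS hα) (hS hβ) (by rw [hlen α hα, hlen β hβ]) hαβ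
  have h := h4 α (hS hα) (cplx β) (Submodule.subset_span ⟨β, hS hβ, rfl⟩) (cplx β)
    (Submodule.subset_span ⟨β, hS hβ, rfl⟩)
  simp only [lin_cplx, hαβ, cplx_dotProduct, cplx] at h
  have h' : ∑ γ ∈ S, (α ⬝ᵥ γ) ^ 2 * ((γ ⬝ᵥ β) * (γ ⬝ᵥ β)) =
      C * ((α ⬝ᵥ α) * (β ⬝ᵥ β) + 2 * (0 * 0)) + d * ∑ m, α m ^ 2 * (β m * β m) := by
    exact_mod_cast h
  have hα0 : α ≠ 0 := fun h0 => hR.ne_zero (h0 ▸ hS hα)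
  have hβ0 : β ≠ 0 := fun h0 => hR.ne_zero (h0 ▸ hS hβ)
  have hpos : 0 < ∑ γ ∈ S, (α ⬝ᵥ γ) ^ 2 * ((γ ⬝ᵥ β) * (γ ⬝ᵥ β)) := by
    rw [h']
    have := dot_self_pos hα0
    have := dot_self_pos hβ0
    have : 0 ≤ ∑ m, α m ^ 2 * (β m * β m) :=
      Finset.sum_nonneg fun m _ => mul_nonneg (sq_nonneg _) (mul_self_nonneg _)
    have h5 := mul_nonneg hd this
    have h6 : 0 < C * ((α ⬝ᵥ α) * (β ⬝ᵥ β)) := by positivity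
    linarith
  -- For orthogonal `α`, `β` the positive fourth moment provides a root `γ` that is orthogonal to
  -- neither, and `γ` links the two.
  obtain ⟨γ, hγ, hne⟩ := Finset.exists_ne_zero_of_sum_ne_zero hpos.ne'
  have h1 : α ⬝ᵥ γ ≠ 0 := fun h => hne (by rw [h]; ring)
  have h2 : γ ⬝ᵥ β ≠ 0 := fun h => hne (by rw [h]; ring)
  exact (hκ.eq_of_dot_ne_zero hR (hS hα) (hS hγ) (by rw [hlen α hα, hlen γ hγ]) h1).trans
    (hκ.eq_of_dot_ne_zero hR (hS hγ) (hS hβ) (by rw [hlen γ hγ, hlen β hβ]) h2)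

/-- A vector orthogonal to a root and to all roots of one length orthogonal to it vanishes, if the
moments of the roots of that length are those of a sphere. -/
theorem eq_zero_of_orthogonal_of_moments (hR : IsCrystallographic R)
    {S : Finset (Fin N → ℝ)} (hS : S ⊆ R) {ℓ : ℝ} (hℓ : 0 < ℓ) (hlen : ∀ α ∈ S, α ⬝ᵥ α = ℓ)
    {ν C : ℝ} (h2 : HasSecondMoment R S ν) (h4 : HasFourthMoment R S C 0) (hne : ℓ * ν ≠ 4 * C)
    {α : Fin N → ℝ} (hα : α ∈ S) {v : LieAlg R} (hv : asForm R α v = 0)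
    (hβ : ∀ β ∈ R, α ⬝ᵥ β = 0 → asForm R β v = 0) : v = 0 := by
  have hα0 : α ≠ 0 := fun h0 => hR.ne_zero (h0 ▸ hS hα)
  rw [asForm_eq_lin] at hv
  -- A root `β` with `β(v) ≠ 0` is neither orthogonal nor proportional to `α`, so `(α, β) = ±ℓ/2`.
  -- Summed against `β(t)`, this compares the second moment with the fourth: `ℓ² ν (v,t) = 4 C ℓ
  -- (v,t)`.
  have hterm : ∀ β ∈ S, (ℓ : ℂ) ^ 2 * lin β v = 4 * ((α ⬝ᵥ β : ℝ) : ℂ) ^ 2 * lin β v := by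
    intro β hβS
    by_cases h0 : lin β v = 0
    · rw [h0, mul_zero, mul_zero]
    have h1 : α ⬝ᵥ β ≠ 0 := fun h => h0 (by rw [← asForm_eq_lin]; exact hβ β (hS hβS) h)
    have n1 : α ≠ β := fun h => h0 (h ▸ hv)
    have n2 : α ≠ -β := fun h => h0 (by rw [h, lin_neg, neg_eq_zero] at hv; exact hv)
    have hsub := dot_self_pos (sub_ne_zero.mpr n1)
    have hadd := dot_self_pos (fun h => n2 (eq_neg_of_add_eq_zero_left h) : α + β ≠ 0)
    rw [dot_sub_self, hlen α hα, hlen β hβS] at hsub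
    rw [dot_add_self, hlen α hα, hlen β hβS] at hadd
    obtain ⟨m, hm⟩ := hR.int β (hS hβS) α (hS hα)
    rw [hlen β hβS] at hm
    have : m < 2 := by
      by_contra! h
      have : (2 : ℝ) ≤ m := by exact_mod_cast h
      nlinarith
    have : -2 < m := by
      by_contra! h
      have : (m : ℝ) ≤ -2 := by exact_mod_cast h
      nlinarith
    have hsq : (ℓ : ℝ) ^ 2 = 4 * (α ⬝ᵥ β) ^ 2 := by
      interval_cases m
      · have : α ⬝ᵥ β = -(ℓ / 2) := by push_cast at hm; linarith
        rw [this]; ring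
      · exact absurd (by push_cast at hm; linarith) h1
      · have : α ⬝ᵥ β = ℓ / 2 := by push_cast at hm; linarith
        rw [this]; ring
    have hsq' : (ℓ : ℂ) ^ 2 = 4 * ((α ⬝ᵥ β : ℝ) : ℂ) ^ 2 := by exact_mod_cast hsq
    rw [hsq']
  refine eq_zero_of_stdForm R fun t => ?_
  have e2 := h2 v v.2 t t.2
  have e4 := h4 α (hS hα) v v.2 t t.2
  have e : (ℓ : ℂ) ^ 2 * ∑ β ∈ S, lin β v * lin β t =
      4 * ∑ β ∈ S, ((α ⬝ᵥ β : ℝ) : ℂ) ^ 2 * (lin β v * lin β t) := by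
    rw [Finset.mul_sum, Finset.mul_sum]
    refine Finset.sum_congr rfl fun β hβS => ?_
    linear_combination lin β t * hterm β hβS
  rw [e2, e4, hv, hlen α hα, Complex.ofReal_zero] at e
  simp only [zero_mul, mul_zero, add_zero] at e
  have hℓC : (ℓ : ℂ) ≠ 0 := by exact_mod_cast hℓ.ne'
  have hneC : (ℓ : ℂ) * ν - 4 * C ≠ 0 := by
    rw [sub_ne_zero]; exact_mod_cast hne
  have : (ℓ * (ℓ * ν - 4 * C) : ℂ) * stdForm R v t = 0 := by
    rw [stdForm_eq]
    linear_combination e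
  exact (mul_eq_zero.mp this).resolve_left (mul_ne_zero hℓC hneC)

end Multiplicities

end ToricConnection
end

noncomputable section

open scoped Classical

namespace ToricConnection

open Matrix

/-! ### Root systems as lattice vectors of given length: types A to D -/

section Lattices

/-- An integer vector, seen in `ℝ^N`. -/
def intVec {N : ℕ} (z : Fin N → ℤ) : Fin N → ℝ := fun i => (z i : ℝ)

theorem intVec_dot {N : ℕ} (z w : Fin N → ℤ) : intVec z ⬝ᵥ intVec w = ((z ⬝ᵥ w : ℤ) : ℝ) := by
  simp [intVec, dotProduct]

theorem sign_cases (s : ℤˣ) : ((s : ℤ) : ℝ) = 1 ∨ ((s : ℤ) : ℝ) = -1 := by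
  rcases Int.units_eq_one_or s with h | h <;> simp [h]

theorem sign_sq (s : ℤˣ) : ((s : ℤ) : ℝ) * ((s : ℤ) : ℝ) = 1 := by
  rcases sign_cases s with h | h <;> rw [h] <;> norm_num

theorem ε_apply {N : ℕ} (i j : Fin N) : ε i j = if j = i then 1 else 0 := by
  simp [ε, Pi.single_apply]

theorem exists_sign_of_sq {z : ℤ} (h : z * z = 1) : ∃ s : ℤˣ, (s : ℤ) = z :=
  ⟨⟨z, z, h, h⟩, rfl⟩

theorem exists_of_sum_sq_eq_one {N : ℕ} {t : Finset (Fin N)} {z : Fin N → ℤ}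
    (h : ∑ i ∈ t, z i * z i = 1) :
    ∃ i ∈ t, z i * z i = 1 ∧ ∀ j ∈ t, j ≠ i → z j = 0 := by
  obtain ⟨i, hi, hne⟩ := Finset.exists_ne_zero_of_sum_ne_zero (by rw [h]; norm_num)
  have hpos : 0 < z i * z i := lt_of_le_of_ne (mul_self_nonneg _) (Ne.symm hne)
  have hsplit := Finset.add_sum_erase t (fun i => z i * z i) hi
  have hrest : 0 ≤ ∑ x ∈ t.erase i, z x * z x := Finset.sum_nonneg fun _ _ => mul_self_nonneg _
  rw [h] at hsplit
  refine ⟨i, hi, by linarith, fun j hj hji => ?_⟩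
  have h0 : ∑ x ∈ t.erase i, z x * z x = 0 := by linarith
  rw [Finset.sum_eq_zero_iff_of_nonneg fun _ _ => mul_self_nonneg _] at h0
  exact mul_self_eq_zero.mp (h0 j (Finset.mem_erase.mpr ⟨hji, hj⟩))

theorem exists_unit_of_dot_eq_one {N : ℕ} {z : Fin N → ℤ} (h : z ⬝ᵥ z = 1) :
    ∃ (i : Fin N) (s : ℤˣ), intVec z = ((s : ℤ) : ℝ) • ε i := by
  obtain ⟨i, -, hi, h0⟩ := exists_of_sum_sq_eq_one (t := Finset.univ) h
  obtain ⟨s, hs⟩ := exists_sign_of_sq hi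
  refine ⟨i, s, funext fun j => ?_⟩
  by_cases hj : j = i
  · subst hj; simp [intVec, ε_apply, hs]
  · simp [intVec, ε_apply, hj, h0 j (Finset.mem_univ j) hj]

theorem exists_pair_of_dot_eq_two {N : ℕ} {z : Fin N → ℤ} (h : z ⬝ᵥ z = 2) :
    ∃ (i j : Fin N) (s t : ℤˣ), i ≠ j ∧
      intVec z = ((s : ℤ) : ℝ) • ε i + ((t : ℤ) : ℝ) • ε j := by
  have h' : ∑ i, z i * z i = 2 := h
  obtain ⟨i, hi, hne⟩ := Finset.exists_ne_zero_of_sum_ne_zero (by rw [h']; norm_num)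
  have hsplit := Finset.add_sum_erase Finset.univ (fun i => z i * z i) hi
  have hrest : 0 ≤ ∑ x ∈ Finset.univ.erase i, z x * z x :=
    Finset.sum_nonneg fun _ _ => mul_self_nonneg _
  rw [h'] at hsplit
  have hzi : z i * z i = 1 := by
    have h1 : z i < 2 := by nlinarith
    have h2 : -2 < z i := by nlinarith
    generalize z i = m at *
    interval_cases m <;> simp_all
  obtain ⟨j, hj, hzj, h0⟩ := exists_of_sum_sq_eq_one
    (by linarith : ∑ x ∈ Finset.univ.erase i, z x * z x = 1)
  obtain ⟨s, hs⟩ := exists_sign_of_sq hzi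
  obtain ⟨t, ht⟩ := exists_sign_of_sq hzj
  have hji : j ≠ i := (Finset.mem_erase.mp hj).1
  refine ⟨i, j, s, t, hji.symm, funext fun l => ?_⟩
  by_cases hl : l = i
  · subst hl; simp [intVec, ε_apply, hs, hji.symm]
  by_cases hl' : l = j
  · subst hl'; simp [intVec, ε_apply, ht, hji]
  · simp [intVec, ε_apply, hl, hl', h0 l (Finset.mem_erase.mpr ⟨hl, Finset.mem_univ l⟩) hl']

theorem mem_pmRoots' {n : ℕ} {x : Fin n → ℝ} : x ∈ pmRoots n ↔ ∃ (i j : Fin n) (s t : ℤˣ), i ≠ j ∧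
    x = ((s : ℤ) : ℝ) • ε i + ((t : ℤ) : ℝ) • ε j := by
  simp only [pmRoots, Finset.mem_image, Finset.mem_filter, Finset.mem_univ, true_and]
  constructor
  · rintro ⟨⟨⟨i, j⟩, ⟨s, t⟩⟩, h, rfl⟩
    exact ⟨i, j, s, t, h, rfl⟩
  · rintro ⟨i, j, s, t, h, rfl⟩
    exact ⟨⟨⟨i, j⟩, ⟨s, t⟩⟩, h, rfl⟩

theorem sign_smul_ε {n : ℕ} (s : ℤˣ) (i : Fin n) :
    ((s : ℤ) : ℝ) • ε i = intVec (Pi.single i (s : ℤ)) := by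
  ext l
  by_cases h : l = i <;> simp [intVec, ε_apply, h]

theorem intVec_add {N : ℕ} (z w : Fin N → ℤ) : intVec (z + w) = intVec z + intVec w := by
  ext i; simp [intVec]

theorem mem_pmRoots {n : ℕ} {x : Fin n → ℝ} :
    x ∈ pmRoots n ↔ ∃ z : Fin n → ℤ, x = intVec z ∧ z ⬝ᵥ z = 2 := by
  rw [mem_pmRoots']
  constructor
  · rintro ⟨i, j, s, t, h, rfl⟩
    refine ⟨Pi.single i (s : ℤ) + Pi.single j (t : ℤ), ?_, ?_⟩
    · rw [intVec_add, sign_smul_ε, sign_smul_ε]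
    · have hs : (s : ℤ) * s = 1 := by rcases Int.units_eq_one_or s with h | h <;> simp [h]
      have ht : (t : ℤ) * t = 1 := by rcases Int.units_eq_one_or t with h | h <;> simp [h]
      simp [h, h.symm, hs, ht]
  · rintro ⟨z, rfl, h⟩
    exact exists_pair_of_dot_eq_two h

/-- Criterion for a set of lattice vectors of given lengths to be crystallographic. -/
theorem IsCrystallographic.of_lattice {N : ℕ} {R : Finset (Fin N → ℝ)}
    (Λ : AddSubgroup (Fin N → ℝ)) (Q : ℝ → Prop) (hmem : ∀ x, x ∈ R ↔ x ∈ Λ ∧ Q (x ⬝ᵥ x))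
    (hint : ∀ α ∈ R, ∀ β ∈ R, ∃ m : ℤ, 2 * (β ⬝ᵥ α) = m * (α ⬝ᵥ α)) (h0 : ¬ Q 0) :
    IsCrystallographic R := by
  have hz : (0 : Fin N → ℝ) ∉ R := fun h => h0 (by simpa using ((hmem 0).mp h).2)
  refine ⟨fun α hα β hβ => ?_, hint, hz⟩
  obtain ⟨m, hm⟩ := hint α hα β hβ
  have hα0 : α ≠ 0 := fun h => hz (h ▸ hα)
  rw [realReflection_of_dot hα0 hm, hmem]
  obtain ⟨hΛα, -⟩ := (hmem α).mp hα
  obtain ⟨hΛβ, hQ⟩ := (hmem β).mp hβ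
  constructor
  · have : (m : ℝ) • α = m • α := by ext i; simp
    rw [this]
    exact Λ.sub_mem hΛβ (Λ.zsmul_mem hΛα m)
  · have : (β - (m : ℝ) • α) ⬝ᵥ (β - (m : ℝ) • α) = β ⬝ᵥ β := by
      rw [dot_sub_self, dotProduct_smul, smul_dotProduct, dotProduct_smul, smul_eq_mul, smul_eq_mul,
        smul_eq_mul]
      linear_combination (-(m : ℝ)) * hm
    rwa [this]

/-- The lattice `ℤ^N`. -/
def intLattice (N : ℕ) : AddSubgroup (Fin N → ℝ) where
  carrier := Set.range intVec
  zero_mem' := ⟨0, by ext; simp [intVec]⟩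
  add_mem' := by rintro _ _ ⟨z, rfl⟩ ⟨w, rfl⟩; exact ⟨z + w, intVec_add z w⟩
  neg_mem' := by rintro _ ⟨z, rfl⟩; exact ⟨-z, by ext; simp [intVec]⟩

theorem pmRoots_dot {n : ℕ} {x : Fin n → ℝ} (h : x ∈ pmRoots n) : x ⬝ᵥ x = 2 := by
  obtain ⟨z, rfl, hz⟩ := mem_pmRoots.mp h
  rw [intVec_dot, hz]; norm_num

theorem isCrystallographic_D (n : ℕ) : IsCrystallographic (rootsD n) := by
  refine IsCrystallographic.of_lattice (intLattice n) (fun q => q = 2) (fun x => ?_) ?_ (by norm_num)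
  · rw [rootsD, mem_pmRoots]
    constructor
    · rintro ⟨z, rfl, h⟩
      exact ⟨⟨z, rfl⟩, by rw [intVec_dot, h]; norm_num⟩
    · rintro ⟨⟨z, rfl⟩, h⟩
      rw [intVec_dot] at h
      exact ⟨z, rfl, by exact_mod_cast h⟩
  · intro α hα β hβ
    obtain ⟨z, rfl, hz⟩ := mem_pmRoots.mp hα
    obtain ⟨w, rfl, -⟩ := mem_pmRoots.mp hβ
    refine ⟨w ⬝ᵥ z, ?_⟩
    rw [intVec_dot, intVec_dot, hz]
    push_cast
    ring

theorem sum_pmVector {n : ℕ} (i j : Fin n) (s t : ℝ) : ∑ l, (s • ε i + t • ε j) l = s + t := by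
  simp [ε_apply, Finset.sum_add_distrib]

theorem mem_rootsA {n : ℕ} {x : Fin (n + 1) → ℝ} :
    x ∈ rootsA n ↔ ∃ i j, i ≠ j ∧ x = ε i - ε j := by
  simp only [rootsA, Finset.mem_image, Finset.mem_filter, Finset.mem_univ, true_and]
  constructor
  · rintro ⟨⟨i, j⟩, h, rfl⟩
    exact ⟨i, j, h, rfl⟩
  · rintro ⟨i, j, h, rfl⟩
    exact ⟨⟨i, j⟩, h, rfl⟩

theorem mem_rootsA_iff {n : ℕ} {x : Fin (n + 1) → ℝ} :
    x ∈ rootsA n ↔ ∃ z : Fin (n + 1) → ℤ, x = intVec z ∧ ∑ i, z i = 0 ∧ z ⬝ᵥ z = 2 := by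
  constructor
  · intro h
    obtain ⟨i, j, hij, rfl⟩ := mem_rootsA.mp h
    refine ⟨Pi.single i 1 - Pi.single j 1, ?_, ?_, ?_⟩
    · ext l; simp [intVec, ε, Pi.single_apply]
    · simp [Finset.sum_sub_distrib]
    · simp [hij, hij.symm]
  · rintro ⟨z, rfl, h0, h⟩
    obtain ⟨i, j, s, t, hij, he⟩ := exists_pair_of_dot_eq_two h
    have hsum : ((s : ℤ) : ℝ) + ((t : ℤ) : ℝ) = 0 := by
      rw [← sum_pmVector i j, ← he]
      simp only [intVec]
      exact_mod_cast h0
    rw [mem_rootsA, he]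
    rcases sign_cases s with hs | hs <;> rcases sign_cases t with ht | ht <;>
      rw [hs, ht] at hsum ⊢ <;> norm_num at hsum
    · exact ⟨i, j, hij, by module⟩
    · exact ⟨j, i, hij.symm, by module⟩

/-- The lattice of integer vectors with coordinate sum zero. -/
def sumZeroLattice (N : ℕ) : AddSubgroup (Fin N → ℝ) where
  carrier := {x | ∃ z : Fin N → ℤ, x = intVec z ∧ ∑ i, z i = 0}
  zero_mem' := ⟨0, by ext; simp [intVec], by simp⟩
  add_mem' := by
    rintro _ _ ⟨z, rfl, hz⟩ ⟨w, rfl, hw⟩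
    exact ⟨z + w, (intVec_add z w).symm, by simp [Finset.sum_add_distrib, hz, hw]⟩
  neg_mem' := by
    rintro _ ⟨z, rfl, hz⟩
    exact ⟨-z, by ext; simp [intVec], by simp [hz]⟩

theorem rootsA_dot {n : ℕ} {x : Fin (n + 1) → ℝ} (h : x ∈ rootsA n) : x ⬝ᵥ x = 2 := by
  obtain ⟨z, rfl, -, hz⟩ := mem_rootsA_iff.mp h
  rw [intVec_dot, hz]; norm_num

theorem isCrystallographic_A (n : ℕ) : IsCrystallographic (rootsA n) := by
  refine IsCrystallographic.of_lattice (sumZeroLattice (n + 1)) (fun q => q = 2) (fun x => ?_) ?_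
    (by norm_num)
  · rw [mem_rootsA_iff]
    constructor
    · rintro ⟨z, rfl, h0, h⟩
      exact ⟨⟨z, rfl, h0⟩, by rw [intVec_dot, h]; norm_num⟩
    · rintro ⟨⟨z, rfl, h0⟩, h⟩
      rw [intVec_dot] at h
      exact ⟨z, rfl, h0, by exact_mod_cast h⟩
  · intro α hα β hβ
    obtain ⟨z, rfl, -, hz⟩ := mem_rootsA_iff.mp hα
    obtain ⟨w, rfl, -⟩ := mem_rootsA_iff.mp hβ
    refine ⟨w ⬝ᵥ z, ?_⟩
    rw [intVec_dot, intVec_dot, hz]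
    push_cast
    ring

/-- The multiples `± c ε_i` of the unit vectors. -/
def unitRoots (n : ℕ) (c : ℝ) : Finset (Fin n → ℝ) :=
  (Finset.univ : Finset (Fin n × ℤˣ)).image (fun p => (c * ((p.2 : ℤ) : ℝ)) • ε p.1)

theorem rootsB_eq (n : ℕ) : rootsB n = pmRoots n ∪ unitRoots n 1 := by
  simp only [rootsB, unitRoots, one_mul]

theorem rootsC_eq (n : ℕ) : rootsC n = pmRoots n ∪ unitRoots n 2 := rfl

theorem mem_unitRoots' {n : ℕ} {c : ℝ} {x : Fin n → ℝ} : x ∈ unitRoots n c ↔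
    ∃ (i : Fin n) (s : ℤˣ), x = (c * ((s : ℤ) : ℝ)) • ε i := by
  simp only [unitRoots, Finset.mem_image, Finset.mem_univ, true_and]
  constructor
  · rintro ⟨⟨i, s⟩, rfl⟩; exact ⟨i, s, rfl⟩
  · rintro ⟨i, s, rfl⟩; exact ⟨⟨i, s⟩, rfl⟩

theorem mem_unitRoots {n : ℕ} {c : ℝ} {x : Fin n → ℝ} : x ∈ unitRoots n c ↔
    ∃ z : Fin n → ℤ, x = c • intVec z ∧ z ⬝ᵥ z = 1 := by
  rw [mem_unitRoots']
  constructor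
  · rintro ⟨i, s, rfl⟩
    refine ⟨Pi.single i (s : ℤ), by rw [← sign_smul_ε, smul_smul], ?_⟩
    rcases Int.units_eq_one_or s with h | h <;> simp [h]
  · rintro ⟨z, rfl, h⟩
    obtain ⟨i, s, he⟩ := exists_unit_of_dot_eq_one h
    exact ⟨i, s, by rw [he, smul_smul]⟩

theorem unitRoots_dot {n : ℕ} {c : ℝ} {x : Fin n → ℝ} (h : x ∈ unitRoots n c) :
    x ⬝ᵥ x = c ^ 2 := by
  obtain ⟨z, rfl, hz⟩ := mem_unitRoots.mp h
  rw [dotProduct_smul, smul_dotProduct, intVec_dot, hz, smul_eq_mul, smul_eq_mul]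
  push_cast; ring

theorem realReflection_smul_left {N : ℕ} {c : ℝ} (hc : c ≠ 0) (α β : Fin N → ℝ) :
    realReflection (c • α) β = realReflection α β := by
  simp only [realReflection_eq, dotProduct_smul, smul_dotProduct, smul_eq_mul, smul_smul]
  congr 2
  by_cases h : α ⬝ᵥ α = 0
  · simp [h]
  · field_simp

theorem realReflection_smul_right {N : ℕ} (c : ℝ) (α β : Fin N → ℝ) :
    realReflection α (c • β) = c • realReflection α β := by
  simp only [realReflection_eq, smul_dotProduct, smul_eq_mul, smul_sub, smul_smul]
  congr 2
  ring

/-- If `(z, z)` is `1` or `2`, then `2 (w, z)/(z, z)` is an integer and the reflection in `z`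
preserves `ℤ^N`. -/
theorem exists_realReflection_intVec {N : ℕ} {z w : Fin N → ℤ}
    (hz : z ⬝ᵥ z = 1 ∨ z ⬝ᵥ z = 2) :
    ∃ y : Fin N → ℤ, realReflection (intVec z) (intVec w) = intVec y ∧ y ⬝ᵥ y = w ⬝ᵥ w := by
  have key : ∀ m : ℤ, 2 * (w ⬝ᵥ z) = m * (z ⬝ᵥ z) →
      ∃ y : Fin N → ℤ, realReflection (intVec z) (intVec w) = intVec y ∧ y ⬝ᵥ y = w ⬝ᵥ w := by
    intro m hm
    have h0 : intVec z ≠ 0 := by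
      intro h
      have h1 : intVec z ⬝ᵥ intVec z = 0 := by rw [h]; simp
      rw [intVec_dot] at h1
      have h2 : z ⬝ᵥ z = 0 := by exact_mod_cast h1
      rcases hz with h | h <;> omega
    refine ⟨w - m • z, ?_, ?_⟩
    · rw [realReflection_of_dot (c := (m : ℝ)) h0
        (by rw [intVec_dot, intVec_dot]; exact_mod_cast hm)]
      ext i; simp [intVec]
    · simp only [sub_dotProduct, dotProduct_sub, dotProduct_smul, smul_dotProduct,
        dotProduct_comm z w, smul_eq_mul]
      linear_combination (-m) * hm
  rcases hz with h | h
  · exact key (2 * (w ⬝ᵥ z)) (by rw [h]; ring)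
  · exact key (w ⬝ᵥ z) (by rw [h]; ring)

/-- Types `B_n` (`c = 1`) and `C_n` (`c = 2`) together. Length in the lattice does not characterise
the roots of `C_n`, since `ε_1 + ε_2 + ε_3 + ε_4` has the length of `2 ε_1`. Hence reflections are
reduced to those in integer vectors of squared length `1` or `2`, which do not see the scale `c`. -/
theorem isCrystallographic_pm_union_unit (n : ℕ) {c : ℝ} (hc : c = 1 ∨ c = 2) :
    IsCrystallographic (pmRoots n ∪ unitRoots n c) := by
  have hc0 : c ≠ 0 := by rcases hc with h | h <;> rw [h] <;> norm_num
  refine ⟨fun α hα β hβ => ?_, fun α hα β hβ => ?_, fun h => ?_⟩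
  · rw [Finset.mem_union] at hα hβ ⊢
    have h1 : ∃ z : Fin n → ℤ, realReflection α β = realReflection (intVec z) β ∧
        (z ⬝ᵥ z = 1 ∨ z ⬝ᵥ z = 2) := by
      rcases hα with h | h
      · obtain ⟨z, rfl, hz⟩ := mem_pmRoots.mp h
        exact ⟨z, rfl, Or.inr hz⟩
      · obtain ⟨z, rfl, hz⟩ := mem_unitRoots.mp h
        exact ⟨z, realReflection_smul_left hc0 _ _, Or.inl hz⟩
    obtain ⟨z, hz, hz'⟩ := h1
    rw [hz]
    rcases hβ with h | h
    · obtain ⟨w, rfl, hw⟩ := mem_pmRoots.mp h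
      obtain ⟨y, hy, hy'⟩ := exists_realReflection_intVec (w := w) hz'
      exact Or.inl (mem_pmRoots.mpr ⟨y, hy, hy'.trans hw⟩)
    · obtain ⟨w, rfl, hw⟩ := mem_unitRoots.mp h
      obtain ⟨y, hy, hy'⟩ := exists_realReflection_intVec (w := w) hz'
      exact Or.inr (mem_unitRoots.mpr
        ⟨y, by rw [realReflection_smul_right, hy], hy'.trans hw⟩)
  · rw [Finset.mem_union] at hα hβ
    rcases hα with h | h
    · rw [pmRoots_dot h]
      obtain ⟨z, rfl, hz⟩ := mem_pmRoots.mp h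
      rcases hβ with h' | h'
      · obtain ⟨w, rfl, hw⟩ := mem_pmRoots.mp h'
        exact ⟨w ⬝ᵥ z, by rw [intVec_dot]; ring⟩
      · obtain ⟨w, rfl, hw⟩ := mem_unitRoots.mp h'
        rw [smul_dotProduct, intVec_dot, smul_eq_mul]
        rcases hc with rfl | rfl
        · exact ⟨w ⬝ᵥ z, by ring⟩
        · exact ⟨2 * (w ⬝ᵥ z), by push_cast; ring⟩
    · rw [unitRoots_dot h]
      obtain ⟨z, rfl, hz⟩ := mem_unitRoots.mp h
      rcases hβ with h' | h'
      · obtain ⟨w, rfl, hw⟩ := mem_pmRoots.mp h'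
        rw [dotProduct_smul, intVec_dot, smul_eq_mul]
        rcases hc with rfl | rfl
        · exact ⟨2 * (w ⬝ᵥ z), by push_cast; ring⟩
        · exact ⟨w ⬝ᵥ z, by ring⟩
      · obtain ⟨w, rfl, hw⟩ := mem_unitRoots.mp h'
        rw [dotProduct_smul, smul_dotProduct, intVec_dot, smul_eq_mul, smul_eq_mul]
        exact ⟨2 * (w ⬝ᵥ z), by push_cast; ring⟩
  · rw [Finset.mem_union] at h
    rcases h with h | h
    · have := pmRoots_dot h
      simp at this
    · have := unitRoots_dot h
      rw [zero_dotProduct] at this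
      exact hc0 (pow_eq_zero_iff two_ne_zero |>.mp this.symm)

end Lattices

end ToricConnection
end

noncomputable section

open scoped Classical

namespace ToricConnection

open Matrix

/-! ### Second and fourth moments in the classical types -/

section Sums

variable {n : ℕ}

theorem lin_ε (i : Fin n) (u : Fin n → ℂ) : lin (ε i) u = u i := by
  rw [lin, dotProduct, Finset.sum_eq_single i] <;> simp +contextual [cplx, ε_apply]

theorem lin_smul (r : ℝ) (α : Fin n → ℝ) (u : Fin n → ℂ) : lin (r • α) u = r * lin α u := by
  simp [lin, cplx, dotProduct, Finset.mul_sum, mul_assoc]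

theorem lin_sub (α β : Fin n → ℝ) (u : Fin n → ℂ) : lin (α - β) u = lin α u - lin β u := by
  rw [sub_eq_add_neg, lin_add, lin_neg, sub_eq_add_neg]

theorem lin_zero (u : Fin n → ℂ) : lin 0 u = 0 := by
  simp [lin, cplx, dotProduct]

theorem sum_units {M : Type*} [AddCommMonoid M] (g : ℤˣ → M) : ∑ s, g s = g 1 + g (-1) := by
  rw [show (Finset.univ : Finset ℤˣ) = {1, -1} from rfl, Finset.sum_pair (by decide)]

theorem sum_ne (h : Fin n → Fin n → ℂ) :
    ∑ i, ∑ j, (if i ≠ j then h i j else 0) = ∑ i, ∑ j, h i j - ∑ i, h i i := by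
  rw [← Finset.sum_sub_distrib]
  refine Finset.sum_congr rfl fun i _ => ?_
  rw [eq_sub_iff_add_eq, ← Finset.sum_erase_add _ _ (Finset.mem_univ i),
    ← Finset.sum_erase_add _ (fun j => h i j) (Finset.mem_univ i)]
  rw [if_neg (by simp), add_zero]
  congr 1
  exact Finset.sum_congr rfl fun j hj => if_pos (Finset.ne_of_mem_erase hj).symm

theorem sum_unitRoots {c : ℝ} (hc : c ≠ 0) (g : (Fin n → ℝ) → ℂ) :
    ∑ α ∈ unitRoots n c, g α = ∑ i, (g (c • ε i) + g (-(c • ε i))) := by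
  rw [unitRoots, Finset.sum_image]
  · rw [Fintype.sum_prod_type]
    refine Finset.sum_congr rfl fun i _ => ?_
    rw [sum_units]
    congr 2
    · simp
    · ext; simp
  · rintro ⟨i, s⟩ - ⟨j, t⟩ - h
    have hi := congrFun h i
    simp only [Pi.smul_apply, ε_apply, smul_eq_mul, if_true, mul_one] at hi
    by_cases hij : i = j
    · subst hij
      rw [if_pos rfl, mul_one] at hi
      have := mul_left_cancel₀ hc hi
      have hst : s = t := Units.ext (by exact_mod_cast this)
      rw [hst]
    · rw [if_neg hij, mul_zero] at hi
      rcases mul_eq_zero.mp hi with h | h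
      · exact absurd h hc
      · rcases sign_cases s with h' | h' <;> rw [h'] at h <;> norm_num at h

theorem sum_rootsA (g : (Fin (n + 1) → ℝ) → ℂ) :
    ∑ α ∈ rootsA n, g α = ∑ i, ∑ j, (if i ≠ j then g (ε i - ε j) else 0) := by
  rw [rootsA, Finset.sum_image, Finset.sum_filter, Fintype.sum_prod_type]
  rintro ⟨i, j⟩ hij ⟨i', j'⟩ hij' h
  simp only [Finset.coe_filter, Finset.mem_univ, true_and, Set.mem_ofPred_eq] at hij hij'
  have hi := congrFun h i
  have hj := congrFun h j
  simp only [Pi.sub_apply, ε_apply, if_true, hij, if_false, Ne.symm hij] at hi hj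
  have h1 : i = i' := by
    by_contra hne
    rw [if_neg hne] at hi
    split_ifs at hi <;> norm_num at hi
  have h2 : j = j' := by
    by_contra hne
    rw [if_neg hne] at hj
    split_ifs at hj <;> norm_num at hj
  rw [h1, h2]

/-- A root `±ε_i ± ε_j` arises from exactly two index pairs, one for each ordering; hence the factor
`2` in `sum_pmRoots`. -/
theorem pmVector_eq {i j i' j' : Fin n} {s t s' t' : ℤˣ} (hij : i ≠ j) (hij' : i' ≠ j')
    (h : ((s : ℤ) : ℝ) • ε i + ((t : ℤ) : ℝ) • ε j =
      ((s' : ℤ) : ℝ) • ε i' + ((t' : ℤ) : ℝ) • (ε j' : Fin n → ℝ)) :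
    (i = i' ∧ j = j' ∧ s = s' ∧ t = t') ∨ (i = j' ∧ j = i' ∧ s = t' ∧ t = s') := by
  have hcast : ∀ a b : ℤˣ, ((a : ℤ) : ℝ) = ((b : ℤ) : ℝ) → a = b := fun a b h =>
    Units.ext (by exact_mod_cast h)
  have hne : ∀ a : ℤˣ, ((a : ℤ) : ℝ) ≠ 0 := fun a h => by
    rcases sign_cases a with h' | h' <;> rw [h'] at h <;> norm_num at h
  have hi := congrFun h i
  have hj := congrFun h j
  simp only [Pi.add_apply, Pi.smul_apply, ε_apply, if_true, hij, hij.symm, if_false, smul_eq_mul,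
    mul_one, mul_zero, add_zero, zero_add] at hi hj
  by_cases h1 : i = i'
  · subst h1
    simp only [if_true, hij', if_false, mul_one, mul_zero, add_zero, hij.symm, zero_add] at hi hj
    by_cases h2 : j = j'
    · subst h2
      simp only [if_true, mul_one] at hj
      exact Or.inl ⟨rfl, rfl, hcast _ _ hi, hcast _ _ hj⟩
    · rw [if_neg h2, mul_zero] at hj
      exact absurd hj (hne _)
  · rw [if_neg h1, mul_zero, zero_add] at hi
    by_cases h2 : i = j'
    · subst h2
      simp only [if_true, mul_one, hij.symm, if_false, mul_zero, add_zero] at hi hj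
      by_cases h3 : j = i'
      · subst h3
        simp only [if_true, mul_one] at hj
        exact Or.inr ⟨rfl, rfl, hcast _ _ hi, hcast _ _ hj⟩
      · rw [if_neg h3, mul_zero] at hj
        exact absurd hj (hne _)
    · rw [if_neg h2, mul_zero] at hi
      exact absurd hi (hne _)

theorem sum_pmRoots (g : (Fin n → ℝ) → ℂ) :
    2 * ∑ α ∈ pmRoots n, g α = ∑ i, ∑ j, (if i ≠ j then
      g (ε i + ε j) + g (ε i - ε j) + g (-ε i + ε j) + g (-ε i - ε j) else 0) := by
  set F : ((Fin n × Fin n) × (ℤˣ × ℤˣ)) → (Fin n → ℝ) := fun p =>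
    ((p.2.1 : ℤ) : ℝ) • ε p.1.1 + ((p.2.2 : ℤ) : ℝ) • ε p.1.2 with hF
  set P : Finset ((Fin n × Fin n) × (ℤˣ × ℤˣ)) :=
    (Finset.univ : Finset ((Fin n × Fin n) × (ℤˣ × ℤˣ))).filter (fun p => p.1.1 ≠ p.1.2) with hP
  have h1 : ∑ p ∈ P, g (F p) = ∑ i, ∑ j, (if i ≠ j then
      g (ε i + ε j) + g (ε i - ε j) + g (-ε i + ε j) + g (-ε i - ε j) else 0) := by
    rw [hP, Finset.sum_filter, Fintype.sum_prod_type, Fintype.sum_prod_type]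
    refine Finset.sum_congr rfl fun i _ => Finset.sum_congr rfl fun j _ => ?_
    by_cases hij : i = j
    · simp [hij]
    · simp only [ne_eq, hij, not_false_eq_true, if_true]
      rw [Fintype.sum_prod_type]
      simp only [sum_units, hF]
      simp only [Units.val_one, Int.cast_one, one_smul, Units.val_neg, Int.cast_neg, neg_smul,
        ← sub_eq_add_neg]
      ring
  rw [← h1, Finset.sum_comp g F, Finset.mul_sum]
  refine Finset.sum_congr rfl fun b hb => ?_
  have hcard : (P.filter (fun p => F p = b)).card = 2 := by
    obtain ⟨p, hp, rfl⟩ := Finset.mem_image.mp hb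
    obtain ⟨⟨i, j⟩, ⟨s, t⟩⟩ := p
    have hij : i ≠ j := (Finset.mem_filter.mp hp).2
    have : P.filter (fun q => F q = F ((i, j), (s, t))) = {((i, j), (s, t)), ((j, i), (t, s))} := by
      ext ⟨⟨i', j'⟩, ⟨s', t'⟩⟩
      simp only [hP, Finset.mem_filter, Finset.mem_univ, true_and, Finset.mem_insert,
        Finset.mem_singleton, Prod.mk.injEq]
      constructor
      · rintro ⟨hne, he⟩
        rcases pmVector_eq hne hij he with ⟨a, b, c, d⟩ | ⟨a, b, c, d⟩
        · exact Or.inl ⟨⟨a, b⟩, c, d⟩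
        · exact Or.inr ⟨⟨a, b⟩, c, d⟩
      · rintro (⟨⟨rfl, rfl⟩, rfl, rfl⟩ | ⟨⟨rfl, rfl⟩, rfl, rfl⟩)
        · exact ⟨hij, rfl⟩
        · exact ⟨hij.symm, add_comm _ _⟩
    rw [this, Finset.card_pair]
    intro h
    exact hij (congrArg (fun p => p.1.1) h)
  rw [hcard, nsmul_eq_mul]
  norm_num

theorem second_moment_pmRoots (y z : Fin n → ℂ) :
    ∑ α ∈ pmRoots n, lin α y * lin α z = 4 * ((n : ℂ) - 1) * (y ⬝ᵥ z) := by
  refine mul_left_cancel₀ (two_ne_zero (α := ℂ)) ?_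
  rw [sum_pmRoots, sum_ne]
  simp only [lin_add, lin_sub, lin_neg, lin_ε]
  have e1 : ∀ i j : Fin n, (y i + y j) * (z i + z j) + (y i - y j) * (z i - z j) +
      (-y i + y j) * (-z i + z j) + (-y i - y j) * (-z i - z j) =
      4 * (y i * z i) + 4 * (y j * z j) := fun i j => by ring
  simp only [e1, Finset.sum_add_distrib, Finset.sum_const, Finset.card_univ,
    Fintype.card_fin, nsmul_eq_mul, dotProduct]
  simp only [← Finset.mul_sum]
  ring

/-- Summation over the signs kills all monomials of odd degree in a coordinate. The diagonal `i =
j`, included and then removed, shifts the coefficient of the sum over coordinates from `4 n` to `4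
(n - 4)`; in dimension four that sum disappears. -/
theorem fourth_moment_pmRoots (x y z : Fin n → ℂ) :
    ∑ α ∈ pmRoots n, lin α x ^ 2 * (lin α y * lin α z) =
      4 * ((x ⬝ᵥ x) * (y ⬝ᵥ z) + 2 * ((x ⬝ᵥ y) * (x ⬝ᵥ z)))
        + 4 * ((n : ℂ) - 4) * ∑ m, x m ^ 2 * (y m * z m) := by
  refine mul_left_cancel₀ (two_ne_zero (α := ℂ)) ?_
  rw [sum_pmRoots, sum_ne]
  simp only [lin_add, lin_sub, lin_neg, lin_ε]
  have e1 : ∀ i j : Fin n, (x i + x j) ^ 2 * ((y i + y j) * (z i + z j))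
      + (x i - x j) ^ 2 * ((y i - y j) * (z i - z j))
      + (-x i + x j) ^ 2 * ((-y i + y j) * (-z i + z j))
      + (-x i - x j) ^ 2 * ((-y i - y j) * (-z i - z j)) =
      4 * (x i ^ 2 * (y i * z i)) + 4 * (x j ^ 2 * (y j * z j))
      + (4 * (x i * x i)) * (y j * z j) + (4 * (y i * z i)) * (x j * x j)
      + (8 * (x i * y i)) * (x j * z j) + (8 * (x i * z i)) * (x j * y j) := fun i j => by ring
  have e2 : ∀ i : Fin n, (x i + x i) ^ 2 * ((y i + y i) * (z i + z i))
      + (x i - x i) ^ 2 * ((y i - y i) * (z i - z i))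
      + (-x i + x i) ^ 2 * ((-y i + y i) * (-z i + z i))
      + (-x i - x i) ^ 2 * ((-y i - y i) * (-z i - z i)) =
      32 * (x i ^ 2 * (y i * z i)) := fun i => by ring
  simp only [e2]
  simp only [e1, Finset.sum_add_distrib, Finset.sum_const,
    Finset.card_univ, Fintype.card_fin, nsmul_eq_mul, dotProduct]
  simp only [← Finset.mul_sum, ← Finset.sum_mul]
  ring

theorem second_moment_unitRoots {c : ℝ} (hc : c ≠ 0) (y z : Fin n → ℂ) :
    ∑ α ∈ unitRoots n c, lin α y * lin α z = 2 * c ^ 2 * (y ⬝ᵥ z) := by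
  rw [sum_unitRoots hc]
  simp only [lin_neg, lin_smul, lin_ε]
  rw [dotProduct, Finset.mul_sum]
  exact Finset.sum_congr rfl fun i _ => by ring

theorem fourth_moment_unitRoots {c : ℝ} (hc : c ≠ 0) (x y z : Fin n → ℂ) :
    ∑ α ∈ unitRoots n c, lin α x ^ 2 * (lin α y * lin α z) =
      2 * c ^ 4 * ∑ m, x m ^ 2 * (y m * z m) := by
  rw [sum_unitRoots hc]
  simp only [lin_neg, lin_smul, lin_ε]
  rw [Finset.mul_sum]
  exact Finset.sum_congr rfl fun i _ => by ring

theorem lin_single (α : Fin n → ℝ) (m : Fin n) : lin α (Pi.single m 1) = α m := by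
  simp [lin, cplx]

/-- The fourth moment with `x` the `m`-th basis vector. -/
theorem coordinate_moment_pmRoots (m : Fin n) (y z : Fin n → ℂ) :
    ∑ α ∈ pmRoots n, (α m : ℂ) ^ 2 * (lin α y * lin α z) =
      (4 * ((n : ℂ) - 4) + 8) * (y m * z m) + 4 * (y ⬝ᵥ z) := by
  have := fourth_moment_pmRoots (Pi.single m 1) y z
  simp only [lin_single] at this
  rw [this]
  have e : ∑ l, (Pi.single m 1 : Fin n → ℂ) l ^ 2 * (y l * z l) = y m * z m := by
    rw [Finset.sum_eq_single m] <;> simp +contextual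
  rw [e]
  simp
  ring

theorem coordinate_moment_unitRoots {c : ℝ} (hc : c ≠ 0) (m : Fin n) (y z : Fin n → ℂ) :
    ∑ α ∈ unitRoots n c, (α m : ℂ) ^ 2 * (lin α y * lin α z) = 2 * c ^ 4 * (y m * z m) := by
  have := fourth_moment_unitRoots hc (Pi.single m 1) y z
  simp only [lin_single] at this
  rw [this]
  have e : ∑ l, (Pi.single m 1 : Fin n → ℂ) l ^ 2 * (y l * z l) = y m * z m := by
    rw [Finset.sum_eq_single m] <;> simp +contextual
  rw [e]

theorem second_moment_rootsA {y z : Fin (n + 1) → ℂ} (hy : ∑ i, y i = 0) :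
    ∑ α ∈ rootsA n, lin α y * lin α z = 2 * ((n : ℂ) + 1) * (y ⬝ᵥ z) := by
  rw [sum_rootsA, sum_ne]
  simp only [sub_self, lin_zero, lin_sub, lin_ε, mul_zero, Finset.sum_const_zero, sub_zero]
  have e1 : ∀ i j : Fin (n + 1), (y i - y j) * (z i - z j) =
      y i * z i + y j * z j - z i * y j - y i * z j := fun i j => by ring
  simp only [e1, Finset.sum_add_distrib, Finset.sum_sub_distrib, Finset.sum_const,
    Finset.card_univ, Fintype.card_fin, nsmul_eq_mul, dotProduct]
  simp only [← Finset.mul_sum, ← Finset.sum_mul, hy]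
  push_cast
  ring

/-- In the expansion every monomial with a single factor in one of the indices `i`, `j` sums to
zero, because the coordinate sums vanish. -/
theorem fourth_moment_rootsA {x y z : Fin (n + 1) → ℂ} (hx : ∑ i, x i = 0) (hy : ∑ i, y i = 0)
    (hz : ∑ i, z i = 0) :
    ∑ α ∈ rootsA n, lin α x ^ 2 * (lin α y * lin α z) =
      2 * ((x ⬝ᵥ x) * (y ⬝ᵥ z) + 2 * ((x ⬝ᵥ y) * (x ⬝ᵥ z)))
        + 2 * ((n : ℂ) + 1) * ∑ m, x m ^ 2 * (y m * z m) := by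
  rw [sum_rootsA, sum_ne]
  simp only [sub_self, lin_zero, lin_sub, lin_ε, mul_zero, Finset.sum_const_zero, sub_zero]
  have e1 : ∀ i j : Fin (n + 1), (x i - x j) ^ 2 * ((y i - y j) * (z i - z j)) =
      x i ^ 2 * (y i * z i) + x j ^ 2 * (y j * z j)
      + (x i * x i) * (y j * z j) + (y i * z i) * (x j * x j)
      + (2 * (x i * y i)) * (x j * z j) + (2 * (x i * z i)) * (x j * y j)
      - (x i * x i * y i) * z j - (x i * x i * z i) * y j - (2 * (x i * y i * z i)) * x j
      - z i * (x j * x j * y j) - y i * (x j * x j * z j)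
      - (2 * x i) * (x j * y j * z j) := fun i j => by ring
  simp only [e1, Finset.sum_add_distrib, Finset.sum_sub_distrib, Finset.sum_const,
    Finset.card_univ, Fintype.card_fin, nsmul_eq_mul, dotProduct]
  simp only [← Finset.mul_sum, ← Finset.sum_mul, hx, hy, hz]
  push_cast
  ring

/-- The basis vector at `m` does not have sum zero, so the fourth moment cannot be specialised.
Instead `(α m)²` selects the roots with `i = m` or `j = m`. -/
theorem coordinate_moment_rootsA (m : Fin (n + 1)) {y z : Fin (n + 1) → ℂ} (hy : ∑ i, y i = 0)
    (hz : ∑ i, z i = 0) :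
    ∑ α ∈ rootsA n, (α m : ℂ) ^ 2 * (lin α y * lin α z) =
      2 * ((n : ℂ) + 1) * (y m * z m) + 2 * (y ⬝ᵥ z) := by
  rw [sum_rootsA, sum_ne]
  simp only [sub_self, lin_zero, lin_sub, lin_ε, mul_zero, Finset.sum_const_zero, sub_zero,
    Pi.sub_apply]
  have e1 : ∀ i j : Fin (n + 1), (((ε i m - ε j m : ℝ) : ℂ)) ^ 2 * ((y i - y j) * (z i - z j)) =
      (if i = m then (y i - y j) * (z i - z j) else 0)
        + (if j = m then (y i - y j) * (z i - z j) else 0) := by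
    intro i j
    simp only [ε_apply, eq_comm (a := m)]
    by_cases h1 : i = m <;> by_cases h2 : j = m
    · subst h1; subst h2; simp
    · simp [h1, h2]
    · simp [h1, h2]
    · simp [h1, h2]
  simp only [e1, Finset.sum_add_distrib]
  rw [Finset.sum_comm (f := fun i j => if i = m then (y i - y j) * (z i - z j) else 0)]
  simp only [Finset.sum_ite_eq', Finset.mem_univ, if_true]
  have e2 : ∀ j : Fin (n + 1), (y m - y j) * (z m - z j) =
      y m * z m + y j * z j - z m * y j - y m * z j := fun j => by ring
  have e3 : ∀ j : Fin (n + 1), (y j - y m) * (z j - z m) =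
      y m * z m + y j * z j - z m * y j - y m * z j := fun j => by ring
  simp only [e2, e3, Finset.sum_add_distrib, Finset.sum_sub_distrib, ← Finset.mul_sum,
    Finset.sum_const, Finset.card_univ, Fintype.card_fin, nsmul_eq_mul, dotProduct, hy, hz]
  push_cast
  ring

end Sums

end ToricConnection
end

noncomputable section

open scoped Classical

namespace ToricConnection

open Matrix

/-! ### Pair sums of the vectors `± ε_i ± ε_j` and `± c ε_i` -/

section PlusMinus

variable {n : ℕ}

theorem ofReal_dot_eq_lin (α β : Fin n → ℝ) : ((α ⬝ᵥ β : ℝ) : ℂ) = lin β (cplx α) := by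
  rw [lin_cplx, dotProduct_comm]

theorem HasPairSum.symm {R A B : Finset (Fin n → ℝ)} {g : ℂ} (h : HasPairSum R A B g) :
    HasPairSum R B A g := fun u hu v hv w hw t ht => by
  rw [pairSum_comm, h u hu v hv w hw t ht]

theorem hasSecondMoment_pmRoots (R : Finset (Fin n → ℝ)) :
    HasSecondMoment R (pmRoots n) (4 * ((n : ℝ) - 1)) := fun y _ z _ => by
  rw [second_moment_pmRoots]
  push_cast
  ring

theorem hasFourthMoment_pmRoots (R : Finset (Fin n → ℝ)) :
    HasFourthMoment R (pmRoots n) 4 (4 * ((n : ℝ) - 4)) := fun α _ y _ z _ => by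
  simp only [ofReal_dot_eq_lin, fourth_moment_pmRoots]
  simp only [lin, cplx]
  push_cast
  ring

theorem hasSecondMoment_unitRoots (R : Finset (Fin n → ℝ)) {c : ℝ} (hc : c ≠ 0) :
    HasSecondMoment R (unitRoots n c) (2 * c ^ 2) := fun y _ z _ => by
  rw [second_moment_unitRoots hc]
  push_cast
  ring

theorem hasFourthMoment_unitRoots (R : Finset (Fin n → ℝ)) {c : ℝ} (hc : c ≠ 0) :
    HasFourthMoment R (unitRoots n c) 0 (2 * c ^ 4) := fun α _ y _ z _ => by
  simp only [ofReal_dot_eq_lin, fourth_moment_unitRoots hc]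
  simp only [cplx]
  push_cast
  ring

variable {R : Finset (Fin n → ℝ)}

theorem hasPairSum_pmRoots (h : pmRoots n ⊆ R) :
    HasPairSum R (pmRoots n) (pmRoots n) (48 * ((n : ℂ) - 2)) := by
  have := hasPairSum_of_moments h (fun α => pmRoots_dot) (hasSecondMoment_pmRoots R)
    (hasFourthMoment_pmRoots R) (e := 4 * ((n : ℝ) - 4) + 8) (f := 4)
    (fun m y _ z _ => by rw [coordinate_moment_pmRoots]; push_cast; ring)
  convert this using 1
  push_cast
  ring

theorem hasPairSum_pmRoots_unitRoots (h : pmRoots n ⊆ R) {c : ℝ} (hc : c ≠ 0) :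
    HasPairSum R (pmRoots n) (unitRoots n c) (8 * (c : ℂ) ^ 4) := by
  have := hasPairSum_of_moments h (fun α => pmRoots_dot) (hasSecondMoment_pmRoots R)
    (hasFourthMoment_unitRoots R hc) (e := 4 * ((n : ℝ) - 4) + 8) (f := 4)
    (fun m y _ z _ => by rw [coordinate_moment_pmRoots]; push_cast; ring)
  convert this using 1
  push_cast
  ring

theorem hasPairSum_unitRoots {c : ℝ} (hc : c ≠ 0) (h : unitRoots n c ⊆ R) :
    HasPairSum R (unitRoots n c) (unitRoots n c) 0 := by
  have := hasPairSum_of_moments h (fun α => unitRoots_dot) (hasSecondMoment_unitRoots R hc)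
    (hasFourthMoment_unitRoots R hc) (e := 2 * c ^ 4) (f := 0)
    (fun m y _ z _ => by rw [coordinate_moment_unitRoots hc]; push_cast; ring)
  convert this using 1
  push_cast
  ring

theorem add_mem_pmRoots {i j : Fin n} (h : i ≠ j) : ε i + ε j ∈ pmRoots n :=
  mem_pmRoots'.mpr ⟨i, j, 1, 1, h, by simp⟩

theorem sub_mem_pmRoots {i j : Fin n} (h : i ≠ j) : ε i - ε j ∈ pmRoots n :=
  mem_pmRoots'.mpr ⟨i, j, 1, -1, h, by simp [sub_eq_add_neg]⟩

theorem smul_mem_unitRoots (c : ℝ) (i : Fin n) : c • ε i ∈ unitRoots n c :=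
  mem_unitRoots'.mpr ⟨i, 1, by simp⟩

theorem exists_independent_pmRoots (hn : 2 ≤ n) (h : pmRoots n ⊆ R) :
    ∃ α ∈ R, ∃ β ∈ R, ∀ s t : ℂ, s • cplx α = t • cplx β → s = 0 ∧ t = 0 := by
  have h01 : (⟨0, by omega⟩ : Fin n) ≠ ⟨1, by omega⟩ := by simp
  refine ⟨_, h (add_mem_pmRoots h01), _, h (sub_mem_pmRoots h01), fun s t hst => ?_⟩
  have h0 := congrFun hst ⟨0, by omega⟩
  have h1 := congrFun hst ⟨1, by omega⟩
  simp [cplx, ε_apply] at h0 h1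
  subst h0
  have : s = 0 := by linear_combination h1 / 2
  exact ⟨this, this⟩

theorem ε_dot (i : Fin n) (x : Fin n → ℝ) : ε i ⬝ᵥ x = x i := by
  simp [ε]

theorem dot_ε (i : Fin n) (x : Fin n → ℝ) : x ⬝ᵥ ε i = x i := by
  simp [ε]

/-- The coordinates in the support of a root `± ε_i ± ε_j` are detected by this root and the
orthogonal one with the same support. -/
theorem apply_eq_zero_of_orthogonal_pmRoot (h : pmRoots n ⊆ R) {i j : Fin n} (hij : i ≠ j)
    {s t : ℤˣ} {v : LieAlg R}
    (hv : asForm R (((s : ℤ) : ℝ) • ε i + ((t : ℤ) : ℝ) • ε j) v = 0)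
    (hβ : ∀ β ∈ R, (((s : ℤ) : ℝ) • ε i + ((t : ℤ) : ℝ) • ε j) ⬝ᵥ β = 0 → asForm R β v = 0) :
    v.1 i = 0 ∧ v.1 j = 0 := by
  have h2 := hβ (((s : ℤ) : ℝ) • ε i + (((-t : ℤˣ) : ℤ) : ℝ) • ε j)
    (h (mem_pmRoots'.mpr ⟨i, j, s, -t, hij, rfl⟩)) (by
      rw [add_dotProduct, smul_dotProduct, smul_dotProduct, ε_dot, ε_dot]
      simp only [Pi.add_apply, Pi.smul_apply, ε_apply, hij, hij.symm, if_true, if_false,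
        smul_eq_mul, Units.val_neg, Int.cast_neg]
      linear_combination sign_sq s - sign_sq t)
  rw [asForm_eq_lin, lin_add, lin_smul, lin_smul, lin_ε, lin_ε] at hv h2
  have hs : (((s : ℤ) : ℝ) : ℂ) * (((s : ℤ) : ℝ) : ℂ) = 1 := by exact_mod_cast sign_sq s
  have ht : (((t : ℤ) : ℝ) : ℂ) * (((t : ℤ) : ℝ) : ℂ) = 1 := by exact_mod_cast sign_sq t
  rw [Units.val_neg, Int.cast_neg, Complex.ofReal_neg] at h2
  generalize (((s : ℤ) : ℝ) : ℂ) = s' at *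
  generalize (((t : ℤ) : ℝ) : ℂ) = t' at *
  exact ⟨by linear_combination s' / 2 * (hv + h2) - hs * v.1 i,
    by linear_combination t' / 2 * (hv - h2) - ht * v.1 j⟩

end PlusMinus

/-! ### Type D -/

section TypeD

variable {n : ℕ}

/-- The two coordinates in the support of `α` vanish by `apply_eq_zero_of_orthogonal_pmRoot`. For
another index `l`, a fourth index `m` exists as `n ≥ 4`, and `ε_l ± ε_m` are orthogonal to `α` and
force the coordinate at `l` to vanish. -/
theorem rootsD_complement (hn : 4 ≤ n) (α : rootsD n) (v : LieAlg (rootsD n))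
    (hv : asForm (rootsD n) α.1 v = 0)
    (hβ : ∀ β : rootsD n, α.1 ⬝ᵥ β.1 = 0 → asForm (rootsD n) β.1 v = 0) : v = 0 := by
  obtain ⟨α, hα⟩ := α
  have hβ' : ∀ β ∈ rootsD n, α ⬝ᵥ β = 0 → asForm _ β v = 0 := fun β hβR => hβ ⟨β, hβR⟩
  obtain ⟨i, j, s, t, hij, rfl⟩ := mem_pmRoots'.mp hα
  obtain ⟨h1, h2⟩ := apply_eq_zero_of_orthogonal_pmRoot (Finset.Subset.refl _) hij hv hβ'
  refine Subtype.ext (funext fun l => ?_)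
  by_cases hli : l = i
  · rw [hli]; exact h1
  by_cases hlj : l = j
  · rw [hlj]; exact h2
  obtain ⟨m, hm⟩ : ∃ m, m ∉ ({i, j, l} : Finset (Fin n)) := by
    by_contra! h
    have h3 : Fintype.card (Fin n) ≤ ({i, j, l} : Finset (Fin n)).card :=
      Finset.card_le_card fun m _ => h m
    have := Finset.card_le_three (a := i) (b := j) (c := l)
    rw [Fintype.card_fin] at h3
    omega
  simp only [Finset.mem_insert, Finset.mem_singleton, not_or] at hm
  obtain ⟨hmi, hmj, hml⟩ := hm
  have hα' : ∀ x : Fin n → ℝ, x i = 0 → x j = 0 →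
      (((s : ℤ) : ℝ) • ε i + ((t : ℤ) : ℝ) • ε j) ⬝ᵥ x = 0 := fun x hi hj => by
    rw [add_dotProduct, smul_dotProduct, smul_dotProduct, ε_dot, ε_dot, hi, hj]
    simp
  have e1 := hβ' (ε l + ε m) (add_mem_pmRoots (Ne.symm hml))
    (hα' _ (by simp [ε_apply, Ne.symm hli, Ne.symm hmi]) (by simp [ε_apply, Ne.symm hlj, Ne.symm hmj]))
  have e2 := hβ' (ε l - ε m) (sub_mem_pmRoots (Ne.symm hml))
    (hα' _ (by simp [ε_apply, Ne.symm hli, Ne.symm hmi]) (by simp [ε_apply, Ne.symm hlj, Ne.symm hmj]))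
  rw [asForm_eq_lin, lin_add, lin_ε, lin_ε] at e1
  rw [asForm_eq_lin, lin_sub, lin_ε, lin_ε] at e2
  show v.1 l = 0
  linear_combination (e1 + e2) / 2

theorem isFlat_iff_D (hn : 4 ≤ n) {κ : (Fin n → ℝ) → ℂ}
    {a : LieAlg (rootsD n) →ₗ[ℂ] LieAlg (rootsD n) →ₗ[ℂ] ℂ}
    {b : LieAlg (rootsD n) →ₗ[ℂ] LieAlg (rootsD n) →ₗ[ℂ] LieAlg (rootsD n)} {k : ℂ}
    (hκ : IsMultiplicity (rootsD n) κ) (ha : IsInvariantForm (rootsD n) a)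
    (hb : IsEquivariantMap (rootsD n) b) {α : Fin n → ℝ} (hα : α ∈ rootsD n) (hk : k = κ α) :
    IsFlat (rootsD n) κ a b ↔ a = (((n : ℂ) - 2) * k ^ 2) • stdForm (rootsD n) := by
  have hR := isCrystallographic_D n
  -- `eq_of_fourthMoment` needs a nonnegative coordinate term, which is where `n ≥ 4` enters the
  -- constancy of `κ`.
  have hd : (0 : ℝ) ≤ 4 * ((n : ℝ) - 4) := by
    have : (4 : ℝ) ≤ n := by exact_mod_cast hn
    linarith
  refine isFlat_iff_of_sum hR ha hb (fun f hf => sum_coth_eq_of_pairSums hR (S := rootsD n) (T := ∅)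
    (by simp) two_pos (k := k) (k' := 0) (fun β hβ => ⟨pmRoots_dot hβ, ?_⟩) (by simp)
    (hasPairSum_pmRoots (Finset.Subset.refl _)) (HasPairSum.empty_left _)
    (HasPairSum.empty_left _) (by push_cast; ring) hf) (rootsD_complement hn)
    (exists_independent_pmRoots (by omega) (Finset.Subset.refl _))
  rw [hk]
  exact hκ.eq_of_fourthMoment hR (Finset.Subset.refl _) (fun β hβ => pmRoots_dot hβ) (by norm_num)
    hd (hasFourthMoment_pmRoots _) hβ hα

end TypeD

/-! ### Types B and C -/

section TypeBC

variable {n : ℕ} {c : ℝ}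

/-- The roots `c ε_l` with `α l = 0` are orthogonal to `α` and detect the coordinates outside the
support of `α`. Inside the support, `α` suffices if it is a multiple of `ε_i`; otherwise it is
helped by the orthogonal root with the same support. -/
theorem pm_union_unit_complement (hc : c ≠ 0) (α : (pmRoots n ∪ unitRoots n c : Finset _))
    (v : LieAlg (pmRoots n ∪ unitRoots n c)) (hv : asForm _ α.1 v = 0)
    (hβ : ∀ β : (pmRoots n ∪ unitRoots n c : Finset _), α.1 ⬝ᵥ β.1 = 0 → asForm _ β.1 v = 0) :
    v = 0 := by
  obtain ⟨α, hα⟩ := α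
  have hβ' : ∀ β ∈ pmRoots n ∪ unitRoots n c, α ⬝ᵥ β = 0 → asForm _ β v = 0 := fun β hβR => hβ ⟨β, hβR⟩
  have hunit : ∀ l, α l = 0 → v.1 l = 0 := by
    intro l hl
    have := hβ' (c • ε l) (Finset.mem_union_right _ (smul_mem_unitRoots c l))
      (by rw [dotProduct_smul, dot_ε, hl, smul_zero])
    rw [asForm_eq_lin, lin_smul, lin_ε] at this
    exact (mul_eq_zero.mp this).resolve_left (by exact_mod_cast hc)
  refine Subtype.ext (funext fun l => ?_)
  by_cases hl : α l = 0
  · exact hunit l hl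
  rcases Finset.mem_union.mp hα with h | h
  · obtain ⟨i, j, s, t, hij, rfl⟩ := mem_pmRoots'.mp h
    obtain ⟨h1, h2⟩ := apply_eq_zero_of_orthogonal_pmRoot Finset.subset_union_left hij hv hβ'
    by_cases hli : l = i
    · rw [hli]; exact h1
    by_cases hlj : l = j
    · rw [hlj]; exact h2
    exact absurd (by simp [ε_apply, hli, hlj]) hl
  · obtain ⟨i, s, rfl⟩ := mem_unitRoots'.mp h
    by_cases hli : l = i
    · rw [asForm_eq_lin, lin_smul, lin_ε] at hv
      rw [hli]
      refine (mul_eq_zero.mp hv).resolve_left ?_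
      rcases sign_cases s with h | h <;> rw [h] <;> simpa using hc
    · exact absurd (by simp [ε_apply, hli]) hl

theorem realReflection_unit {i : Fin n} (x : Fin n → ℝ) (hc : c ≠ 0) :
    realReflection (c • ε i) x = x - (2 * x i) • ε i := by
  rw [realReflection_smul_left hc, realReflection_of_dot (c := 2 * x i)]
  · intro h
    have := congrFun h i
    simp [ε_apply] at this
  · rw [dot_ε, ε_dot, ε_apply, if_pos rfl, mul_one]

/-- The coordinate term of the fourth moment is negative for `n < 4`, so the moment criterion is not
available. Reflections in `c ε_j` normalise both signs, and roots `ε_i + ε_j` sharing an index are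
not orthogonal. -/
theorem IsMultiplicity.eq_on_pmRoots {κ : (Fin n → ℝ) → ℂ} (hc : c = 1 ∨ c = 2)
    (hκ : IsMultiplicity (pmRoots n ∪ unitRoots n c) κ) {α β : Fin n → ℝ} (hα : α ∈ pmRoots n)
    (hβ : β ∈ pmRoots n) : κ α = κ β := by
  have hc0 : c ≠ 0 := by rcases hc with h | h <;> rw [h] <;> norm_num
  have hR := isCrystallographic_pm_union_unit n hc
  have flip : ∀ (i j : Fin n) (s t : ℤˣ), i ≠ j → κ (((s : ℤ) : ℝ) • ε i + ((t : ℤ) : ℝ) • ε j) =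
      κ (((s : ℤ) : ℝ) • ε i + ε j) := by
    intro i j s t hij
    rcases sign_cases t with h | h
    · rw [h, one_smul]
    · have := hκ (c • ε j) (Finset.mem_union_right _ (smul_mem_unitRoots c j))
        (((s : ℤ) : ℝ) • ε i + ((t : ℤ) : ℝ) • ε j)
        (Finset.mem_union_left _ (mem_pmRoots'.mpr ⟨i, j, s, t, hij, rfl⟩))
      rw [realReflection_unit _ hc0] at this
      rw [← this]
      congr 1
      simp only [Pi.add_apply, Pi.smul_apply, ε_apply, hij.symm, if_true, if_false, h, smul_eq_mul]
      module
  have flip' : ∀ (i j : Fin n) (s t : ℤˣ), i ≠ j →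
      κ (((s : ℤ) : ℝ) • ε i + ((t : ℤ) : ℝ) • ε j) = κ (ε i + ε j) := by
    intro i j s t hij
    rw [flip i j s t hij, add_comm]
    have := flip j i 1 s hij.symm
    rw [show ((((1 : ℤˣ) : ℤ) : ℝ)) = 1 by simp, one_smul] at this
    rw [this, add_comm]
  have share : ∀ i j j' : Fin n, i ≠ j → i ≠ j' → κ (ε i + ε j) = κ (ε i + ε j') := by
    intro i j j' h h'
    refine hκ.eq_of_dot_ne_zero hR (Finset.mem_union_left _ (add_mem_pmRoots h))
      (Finset.mem_union_left _ (add_mem_pmRoots h')) ?_ ?_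
    · rw [pmRoots_dot (add_mem_pmRoots h), pmRoots_dot (add_mem_pmRoots h')]
    · rw [add_dotProduct, ε_dot, ε_dot]
      by_cases hj : j = j' <;> simp [ε_apply, h', h.symm, h'.symm, hj]
  obtain ⟨i, j, s, t, hij, rfl⟩ := mem_pmRoots'.mp hα
  obtain ⟨i', j', s', t', hij', rfl⟩ := mem_pmRoots'.mp hβ
  rw [flip' i j s t hij, flip' i' j' s' t' hij']
  by_cases h : i = i'
  · subst h
    exact share i j j' hij hij'
  · rw [share i j i' hij h, add_comm (ε i), share i' i j' (Ne.symm h) hij']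

theorem IsMultiplicity.eq_on_unitRoots {κ : (Fin n → ℝ) → ℂ} (hc : c = 1 ∨ c = 2)
    (hκ : IsMultiplicity (pmRoots n ∪ unitRoots n c) κ) {α β : Fin n → ℝ} (hα : α ∈ unitRoots n c)
    (hβ : β ∈ unitRoots n c) : κ α = κ β := by
  have hR := isCrystallographic_pm_union_unit n hc
  have hneg : ∀ (i : Fin n) (s : ℤˣ), κ ((c * ((s : ℤ) : ℝ)) • ε i) = κ (c • ε i) := by
    intro i s
    rcases sign_cases s with h | h
    · rw [h, mul_one]
    · rw [h, ← hκ.neg hR (Finset.mem_union_right _ (smul_mem_unitRoots c i))]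
      congr 1
      module
  obtain ⟨i, s, rfl⟩ := mem_unitRoots'.mp hα
  obtain ⟨j, t, rfl⟩ := mem_unitRoots'.mp hβ
  rw [hneg, hneg]
  by_cases hij : i = j
  · rw [hij]
  have hm := Finset.mem_union_left (unitRoots n c) (sub_mem_pmRoots hij)
  have := hκ (ε i - ε j) hm (c • ε j) (Finset.mem_union_right _ (smul_mem_unitRoots c j))
  rw [realReflection_of_dot (c := -c) (fun h => hR.ne_zero (h ▸ hm))] at this
  · rw [← this]
    congr 1
    module
  · rw [pmRoots_dot (sub_mem_pmRoots hij), smul_dotProduct, ε_dot]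
    simp [ε_apply, Ne.symm hij]
    ring

/-- Here `ℓ = 1` and the short roots are `±ε_i`. The pair sums are `0` (short), `8` (mixed) and `48
(n - 2)` (long), so `hc` reads `48 (n - 2) k² + 48 k k' = 48 c` in the notation of the theorem. -/
theorem isFlat_iff_B (hn : 2 ≤ n) {κ : (Fin n → ℝ) → ℂ}
    {a : LieAlg (rootsB n) →ₗ[ℂ] LieAlg (rootsB n) →ₗ[ℂ] ℂ}
    {b : LieAlg (rootsB n) →ₗ[ℂ] LieAlg (rootsB n) →ₗ[ℂ] LieAlg (rootsB n)}
    (hκ : IsMultiplicity (rootsB n) κ) (ha : IsInvariantForm (rootsB n) a)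
    (hb : IsEquivariantMap (rootsB n) b) {α β : Fin n → ℝ} (hα : α ∈ pmRoots n)
    (hβ : β ∈ unitRoots n 1) :
    IsFlat (rootsB n) κ a b ↔
      a = (((n : ℂ) - 2) * κ α ^ 2 + κ α * κ β) • stdForm (rootsB n) := by
  have e := rootsB_eq n
  generalize rootsB n = R at *
  subst e
  have hR := isCrystallographic_pm_union_unit n (c := 1) (Or.inl rfl)
  exact isFlat_iff_of_sum hR ha hb (fun f hf => sum_coth_eq_of_pairSums hR (Finset.union_comm _ _)
    one_pos (k := κ β) (k' := κ α)
    (fun γ hγ => ⟨by rw [unitRoots_dot hγ]; norm_num, hκ.eq_on_unitRoots (Or.inl rfl) hγ hβ⟩)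
    (fun γ hγ => ⟨by rw [pmRoots_dot hγ]; norm_num, hκ.eq_on_pmRoots (Or.inl rfl) hγ hα⟩)
    (hasPairSum_unitRoots one_ne_zero Finset.subset_union_right)
    (hasPairSum_pmRoots_unitRoots Finset.subset_union_left one_ne_zero)
    (hasPairSum_pmRoots Finset.subset_union_left) (by push_cast; ring) hf)
    (pm_union_unit_complement one_ne_zero)
    (exists_independent_pmRoots hn Finset.subset_union_left)

/-- Here `ℓ = 2` and the roots `±2 ε_i` are long. The pair sums are `48 (n - 2)`, `8 · 2⁴ = 128` and
`0`, so `hc` reads `384 (n - 2) k² + 768 k k' = 384 c`. -/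
theorem isFlat_iff_C (hn : 2 ≤ n) {κ : (Fin n → ℝ) → ℂ}
    {a : LieAlg (rootsC n) →ₗ[ℂ] LieAlg (rootsC n) →ₗ[ℂ] ℂ}
    {b : LieAlg (rootsC n) →ₗ[ℂ] LieAlg (rootsC n) →ₗ[ℂ] LieAlg (rootsC n)}
    (hκ : IsMultiplicity (rootsC n) κ) (ha : IsInvariantForm (rootsC n) a)
    (hb : IsEquivariantMap (rootsC n) b) {α β : Fin n → ℝ} (hα : α ∈ pmRoots n)
    (hβ : β ∈ unitRoots n 2) :
    IsFlat (rootsC n) κ a b ↔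
      a = (((n : ℂ) - 2) * κ α ^ 2 + 2 * κ α * κ β) • stdForm (rootsC n) := by
  have e := rootsC_eq n
  generalize rootsC n = R at *
  subst e
  have hR := isCrystallographic_pm_union_unit n (c := 2) (Or.inr rfl)
  exact isFlat_iff_of_sum hR ha hb (fun f hf => sum_coth_eq_of_pairSums hR rfl
    two_pos (k := κ α) (k' := κ β)
    (fun γ hγ => ⟨pmRoots_dot hγ, hκ.eq_on_pmRoots (Or.inr rfl) hγ hα⟩)
    (fun γ hγ => ⟨by rw [unitRoots_dot hγ]; norm_num, hκ.eq_on_unitRoots (Or.inr rfl) hγ hβ⟩)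
    (hasPairSum_pmRoots Finset.subset_union_left)
    (hasPairSum_pmRoots_unitRoots Finset.subset_union_left two_ne_zero).symm
    (hasPairSum_unitRoots two_ne_zero Finset.subset_union_right) (by push_cast; ring) hf)
    (pm_union_unit_complement two_ne_zero)
    (exists_independent_pmRoots hn Finset.subset_union_left)

end TypeBC

end ToricConnection

end

noncomputable section

open scoped Classical

namespace ToricConnection

open Matrix

theorem map_eq_zero_of_mem_lieAlg {N : ℕ} {R : Finset (Fin N → ℝ)} {φ : (Fin N → ℂ) →ₗ[ℂ] ℂ}
    (h : ∀ α ∈ R, φ (cplx α) = 0) {u : Fin N → ℂ} (hu : u ∈ LieAlg R) : φ u = 0 := by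
  have : LieAlg R ≤ LinearMap.ker φ := Submodule.span_le.mpr (by
    rintro _ ⟨α, hα, rfl⟩
    exact h α hα)
  exact this hu

/-! ### Type A, with the equivariant map `b` -/

section TypeA

variable {n : ℕ}

theorem sum_eq_zero_of_mem_lieAlg_A {u : Fin (n + 1) → ℂ} (hu : u ∈ LieAlg (rootsA n)) :
    ∑ i, u i = 0 := by
  have := map_eq_zero_of_mem_lieAlg (φ := ∑ i, LinearMap.proj i) (fun α hα => ?_) hu
  · simpa using this
  · obtain ⟨i, j, hij, rfl⟩ := mem_rootsA.mp hα
    simp [cplx, ε_apply, Finset.sum_sub_distrib, apply_ite Complex.ofReal]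

theorem hasSecondMoment_rootsA : HasSecondMoment (rootsA n) (rootsA n) (2 * ((n : ℝ) + 1)) :=
  fun y hy z _ => by
  rw [second_moment_rootsA (sum_eq_zero_of_mem_lieAlg_A hy)]
  push_cast
  ring

theorem hasFourthMoment_rootsA :
    HasFourthMoment (rootsA n) (rootsA n) 2 (2 * ((n : ℝ) + 1)) := fun α hα y hy z hz => by
  simp only [ofReal_dot_eq_lin]
  rw [fourth_moment_rootsA (sum_eq_zero_of_mem_lieAlg_A (Submodule.subset_span ⟨α, hα, rfl⟩))
    (sum_eq_zero_of_mem_lieAlg_A hy) (sum_eq_zero_of_mem_lieAlg_A hz)]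
  simp only [lin, cplx]
  push_cast
  ring

theorem hasPairSum_rootsA :
    HasPairSum (rootsA n) (rootsA n) (rootsA n) (12 * ((n : ℂ) + 1)) := by
  have := hasPairSum_of_moments (Finset.Subset.refl _) (fun α => rootsA_dot) hasSecondMoment_rootsA
    (hasFourthMoment_rootsA (n := n)) (e := 2 * ((n : ℝ) + 1)) (f := 2)
    (fun m y hy z hz => by
      rw [coordinate_moment_rootsA m (sum_eq_zero_of_mem_lieAlg_A hy)
        (sum_eq_zero_of_mem_lieAlg_A hz)]
      push_cast
      ring)
  convert this using 1
  push_cast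
  ring

/-- The coordinates of `b(u, v)` in type `A_n`. -/
theorem bA_apply (k' : ℂ) (u v : LieAlg (rootsA n)) (m : Fin (n + 1)) :
    (bA n k' u v).1 m = k' / 2 * (((n : ℂ) + 1) * (u.1 m * v.1 m) - u.1 ⬝ᵥ v.1) := by
  have hn : ((n : ℂ) + 1) ≠ 0 := by exact_mod_cast Nat.succ_ne_zero n
  set F : Fin (n + 1) → Fin (n + 1) → ℂ := fun i j =>
    (u.1 i - u.1 j) * (v.1 i - v.1 j) * ((primed n i j).1 m) with hF
  have hsymm : ∀ i j, F i j = F j i := fun i j => by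
    simp only [hF, primed, add_comm (ε i) (ε j)]
    ring
  have h1 : (bA n k' u v).1 m = k' / 2 * ∑ i, ∑ j, if i < j then F i j else 0 := by
    simp only [bA, LinearMap.smul_apply, LinearMap.sum_apply]
    rw [← Fintype.sum_prod_type', ← Finset.sum_filter]
    simp only [Submodule.coe_smul, Submodule.coe_sum, Pi.smul_apply, Finset.sum_apply, smul_eq_mul]
    congr 1
    refine Finset.sum_congr rfl fun p _ => ?_
    simp only [LinearMap.smulRight_apply, LinearMap.smul_apply, ContinuousLinearMap.coe_coe,
      asForm_eq_lin, lin_sub, lin_ε, Submodule.coe_smul, Pi.smul_apply, smul_eq_mul, hF]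
    ring
  -- `F` is symmetric and vanishes on the diagonal, so the sum over positive roots is half of the
  -- full double sum.
  have h2 : 2 * ∑ i, ∑ j, (if i < j then F i j else 0) = ∑ i, ∑ j, F i j := by
    have e : ∑ i, ∑ j, (if i < j then F i j else 0) = ∑ i, ∑ j, (if j < i then F i j else 0) := by
      rw [Finset.sum_comm]
      exact Finset.sum_congr rfl fun i _ => Finset.sum_congr rfl fun j _ => by rw [hsymm]
    rw [two_mul]
    nth_rewrite 2 [e]
    simp only [← Finset.sum_add_distrib]
    refine Finset.sum_congr rfl fun i _ => Finset.sum_congr rfl fun j _ => ?_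
    rcases lt_trichotomy i j with h | h | h
    · simp [h, h.le]
    · subst h; simp [hF]
    · simp [h, h.le]
  have hp : ∀ i j, (primed n i j).1 m =
      (if m = i then 1 else 0) + (if m = j then 1 else 0) - 2 / ((n : ℂ) + 1) := by
    intro i j
    simp only [primed, cplx, Pi.sub_apply, Pi.add_apply, Pi.smul_apply, Finset.sum_apply, ε_apply,
      smul_eq_mul]
    simp [apply_ite Complex.ofReal]
  have hu := sum_eq_zero_of_mem_lieAlg_A u.2
  have hv := sum_eq_zero_of_mem_lieAlg_A v.2
  have h3 : ∑ i, ∑ j, F i j = 4 * (((n : ℂ) + 1) * (u.1 m * v.1 m) - u.1 ⬝ᵥ v.1) / 2 := by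
    have e1 : ∀ i j, F i j =
        ((if m = i then (u.1 i - u.1 j) * (v.1 i - v.1 j) else 0)
        + (if m = j then (u.1 i - u.1 j) * (v.1 i - v.1 j) else 0))
        - 2 / ((n : ℂ) + 1) * ((u.1 i - u.1 j) * (v.1 i - v.1 j)) := fun i j => by
      simp only [hF, hp]
      split_ifs <;> ring
    have e2 : ∀ i, ∑ j, (u.1 i - u.1 j) * (v.1 i - v.1 j) =
        ((n : ℂ) + 1) * (u.1 i * v.1 i) + u.1 ⬝ᵥ v.1 := by
      intro i
      have : ∀ j, (u.1 i - u.1 j) * (v.1 i - v.1 j) =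
          u.1 i * v.1 i + u.1 j * v.1 j - u.1 i * v.1 j - v.1 i * u.1 j := fun j => by ring
      simp only [this, Finset.sum_add_distrib, Finset.sum_sub_distrib, ← Finset.mul_sum, hu, hv]
      simp [dotProduct]
      ring
    have e2' : ∀ i, ∑ j, (u.1 j - u.1 i) * (v.1 j - v.1 i) =
        ((n : ℂ) + 1) * (u.1 i * v.1 i) + u.1 ⬝ᵥ v.1 := by
      intro i
      rw [← e2]
      exact Finset.sum_congr rfl fun j _ => by ring
    simp only [e1, Finset.sum_sub_distrib, Finset.sum_add_distrib, ← Finset.mul_sum, e2]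
    have e3 : ∑ i, ∑ j, (if m = i then (u.1 i - u.1 j) * (v.1 i - v.1 j) else 0) =
        ((n : ℂ) + 1) * (u.1 m * v.1 m) + u.1 ⬝ᵥ v.1 := by
      rw [Finset.sum_comm]
      simp [e2]
    have e4 : ∑ i, ∑ j, (if m = j then (u.1 i - u.1 j) * (v.1 i - v.1 j) else 0) =
        ((n : ℂ) + 1) * (u.1 m * v.1 m) + u.1 ⬝ᵥ v.1 := by
      simp [e2']
    rw [e3, e4]
    simp only [dotProduct, Finset.sum_const, Finset.card_univ, Fintype.card_fin, nsmul_eq_mul]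
    push_cast
    field_simp
    ring
  rw [h1]
  linear_combination k' / 4 * (h2 + h3)

/-- The resulting cubic form is symmetric in all three arguments; the symmetry of `b` and its
self-adjointness for the inner product follow at once. -/
theorem stdForm_bA (k' : ℂ) (u v t : LieAlg (rootsA n)) :
    stdForm (rootsA n) (bA n k' u v) t =
      k' / 2 * ((n : ℂ) + 1) * ∑ m, u.1 m * v.1 m * t.1 m := by
  have ht := sum_eq_zero_of_mem_lieAlg_A t.2
  rw [stdForm_eq, dotProduct, Finset.mul_sum]
  have : ∀ m, (bA n k' u v).1 m * t.1 m = k' / 2 * ((n : ℂ) + 1) * (u.1 m * v.1 m * t.1 m)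
      - k' / 2 * (u.1 ⬝ᵥ v.1) * t.1 m := fun m => by rw [bA_apply]; ring
  simp only [this, Finset.sum_sub_distrib, ← Finset.mul_sum, ht, mul_zero, sub_zero]

theorem bA_symm (k' : ℂ) (u v : LieAlg (rootsA n)) : bA n k' u v = bA n k' v u :=
  ext_stdForm _ fun t => by
    rw [stdForm_bA, stdForm_bA]
    congr 1
    exact Finset.sum_congr rfl fun m _ => by ring

/-- The coordinatewise product is associative and commutative, so its triple products cancel. What
is left comes from the subtracted inner products: `(v, b(u,w))` is symmetric in `u, v` and drops
out, and `(u,w) v - (v,w) u` remains. -/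
theorem bA_commutator (k' : ℂ) (u v w : LieAlg (rootsA n)) :
    bA n k' v (bA n k' u w) - bA n k' u (bA n k' v w) =
      (-(((n : ℂ) + 1) / 4 * k' ^ 2)) •
        (stdForm (rootsA n) u w • v - stdForm (rootsA n) v w • u) := by
  have hu := sum_eq_zero_of_mem_lieAlg_A u.2
  have hv := sum_eq_zero_of_mem_lieAlg_A v.2
  have hdot : ∀ x y : LieAlg (rootsA n), ∑ i, x.1 i = 0 → x.1 ⬝ᵥ (bA n k' y w).1 =
      k' / 2 * ((n : ℂ) + 1) * ∑ m, y.1 m * w.1 m * x.1 m := fun x y _ => by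
    rw [← stdForm_bA, stdForm_symm, stdForm_eq]
  have hs : ∑ m, u.1 m * w.1 m * v.1 m = ∑ m, v.1 m * w.1 m * u.1 m :=
    Finset.sum_congr rfl fun m _ => by ring
  refine Subtype.ext (funext fun m => ?_)
  simp only [Submodule.coe_sub, Submodule.coe_smul, Pi.sub_apply, Pi.smul_apply, smul_eq_mul,
    bA_apply, hdot v u hv, hdot u v hu, hs, stdForm_eq]
  ring

/-- By self-adjointness of `b` every term becomes a sum over roots, and the contribution of each
root vanishes. For `α = ε_i - ε_j` and `σ = ε_i + ε_j`, the value `α(b(y,z))` is proportional to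
`y_i z_i - y_j z_j = ½ (α(y) σ(z) + σ(y) α(z))`, and the four resulting expressions cancel. -/
theorem mixed_commutator_A (κ : (Fin (n + 1) → ℝ) → ℂ) (k' : ℂ) (x : Total (rootsA n))
    (u v w : LieAlg (rootsA n)) :
    fibreProduct (rootsA n) κ 0 x v (bA n k' u w) - fibreProduct (rootsA n) κ 0 x u (bA n k' v w)
      + bA n k' v (fibreProduct (rootsA n) κ 0 x u w)
      - bA n k' u (fibreProduct (rootsA n) κ 0 x v w) = 0 := by
  have hadj : ∀ y z t : LieAlg (rootsA n), stdForm (rootsA n) (bA n k' y z) t =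
      stdForm (rootsA n) z (bA n k' y t) := fun y z t => by
    rw [stdForm_symm _ z, stdForm_bA, stdForm_bA]
    congr 1
    exact Finset.sum_congr rfl fun m _ => by ring
  refine eq_zero_of_stdForm _ fun t => ?_
  simp only [map_sub, map_add, LinearMap.sub_apply, LinearMap.add_apply, hadj v, hadj u,
    stdForm_fibreProduct_zero]
  rw [← mul_sub, ← mul_add, ← mul_sub, ← Finset.sum_sub_distrib, ← Finset.sum_add_distrib,
    ← Finset.sum_sub_distrib]
  refine mul_eq_zero_of_right _ (Finset.sum_eq_zero fun α hα => ?_)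
  obtain ⟨i, j, -, rfl⟩ := mem_rootsA.mp hα
  simp only [lin_sub, lin_ε, bA_apply]
  ring

theorem commutator_A (hn : 1 ≤ n) {κ : (Fin (n + 1) → ℝ) → ℂ} (hκ : IsMultiplicity (rootsA n) κ)
    {α : Fin (n + 1) → ℝ} (hα : α ∈ rootsA n) (k' : ℂ) (x : Total (rootsA n))
    (hx : x ∈ complement (rootsA n)) (u v w : LieAlg (rootsA n)) :
    fibreProduct (rootsA n) κ (bA n k') x v (fibreProduct (rootsA n) κ (bA n k') x u w)
      - fibreProduct (rootsA n) κ (bA n k') x u (fibreProduct (rootsA n) κ (bA n k') x v w) =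
      (((n : ℂ) + 1) / 4 * (κ α ^ 2 - k' ^ 2)) •
        (stdForm (rootsA n) u w • v - stdForm (rootsA n) v w • u) := by
  have hR := isCrystallographic_A n
  have h0 := commutator_eq_of_sum (rootsA n) hR (κ := κ) (c := ((n : ℂ) + 1) / 4 * κ α ^ 2)
    (fun f hf => sum_coth_eq_of_pairSums hR (S := rootsA n) (T := ∅) (by simp) two_pos (k := κ α)
      (k' := 0) (fun β hβ => ⟨rootsA_dot hβ,
        hκ.eq_of_fourthMoment hR (Finset.Subset.refl _) (fun β hβ => rootsA_dot hβ) two_pos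
          (by positivity) hasFourthMoment_rootsA hβ hα⟩) (by simp)
      hasPairSum_rootsA (HasPairSum.empty_left _) (HasPairSum.empty_left _)
      (by push_cast; ring) hf) hx u v w
  have h1 := bA_commutator k' u v w
  have h2 := mixed_commutator_A κ k' x u v w
  have hsplit : ∀ y z, fibreProduct (rootsA n) κ (bA n k') x y z =
      fibreProduct (rootsA n) κ 0 x y z + bA n k' y z := fun y z => by simp [fibreProduct]
  have hadd : ∀ y z z', fibreProduct (rootsA n) κ 0 x y (z + z') =
      fibreProduct (rootsA n) κ 0 x y z + fibreProduct (rootsA n) κ 0 x y z' := fun y z z' => by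
    refine ext_stdForm _ fun t => ?_
    simp only [map_add, LinearMap.add_apply, stdForm_fibreProduct_zero, Submodule.coe_add]
    rw [← mul_add, ← Finset.sum_add_distrib]
    congr 1
    refine Finset.sum_congr rfl fun β _ => ?_
    rw [show lin β ((z : Fin (n + 1) → ℂ) + z') = lin β z + lin β z' from dotProduct_add _ _ _]
    ring
  simp only [hsplit, hadd, map_add]
  linear_combination (norm := module) h0 + h1 + h2

theorem stdForm_bA_comm (k' : ℂ) (u v w : LieAlg (rootsA n)) :
    stdForm (rootsA n) v (bA n k' u w) = stdForm (rootsA n) u (bA n k' v w) := by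
  rw [stdForm_symm _ v, stdForm_symm _ u, stdForm_bA, stdForm_bA]
  congr 1
  exact Finset.sum_congr rfl fun m _ => by ring

theorem sub_mem_rootsA {i j : Fin (n + 1)} (h : i ≠ j) : ε i - ε j ∈ rootsA n :=
  mem_rootsA.mpr ⟨i, j, h, rfl⟩

theorem isFlat_A (hn : 1 ≤ n) {κ : (Fin (n + 1) → ℝ) → ℂ} (hκ : IsMultiplicity (rootsA n) κ)
    {α : Fin (n + 1) → ℝ} (hα : α ∈ rootsA n) (k' : ℂ)
    {a : LieAlg (rootsA n) →ₗ[ℂ] LieAlg (rootsA n) →ₗ[ℂ] ℂ}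
    (h : a = (((n : ℂ) + 1) / 4 * (κ α ^ 2 - k' ^ 2)) • stdForm (rootsA n)) :
    IsFlat (rootsA n) κ a (bA n k') :=
  isFlat_of_eq_smul_stdForm (bA_symm k') (stdForm_bA_comm k') (commutator_A hn hκ hα k') h

/-- For `n = 1` the space `𝔥` is a line and the vector identity for `a` is empty; two independent
roots exist only from `n = 2` on. -/
theorem eq_smul_stdForm_of_isFlat_A (hn : 2 ≤ n) {κ : (Fin (n + 1) → ℝ) → ℂ}
    (hκ : IsMultiplicity (rootsA n) κ) {α : Fin (n + 1) → ℝ} (hα : α ∈ rootsA n) (k' : ℂ)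
    {a : LieAlg (rootsA n) →ₗ[ℂ] LieAlg (rootsA n) →ₗ[ℂ] ℂ} (ha : IsInvariantForm (rootsA n) a)
    (h : IsFlat (rootsA n) κ a (bA n k')) :
    a = (((n : ℂ) + 1) / 4 * (κ α ^ 2 - k' ^ 2)) • stdForm (rootsA n) := by
  refine eq_smul_stdForm_of_isFlat ha.1 (bA_symm k') (commutator_A (by omega) hκ hα k')
    (isCrystallographic_A n).ne_zero ?_ h
  have h01 : (⟨0, by omega⟩ : Fin (n + 1)) ≠ ⟨1, by omega⟩ := by simp
  have h12 : (⟨1, by omega⟩ : Fin (n + 1)) ≠ ⟨2, by omega⟩ := by simp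
  refine ⟨_, sub_mem_rootsA h01, _, sub_mem_rootsA h12, fun s t hst => ?_⟩
  have h0 := congrFun hst ⟨0, by omega⟩
  have h2 := congrFun hst ⟨2, by omega⟩
  simp [cplx, ε_apply] at h0 h2
  exact ⟨h0, h2⟩

end TypeA

end ToricConnection

end

noncomputable section

open scoped Classical

namespace ToricConnection

open Matrix

/-! ### Type G_2 -/

section TypeG

/-- The long roots `± (2 ε_i - ε_j - ε_k)` of `G_2`. -/
def longRootsG2 : Finset (Fin 3 → ℝ) :=
  (Finset.univ : Finset (Fin 3 × ℤˣ)).image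
    (fun p => ((p.2 : ℤ) : ℝ) • ((3 : ℝ) • ε p.1 - ∑ j, ε j))

theorem forall_fin_three {P : Fin 3 → Prop} : (∀ i, P i) ↔ P 0 ∧ P 1 ∧ P 2 :=
  ⟨fun h => ⟨h 0, h 1, h 2⟩, fun h i => by fin_cases i; exacts [h.1, h.2.1, h.2.2]⟩

theorem exists_fin_three {P : Fin 3 → Prop} : (∃ i, P i) ↔ P 0 ∨ P 1 ∨ P 2 := by
  rw [← not_iff_not]
  push Not
  exact forall_fin_three

theorem sum_ε_apply {n : ℕ} (m : Fin n) : (∑ j, ε j : Fin n → ℝ) m = 1 := by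
  simp [Finset.sum_apply, ε_apply]

theorem mem_longRootsG2' {x : Fin 3 → ℝ} : x ∈ longRootsG2 ↔
    ∃ (i : Fin 3) (s : ℤˣ), x = ((s : ℤ) : ℝ) • ((3 : ℝ) • ε i - ∑ j, ε j) := by
  simp only [longRootsG2, Finset.mem_image, Finset.mem_univ, true_and]
  constructor
  · rintro ⟨⟨i, s⟩, rfl⟩; exact ⟨i, s, rfl⟩
  · rintro ⟨i, s, rfl⟩; exact ⟨⟨i, s⟩, rfl⟩

theorem mem_longRootsG2 {x : Fin 3 → ℝ} : x ∈ longRootsG2 ↔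
    ∃ z : Fin 3 → ℤ, x = intVec z ∧ ∑ i, z i = 0 ∧ z ⬝ᵥ z = 6 := by
  rw [mem_longRootsG2']
  constructor
  · rintro ⟨i, s, rfl⟩
    refine ⟨fun m => (s : ℤ) * ((if m = i then 3 else 0) - 1), ?_, ?_, ?_⟩
    · ext m
      simp only [Pi.smul_apply, Pi.sub_apply, sum_ε_apply, ε_apply, intVec, smul_eq_mul]
      push_cast
      simp
    · rw [← Finset.mul_sum]
      fin_cases i <;> simp
    · rcases Int.units_eq_one_or s with h | h <;> subst h <;> fin_cases i <;>
        simp [dotProduct, Fin.sum_univ_three]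
  · rintro ⟨z, rfl, h0, h⟩
    simp only [dotProduct, Fin.sum_univ_three] at h0 h
    have e2 : z 2 = -z 0 - z 1 := by linarith
    have key : ∃ (i : Fin 3) (s : ℤˣ), ∀ m, z m = (s : ℤ) * ((if m = i then 3 else 0) - 1) := by
      have hs : ∀ P : ℤˣ → Prop, (∃ s, P s) ↔ P 1 ∨ P (-1) := fun P => by
        refine ⟨?_, fun h => h.elim (fun h => ⟨_, h⟩) (fun h => ⟨_, h⟩)⟩
        rintro ⟨s, h⟩
        rcases Int.units_eq_one_or s with rfl | rfl
        exacts [Or.inl h, Or.inr h]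
      rw [e2] at h
      -- With `z 2` eliminated, the length condition is `3 z_0² + (2 z_1 + z_0)² = 12`; it bounds
      -- the coordinates by `2`, and finitely many cases are left.
      have b0 : z 0 ≤ 2 := by nlinarith [sq_nonneg (2 * z 1 + z 0)]
      have b0' : -2 ≤ z 0 := by nlinarith [sq_nonneg (2 * z 1 + z 0)]
      have b1 : z 1 ≤ 2 := by nlinarith [sq_nonneg (2 * z 0 + z 1)]
      have b1' : -2 ≤ z 1 := by nlinarith [sq_nonneg (2 * z 0 + z 1)]
      simp only [hs, forall_fin_three, exists_fin_three, e2]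
      generalize z 0 = p at *
      generalize z 1 = q at *
      clear e2 h0 hs
      interval_cases p <;> interval_cases q <;> first | omega | simp
    obtain ⟨i, s, hz⟩ := key
    refine ⟨i, s, funext fun m => ?_⟩
    simp only [Pi.smul_apply, Pi.sub_apply, sum_ε_apply, ε_apply, intVec, smul_eq_mul, hz]
    push_cast
    simp

theorem sum_longRootsG2 (g : (Fin 3 → ℝ) → ℂ) :
    ∑ α ∈ longRootsG2, g α =
      ∑ i, (g ((3 : ℝ) • ε i - ∑ j, ε j) + g (-((3 : ℝ) • ε i - ∑ j, ε j))) := by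
  rw [longRootsG2, Finset.sum_image]
  · rw [Fintype.sum_prod_type]
    refine Finset.sum_congr rfl fun i _ => ?_
    rw [sum_units]
    simp
  · rintro ⟨i, s⟩ - ⟨i', s'⟩ - h
    have hi := congrFun h i
    simp only [Pi.smul_apply, Pi.sub_apply, sum_ε_apply, ε_apply, smul_eq_mul, if_true] at hi
    by_cases hii : i = i'
    · subst hii
      simp only [if_true] at hi
      have : ((s : ℤ) : ℝ) = ((s' : ℤ) : ℝ) := by linarith
      rw [Units.ext (by exact_mod_cast this : (s : ℤ) = s')]
    · rw [if_neg hii] at hi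
      rcases sign_cases s with h | h <;> rcases sign_cases s' with h' | h' <;>
        rw [h, h'] at hi <;> norm_num at hi

theorem rootsG2_eq : rootsG2 = rootsA 2 ∪ longRootsG2 := rfl

theorem longRootsG2_dot {x : Fin 3 → ℝ} (h : x ∈ longRootsG2) : x ⬝ᵥ x = 6 := by
  obtain ⟨z, rfl, -, hz⟩ := mem_longRootsG2.mp h
  rw [intVec_dot, hz]; norm_num

theorem mem_rootsG2_iff {x : Fin 3 → ℝ} :
    x ∈ rootsG2 ↔ x ∈ sumZeroLattice 3 ∧ (x ⬝ᵥ x = 2 ∨ x ⬝ᵥ x = 6) := by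
  rw [rootsG2_eq, Finset.mem_union, mem_rootsA_iff, mem_longRootsG2]
  constructor
  · rintro (⟨z, rfl, h0, h⟩ | ⟨z, rfl, h0, h⟩)
    · exact ⟨⟨z, rfl, h0⟩, Or.inl (by rw [intVec_dot, h]; norm_num)⟩
    · exact ⟨⟨z, rfl, h0⟩, Or.inr (by rw [intVec_dot, h]; norm_num)⟩
  · rintro ⟨⟨z, rfl, h0⟩, h⟩
    rw [intVec_dot] at h
    exact h.imp (fun h => ⟨z, rfl, h0, by exact_mod_cast h⟩)
      (fun h => ⟨z, rfl, h0, by exact_mod_cast h⟩)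

theorem exists_dot_eq_of_mem_rootsG2 {α β : Fin 3 → ℝ} (hα : α ∈ rootsG2) (hβ : β ∈ rootsG2) :
    ∃ m : ℤ, α ⬝ᵥ β = m := by
  obtain ⟨⟨z, rfl, -⟩, -⟩ := mem_rootsG2_iff.mp hα
  obtain ⟨⟨w, rfl, -⟩, -⟩ := mem_rootsG2_iff.mp hβ
  exact ⟨_, intVec_dot z w⟩

/-- A long root is `±3 ε_i` up to a multiple of the all-ones vector, which is orthogonal to every
root. -/
theorem exists_dot_eq_of_mem_longRootsG2 {α β : Fin 3 → ℝ} (hα : α ∈ rootsG2)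
    (hβ : β ∈ longRootsG2) : ∃ m : ℤ, α ⬝ᵥ β = 3 * m := by
  obtain ⟨⟨z, rfl, h0⟩, -⟩ := mem_rootsG2_iff.mp hα
  obtain ⟨i, s, rfl⟩ := mem_longRootsG2'.mp hβ
  refine ⟨s * z i, ?_⟩
  have h1 : intVec z ⬝ᵥ ∑ j, ε j = 0 := by
    rw [dotProduct]
    simp only [sum_ε_apply, mul_one, intVec]
    exact_mod_cast h0
  rw [dotProduct_smul, dotProduct_sub, dotProduct_smul, dot_ε, h1, intVec]
  push_cast
  simp only [smul_eq_mul]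
  ring

theorem isCrystallographic_G2 : IsCrystallographic rootsG2 := by
  refine IsCrystallographic.of_lattice (sumZeroLattice 3) (fun q => q = 2 ∨ q = 6)
    (fun x => mem_rootsG2_iff) (fun α hα β hβ => ?_) (by norm_num)
  rcases Finset.mem_union.mp hα with h | h
  · obtain ⟨m, hm⟩ := exists_dot_eq_of_mem_rootsG2 hβ hα
    exact ⟨m, by rw [hm, rootsA_dot h]; ring⟩
  · obtain ⟨m, hm⟩ := exists_dot_eq_of_mem_longRootsG2 hβ h
    exact ⟨m, by rw [hm, longRootsG2_dot h]; ring⟩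

theorem sum_eq_zero_of_mem_rootsG2 {α : Fin 3 → ℝ} (hα : α ∈ rootsG2) : ∑ i, α i = 0 := by
  obtain ⟨⟨z, rfl, h0⟩, -⟩ := mem_rootsG2_iff.mp hα
  simp only [intVec]
  exact_mod_cast h0

theorem sum_eq_zero_of_mem_lieAlg_G2 {u : Fin 3 → ℂ} (hu : u ∈ LieAlg rootsG2) :
    ∑ i, u i = 0 := by
  have := map_eq_zero_of_mem_lieAlg (φ := ∑ i, LinearMap.proj i) (fun α hα => ?_) hu
  · simpa using this
  · have := sum_eq_zero_of_mem_rootsG2 hα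
    simp only [LinearMap.sum_apply, LinearMap.proj_apply, cplx]
    exact_mod_cast this

theorem lin_longRootG2 (i : Fin 3) {u : Fin 3 → ℂ} (hu : ∑ i, u i = 0) :
    lin ((3 : ℝ) • ε i - ∑ j, ε j) u = 3 * u i := by
  have : lin (∑ j, ε j) u = ∑ i, u i := by
    simp only [lin, dotProduct, cplx, sum_ε_apply, Complex.ofReal_one, one_mul]
  rw [lin_sub, lin_smul, lin_ε, this, hu]
  push_cast
  ring

/-- Polarised form of `2 ∑ x_m⁴ = (∑ x_m²)²` for three numbers with sum zero. It makes the fourth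
moments of both root lengths isotropic. -/
theorem quartic_sum_three {x y z : Fin 3 → ℂ} (hx : ∑ i, x i = 0) (hy : ∑ i, y i = 0)
    (hz : ∑ i, z i = 0) :
    6 * ∑ m, x m ^ 2 * (y m * z m) = (x ⬝ᵥ x) * (y ⬝ᵥ z) + 2 * ((x ⬝ᵥ y) * (x ⬝ᵥ z)) := by
  simp only [dotProduct, Fin.sum_univ_three] at *
  have ex : x 2 = -x 0 - x 1 := by linear_combination hx
  have ey : y 2 = -y 0 - y 1 := by linear_combination hy
  have ez : z 2 = -z 0 - z 1 := by linear_combination hz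
  rw [ex, ey, ez]
  ring

theorem hasSecondMoment_shortRootsG2 : HasSecondMoment rootsG2 (rootsA 2) 6 := fun y hy z _ => by
  rw [second_moment_rootsA (sum_eq_zero_of_mem_lieAlg_G2 hy)]
  push_cast
  ring

theorem hasSecondMoment_longRootsG2 : HasSecondMoment rootsG2 longRootsG2 18 := fun y hy z hz => by
  rw [sum_longRootsG2]
  simp only [lin_neg, lin_longRootG2 _ (sum_eq_zero_of_mem_lieAlg_G2 hy),
    lin_longRootG2 _ (sum_eq_zero_of_mem_lieAlg_G2 hz)]
  rw [dotProduct, Finset.mul_sum]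
  refine Finset.sum_congr rfl fun i _ => ?_
  push_cast
  ring

theorem hasFourthMoment_shortRootsG2 : HasFourthMoment rootsG2 (rootsA 2) 3 0 :=
  fun α hα y hy z hz => by
  have hx := sum_eq_zero_of_mem_lieAlg_G2 (Submodule.subset_span ⟨α, hα, rfl⟩)
  have hy := sum_eq_zero_of_mem_lieAlg_G2 hy
  have hz := sum_eq_zero_of_mem_lieAlg_G2 hz
  have h := quartic_sum_three hx hy hz
  simp only [ofReal_dot_eq_lin]
  rw [fourth_moment_rootsA hx hy hz]
  simp only [lin]
  push_cast
  linear_combination h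

theorem hasFourthMoment_longRootsG2 : HasFourthMoment rootsG2 longRootsG2 27 0 :=
  fun α hα y hy z hz => by
  have hx := sum_eq_zero_of_mem_lieAlg_G2 (Submodule.subset_span ⟨α, hα, rfl⟩)
  have hy := sum_eq_zero_of_mem_lieAlg_G2 hy
  have hz := sum_eq_zero_of_mem_lieAlg_G2 hz
  have h := quartic_sum_three hx hy hz
  simp only [ofReal_dot_eq_lin]
  rw [sum_longRootsG2]
  simp only [lin_neg, lin_longRootG2 _ hx, lin_longRootG2 _ hy, lin_longRootG2 _ hz]
  simp only [lin]
  have e : ∀ i, (3 * cplx α i) ^ 2 * (3 * y i * (3 * z i)) +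
      (-(3 * cplx α i)) ^ 2 * (-(3 * y i) * -(3 * z i)) =
      162 * (cplx α i ^ 2 * (y i * z i)) := fun i => by ring
  simp only [e, ← Finset.mul_sum]
  push_cast
  linear_combination 27 * h

/-- Weights for the triples of roots of `G_2` with sum zero. -/
def weightG2 (k k' : ℂ) (α β : Fin 3 → ℝ) : ℂ :=
  if α ⬝ᵥ α = 2 ∧ β ⬝ᵥ β = 2 ∧ (α + β) ⬝ᵥ (α + β) = 2 then -(k ^ 2 + k * k') / 4
  else if α ⬝ᵥ α = 6 ∧ β ⬝ᵥ β = 6 ∧ (α + β) ⬝ᵥ (α + β) = 6 then -k' ^ 2 / 12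
  else -(k * k') / 4

theorem weightG2_rot (k k' : ℂ) (α β : Fin 3 → ℝ) :
    weightG2 k k' β (-(α + β)) = weightG2 k k' α β := by
  have e : β + -(α + β) = -α := by abel
  simp only [weightG2, e, neg_dotProduct, dotProduct_neg, neg_neg]
  congr 1
  · exact propext ⟨fun h => ⟨h.2.2, h.1, h.2.1⟩, fun h => ⟨h.2.1, h.2.2, h.1⟩⟩
  · congr 1
    exact propext ⟨fun h => ⟨h.2.2, h.1, h.2.1⟩, fun h => ⟨h.2.1, h.2.2, h.1⟩⟩

/-- The factor relating products of hyperbolic cotangents and inner products in `G_2`. -/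
def scaleG2 (a b : ℝ) : ℝ := if a = 2 ∧ b = 2 then 1 / 3 else if a = 6 ∧ b = 6 then 1 / 9 else 2 / 9

/-- For two short roots with `(α, β) = -1` both `α + β` (short) and `α - β` (long) are roots. The
summand `k k'` in the weight of short triples compensates the weight of the mixed triple that enters
through `α - β`. -/
theorem pairCoeff_eq_weightG2 {k k' : ℂ} {κ : (Fin 3 → ℝ) → ℂ} (hS : ∀ α ∈ rootsA 2, κ α = k)
    (hT : ∀ α ∈ longRootsG2, κ α = k') {α β : Fin 3 → ℝ} (hα : α ∈ rootsG2) (hβ : β ∈ rootsG2)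
    (h1 : α ≠ β) (h2 : α ≠ -β) :
    pairCoeff κ α β = (if α + β ∈ rootsG2 then weightG2 k k' α β else 0) -
      (if α - β ∈ rootsG2 then weightG2 k k' α (-β) else 0) := by
  have hsub := dot_self_pos (sub_ne_zero.mpr h1)
  have hadd := dot_self_pos (fun h => h2 (eq_neg_of_add_eq_zero_left h) : α + β ≠ 0)
  have ea := dot_add_self α β
  have es := dot_sub_self α β
  have ma : α + β ∈ rootsG2 ↔ (α + β) ⬝ᵥ (α + β) = 2 ∨ (α + β) ⬝ᵥ (α + β) = 6 := by
    rw [mem_rootsG2_iff, and_iff_right]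
    exact add_mem (mem_rootsG2_iff.mp hα).1 (mem_rootsG2_iff.mp hβ).1
  have ms : α - β ∈ rootsG2 ↔ (α - β) ⬝ᵥ (α - β) = 2 ∨ (α - β) ⬝ᵥ (α - β) = 6 := by
    rw [mem_rootsG2_iff, and_iff_right]
    exact sub_mem (mem_rootsG2_iff.mp hα).1 (mem_rootsG2_iff.mp hβ).1
  simp only [ma, ms, pairCoeff, weightG2, ← sub_eq_add_neg, neg_dotProduct, dotProduct_neg, neg_neg]
  rw [ea] at hadd ⊢
  rw [es] at hsub ⊢
  rcases Finset.mem_union.mp hα with hα' | hα' <;> rcases Finset.mem_union.mp hβ with hβ' | hβ'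
  · obtain ⟨m, hm⟩ := exists_dot_eq_of_mem_rootsG2 hα hβ
    rw [hS α hα', hS β hβ', rootsA_dot hα', rootsA_dot hβ', hm]
    rw [rootsA_dot hα', rootsA_dot hβ', hm] at hadd hsub
    have b1 : -2 < m := by exact_mod_cast (by linarith : (-2 : ℝ) < m)
    have b2 : m < 2 := by exact_mod_cast (by linarith : (m : ℝ) < 2)
    interval_cases m <;> norm_num <;> ring
  · obtain ⟨m, hm⟩ := exists_dot_eq_of_mem_longRootsG2 hα hβ'
    rw [hS α hα', hT β hβ', rootsA_dot hα', longRootsG2_dot hβ', hm]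
    rw [rootsA_dot hα', longRootsG2_dot hβ', hm] at hadd hsub
    have b1 : -2 < m := by exact_mod_cast (by linarith : (-2 : ℝ) < m)
    have b2 : m < 2 := by exact_mod_cast (by linarith : (m : ℝ) < 2)
    interval_cases m <;> norm_num <;> ring
  · obtain ⟨m, hm⟩ := exists_dot_eq_of_mem_longRootsG2 hβ hα'
    rw [dotProduct_comm] at hm
    rw [hT α hα', hS β hβ', longRootsG2_dot hα', rootsA_dot hβ', hm]
    rw [longRootsG2_dot hα', rootsA_dot hβ', hm] at hadd hsub
    have b1 : -2 < m := by exact_mod_cast (by linarith : (-2 : ℝ) < m)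
    have b2 : m < 2 := by exact_mod_cast (by linarith : (m : ℝ) < 2)
    interval_cases m <;> norm_num <;> ring
  · obtain ⟨m, hm⟩ := exists_dot_eq_of_mem_longRootsG2 hα hβ'
    rw [hT α hα', hT β hβ', longRootsG2_dot hα', longRootsG2_dot hβ', hm]
    rw [longRootsG2_dot hα', longRootsG2_dot hβ', hm] at hadd hsub
    have b1 : -2 < m := by exact_mod_cast (by linarith : (-2 : ℝ) < m)
    have b2 : m < 2 := by exact_mod_cast (by linarith : (m : ℝ) < 2)
    interval_cases m <;> norm_num <;> ring

/-- The inner products are three times `-1`, three times `-3`, or `1, -3, -3` for a long root with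
two short ones, whence `1/3`, `1/9` and `2/9`. The identity holds for all combinations of the two
lengths, so no case has to be excluded. -/
theorem scaleG2_triple {α β : Fin 3 → ℝ} (hα : α ∈ rootsG2) (hβ : β ∈ rootsG2)
    (hαβ : α + β ∈ rootsG2) {a b c : ℝ} (ha : α ⬝ᵥ α = a) (hb : β ⬝ᵥ β = b)
    (hc : (α + β) ⬝ᵥ (α + β) = c) :
    scaleG2 a b * (c - a - b) / 2 + scaleG2 b c * (a - b - c) / 2
      + scaleG2 c a * (b - a - c) / 2 = -1 := by
  subst ha hb hc
  have key : ∀ γ ∈ rootsG2, γ ⬝ᵥ γ = 2 ∨ γ ⬝ᵥ γ = 6 := fun γ hγ => (mem_rootsG2_iff.mp hγ).2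
  rcases key _ hα with hα' | hα' <;> rcases key _ hβ with hβ' | hβ' <;>
    rcases key _ hαβ with hs | hs
  all_goals rw [hα', hβ', hs]
  all_goals norm_num [scaleG2]

/-- The moments give the pair sums `36`, `324` and `2916` (short, mixed, long). The total is `6 k² +
24 k k' + 18 k'² = 6 (k + k') (k + 3 k')`, which is `8 c`. -/
theorem sum_coth_G2 {k k' : ℂ} {κ : (Fin 3 → ℝ) → ℂ} (hS : ∀ α ∈ rootsA 2, κ α = k)
    (hT : ∀ α ∈ longRootsG2, κ α = k') {f : (Fin 3 → ℝ) → ℂ} (hf : IsCoth rootsG2 f)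
    (u : Fin 3 → ℂ) (hu : u ∈ LieAlg rootsG2) (v : Fin 3 → ℂ) (hv : v ∈ LieAlg rootsG2)
    (w : Fin 3 → ℂ) (hw : w ∈ LieAlg rootsG2) (t : Fin 3 → ℂ) (ht : t ∈ LieAlg rootsG2) :
    ∑ α ∈ rootsG2, ∑ β ∈ rootsG2, pairCoeff κ α β * (f α * f β) * bivectorSquare u v w t α β =
      8 * (3 / 4 * (k + 3 * k') * (k + k')) *
        ((u ⬝ᵥ w) * (v ⬝ᵥ t) - (v ⬝ᵥ w) * (u ⬝ᵥ t)) := by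
  rw [sum_coth_eq isCrystallographic_G2 hf (pairCoeff κ) (weightG2 k k') scaleG2 u v w t
    (fun α hα β hβ h1 h2 => pairCoeff_eq_weightG2 hS hT hα hβ h1 h2) (weightG2_rot k k')
    (fun α hα β hβ h a b c ha hb hc => scaleG2_triple hα hβ h ha hb hc)]
  have hA : rootsA 2 ⊆ rootsG2 := Finset.subset_union_left
  have hL : longRootsG2 ⊆ rootsG2 := Finset.subset_union_right
  have hdisj : Disjoint (rootsA 2) longRootsG2 := Finset.disjoint_left.mpr fun α h1 h2 => by
    have := (rootsA_dot h1).symm.trans (longRootsG2_dot h2)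
    norm_num at this
  have pSS := hasPairSum_of_moments hA (fun α => rootsA_dot) hasSecondMoment_shortRootsG2
    hasFourthMoment_shortRootsG2 (e := 0) (f := 0) (fun m y _ z _ => by simp) u hu v hv w hw t ht
  have pTS := hasPairSum_of_moments hL (fun α => longRootsG2_dot) hasSecondMoment_longRootsG2
    hasFourthMoment_shortRootsG2 (e := 0) (f := 0) (fun m y _ z _ => by simp) u hu v hv w hw t ht
  have pTT := hasPairSum_of_moments hL (fun α => longRootsG2_dot) hasSecondMoment_longRootsG2
    hasFourthMoment_longRootsG2 (e := 0) (f := 0) (fun m y _ z _ => by simp) u hu v hv w hw t ht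
  set G : (Fin 3 → ℝ) → (Fin 3 → ℝ) → ℂ := fun α β => pairCoeff κ α β *
    ((scaleG2 (α ⬝ᵥ α) (β ⬝ᵥ β) * (α ⬝ᵥ β) : ℝ) : ℂ) * bivectorSquare u v w t α β with hG
  have gSS : ∑ α ∈ rootsA 2, ∑ β ∈ rootsA 2, G α β =
      k ^ 2 / 12 * pairSum (rootsA 2) (rootsA 2) u v w t := by
    simp only [pairSum, Finset.mul_sum]
    refine Finset.sum_congr rfl fun α hα => Finset.sum_congr rfl fun β hβ => ?_
    simp only [hG, pairCoeff, hS α hα, hS β hβ, rootsA_dot hα, rootsA_dot hβ, scaleG2, and_self,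
      if_true]
    push_cast
    ring
  have gTT : ∑ α ∈ longRootsG2, ∑ β ∈ longRootsG2, G α β =
      k' ^ 2 / 324 * pairSum longRootsG2 longRootsG2 u v w t := by
    simp only [pairSum, Finset.mul_sum]
    refine Finset.sum_congr rfl fun α hα => Finset.sum_congr rfl fun β hβ => ?_
    simp only [hG, pairCoeff, hT α hα, hT β hβ, longRootsG2_dot hα, longRootsG2_dot hβ, scaleG2]
    norm_num
    ring
  have gST : ∑ α ∈ rootsA 2, ∑ β ∈ longRootsG2, G α β =
      k * k' / 54 * pairSum (rootsA 2) longRootsG2 u v w t := by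
    simp only [pairSum, Finset.mul_sum]
    refine Finset.sum_congr rfl fun α hα => Finset.sum_congr rfl fun β hβ => ?_
    simp only [hG, pairCoeff, hS α hα, hT β hβ, rootsA_dot hα, longRootsG2_dot hβ, scaleG2]
    norm_num
    ring
  have gTS : ∑ α ∈ longRootsG2, ∑ β ∈ rootsA 2, G α β =
      k * k' / 54 * pairSum longRootsG2 (rootsA 2) u v w t := by
    simp only [pairSum, Finset.mul_sum]
    refine Finset.sum_congr rfl fun α hα => Finset.sum_congr rfl fun β hβ => ?_
    simp only [hG, pairCoeff, hT α hα, hS β hβ, longRootsG2_dot hα, rootsA_dot hβ, scaleG2]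
    norm_num
    ring
  rw [rootsG2_eq, Finset.sum_union hdisj]
  simp only [Finset.sum_union hdisj, Finset.sum_add_distrib]
  rw [gSS, gTT, gST, gTS, pairSum_comm (rootsA 2) longRootsG2, pSS, pTS, pTT]
  push_cast
  ring

/-- Each root is orthogonal to a root of the other length, and the two span the plane: `ε_i - ε_j`
and `3 ε_k - ∑ ε_l` for distinct `i, j, k`. -/
theorem rootsG2_complement (α : rootsG2) (v : LieAlg rootsG2) (hv : asForm rootsG2 α.1 v = 0)
    (hβ : ∀ β : rootsG2, α.1 ⬝ᵥ β.1 = 0 → asForm rootsG2 β.1 v = 0) : v = 0 := by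
  obtain ⟨α, hα⟩ := α
  have hβ' : ∀ β ∈ rootsG2, α ⬝ᵥ β = 0 → asForm _ β v = 0 := fun β hβR => hβ ⟨β, hβR⟩
  have h0 := sum_eq_zero_of_mem_lieAlg_G2 v.2
  have f1 : ∀ i j k : Fin 3, i ≠ j → k ≠ i → k ≠ j → (Finset.univ : Finset (Fin 3)) = {i, j, k} := by
    decide
  have f2 : ∀ i j k l : Fin 3, i ≠ j → k ≠ i → k ≠ j → l = i ∨ l = j ∨ l = k := by decide
  have f3 : ∀ i j : Fin 3, i ≠ j → ∃ k, k ≠ i ∧ k ≠ j := by decide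
  have f4 : ∀ k : Fin 3, ∃ i j, i ≠ j ∧ k ≠ i ∧ k ≠ j := by decide
  have key : ∀ i j k : Fin 3, i ≠ j → k ≠ i → k ≠ j → v.1 i = v.1 j → v.1 k = 0 → v = 0 := by
    intro i j k hij hki hkj e1 e2
    have hsum : v.1 i + v.1 j + v.1 k = ∑ l, v.1 l := by
      rw [show (Finset.univ : Finset (Fin 3)) = {i, j, k} from f1 i j k hij hki hkj,
        Finset.sum_insert (by simp [hij, hki.symm]), Finset.sum_pair hkj.symm, add_assoc]
    rw [h0, e2, ← e1] at hsum
    have hi : v.1 i = 0 := by linear_combination hsum / 2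
    refine Subtype.ext (funext fun l => ?_)
    have := f2 i j k l hij hki hkj
    rcases this with rfl | rfl | rfl
    · exact hi
    · exact e1.symm.trans hi
    · exact e2
  have hlong : ∀ i, (3 : ℝ) • ε i - ∑ j, ε j ∈ longRootsG2 := fun i =>
    mem_longRootsG2'.mpr ⟨i, 1, by simp⟩
  rcases Finset.mem_union.mp hα with h | h
  · obtain ⟨i, j, hij, rfl⟩ := mem_rootsA.mp h
    obtain ⟨k, hki, hkj⟩ : ∃ k, k ≠ i ∧ k ≠ j := f3 i j hij
    have := hβ' _ (Finset.mem_union_right _ (hlong k)) (by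
      rw [sub_dotProduct, ε_dot, ε_dot]
      simp [ε_apply, hki.symm, hkj.symm])
    rw [asForm_eq_lin, lin_longRootG2 _ h0] at this
    rw [asForm_eq_lin, lin_sub, lin_ε, lin_ε] at hv
    exact key i j k hij hki hkj (sub_eq_zero.mp hv) (by simpa using this)
  · obtain ⟨k, s, rfl⟩ := mem_longRootsG2'.mp h
    obtain ⟨i, j, hij, hki, hkj⟩ : ∃ i j, i ≠ j ∧ k ≠ i ∧ k ≠ j := f4 k
    have := hβ' _ (Finset.mem_union_left _ (sub_mem_rootsA hij)) (by
      rw [smul_dotProduct, dotProduct_sub, dot_ε, dot_ε]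
      simp [ε_apply, hki.symm, hkj.symm])
    rw [asForm_eq_lin, lin_sub, lin_ε, lin_ε] at this
    rw [asForm_eq_lin, lin_smul, lin_longRootG2 _ h0] at hv
    refine key i j k hij hki hkj (sub_eq_zero.mp this) ?_
    rcases sign_cases s with h | h <;> rw [h] at hv <;> simpa using hv

theorem isFlat_iff_G2 {κ : (Fin 3 → ℝ) → ℂ}
    {a : LieAlg rootsG2 →ₗ[ℂ] LieAlg rootsG2 →ₗ[ℂ] ℂ}
    {b : LieAlg rootsG2 →ₗ[ℂ] LieAlg rootsG2 →ₗ[ℂ] LieAlg rootsG2}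
    (hκ : IsMultiplicity rootsG2 κ) (ha : IsInvariantForm rootsG2 a)
    (hb : IsEquivariantMap rootsG2 b) {α β : Fin 3 → ℝ} (hα : α ∈ rootsA 2)
    (hβ : β ∈ longRootsG2) :
    IsFlat rootsG2 κ a b ↔
      a = (3 / 4 * (κ α + 3 * κ β) * (κ α + κ β)) • stdForm rootsG2 := by
  have hR := isCrystallographic_G2
  refine isFlat_iff_of_sum hR ha hb (fun f hf => sum_coth_G2
    (fun γ hγ => hκ.eq_of_fourthMoment hR Finset.subset_union_left (fun β hβ => rootsA_dot hβ)
      (by norm_num) le_rfl hasFourthMoment_shortRootsG2 hγ hα)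
    (fun γ hγ => hκ.eq_of_fourthMoment hR Finset.subset_union_right
      (fun β hβ => longRootsG2_dot hβ) (by norm_num) le_rfl hasFourthMoment_longRootsG2 hγ hβ) hf)
    rootsG2_complement
    ⟨_, Finset.mem_union_left _ (sub_mem_rootsA (show (0 : Fin 3) ≠ 1 by decide)), _,
      Finset.mem_union_left _ (sub_mem_rootsA (show (1 : Fin 3) ≠ 2 by decide)), fun s t hst => ?_⟩
  have h0 := congrFun hst 0
  have h2 := congrFun hst 2
  simp [cplx, ε_apply] at h0 h2
  exact ⟨h0, h2⟩

theorem shortRoot_mem_G2 : ![1, -1, 0] ∈ rootsA 2 := by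
  have h : (![1, -1, 0] : Fin 3 → ℝ) = ε 0 - ε 1 := by
    ext i; fin_cases i <;> simp [ε_apply]
  rw [h]
  exact sub_mem_rootsA (by decide)

theorem longRoot_mem_G2 : ![-2, 1, 1] ∈ longRootsG2 :=
  mem_longRootsG2.mpr ⟨![-2, 1, 1], by ext i; fin_cases i <;> simp [intVec],
    by simp [Fin.sum_univ_three], by simp [dotProduct, Fin.sum_univ_three]⟩

end TypeG

end ToricConnection

end

noncomputable section

open scoped Classical

namespace ToricConnection

open Matrix

/-! ### Splitting off the last coordinate -/

section Snoc

variable {n : ℕ}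

/-- Extend a vector by one coordinate. -/
abbrev extend {A : Type*} (x : Fin n → A) (r : A) : Fin (n + 1) → A := Fin.snoc (α := fun _ => A) x r

theorem lin_extend (x : Fin n → ℝ) (r : ℝ) (u : Fin (n + 1) → ℂ) :
    lin (extend x r) u = lin x (Fin.init u) + r * u (Fin.last n) := by
  simp [lin, dotProduct, Fin.sum_univ_castSucc, cplx, Fin.init]

theorem dot_init (u v : Fin (n + 1) → ℂ) :
    u ⬝ᵥ v = (Fin.init u : Fin n → ℂ) ⬝ᵥ Fin.init v + u (Fin.last n) * v (Fin.last n) := by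
  simp [dotProduct, Fin.sum_univ_castSucc, Fin.init]

theorem sum_signs_succ (F : (Fin (n + 1) → ℤˣ) → ℂ) :
    ∑ s, F s = ∑ s : Fin n → ℤˣ, (F (extend s 1) + F (extend s (-1))) := by
  rw [← (Fin.snocEquiv (fun _ : Fin (n + 1) => ℤˣ)).sum_comp, Fintype.sum_prod_type, sum_units,
    ← Finset.sum_add_distrib]
  rfl

/-- The sign vector `s` as a half-integral vector. -/
def halfVec (s : Fin n → ℤˣ) : Fin n → ℝ := fun i => ((s i : ℤ) : ℝ) / 2

theorem halfVec_extend (s : Fin n → ℤˣ) (r : ℤˣ) :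
    halfVec (extend s r) = extend (halfVec s) (((r : ℤ) : ℝ) / 2) := by
  ext i
  refine Fin.lastCases ?_ (fun i => ?_) i <;> simp [halfVec]

/-- The product of the entries of a sign vector. -/
def signProd (s : Fin n → ℤˣ) : ℂ := (((∏ i, s i : ℤˣ) : ℤ) : ℂ)

theorem signProd_extend (s : Fin n → ℤˣ) (r : ℤˣ) :
    signProd (extend s r) = signProd s * ((r : ℤ) : ℂ) := by
  simp [signProd, Fin.prod_univ_castSucc]

theorem ε_castSucc (i : Fin n) : ε (Fin.castSucc i) = extend (ε i) 0 := by
  ext j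
  refine Fin.lastCases ?_ (fun j => ?_) j
  · simp [ε_apply, Fin.ext_iff]
    exact fun h => absurd h (by have := i.isLt; omega)
  · simp [ε_apply]

theorem ε_last : ε (Fin.last n) = extend 0 1 := by
  ext j
  refine Fin.lastCases ?_ (fun j => ?_) j
  · simp [ε_apply]
  · simp [ε_apply, Fin.ext_iff]
    have := j.isLt
    omega

theorem extend_zero : extend (0 : Fin n → ℝ) 0 = 0 := by
  ext j
  refine Fin.lastCases ?_ (fun j => ?_) j <;> simp

theorem extend_add (x y : Fin n → ℝ) (r s : ℝ) :
    extend x r + extend y s = extend (x + y) (r + s) := by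
  ext j
  refine Fin.lastCases ?_ (fun j => ?_) j <;> simp

theorem extend_neg (x : Fin n → ℝ) (r : ℝ) : -extend x r = extend (-x) (-r) := by
  ext j
  refine Fin.lastCases ?_ (fun j => ?_) j <;> simp

theorem extend_sub (x y : Fin n → ℝ) (r s : ℝ) :
    extend x r - extend y s = extend (x - y) (r - s) := by
  rw [sub_eq_add_neg, extend_neg, extend_add, ← sub_eq_add_neg, ← sub_eq_add_neg]

theorem sum_unitRoots_succ (g : (Fin (n + 1) → ℝ) → ℂ) :
    ∑ α ∈ unitRoots (n + 1) 1, g α =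
      ∑ α ∈ unitRoots n 1, g (extend α 0) + (g (extend 0 1) + g (extend 0 (-1))) := by
  rw [sum_unitRoots one_ne_zero, sum_unitRoots one_ne_zero, Fin.sum_univ_castSucc]
  simp only [one_smul, ε_castSucc, ε_last, extend_neg, neg_zero]

/-- The last coordinate of a root is `0` or `±1`, and in the second case the rest is a unit vector
up to sign. -/
theorem sum_pmRoots_succ (g : (Fin (n + 1) → ℝ) → ℂ) :
    ∑ α ∈ pmRoots (n + 1), g α = ∑ α ∈ pmRoots n, g (extend α 0) +
      ∑ α ∈ unitRoots n 1, (g (extend α 1) + g (extend α (-1))) := by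
  refine mul_left_cancel₀ (two_ne_zero (α := ℂ)) ?_
  rw [mul_add, sum_pmRoots, sum_pmRoots, sum_unitRoots one_ne_zero, Fin.sum_univ_castSucc]
  simp only [Fin.sum_univ_castSucc, one_smul, ε_castSucc, ε_last, extend_neg, extend_add,
    extend_sub, neg_zero, add_zero, sub_zero, zero_add, zero_sub, ne_eq, Fin.castSucc_inj,
    Finset.sum_add_distrib]
  have h1 : ∀ i : Fin n, ¬ Fin.castSucc i = Fin.last n := fun i => (Fin.castSucc_lt_last i).ne
  have h2 : ∀ i : Fin n, ¬ Fin.last n = Fin.castSucc i := fun i => (Fin.castSucc_lt_last i).ne'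
  simp only [h1, h2, not_true_eq_false, not_false_eq_true, if_true, if_false,
    Finset.sum_add_distrib]
  ring

end Snoc

/-! ### Moments of sign vectors -/

section SpinSums

variable {n : ℕ}

/-- Twice the linear form of a half-integral vector. -/
def spin (s : Fin n → ℤˣ) (u : Fin n → ℂ) : ℂ := 2 * lin (halfVec s) u

theorem spin_extend (s : Fin n → ℤˣ) (r : ℤˣ) (u : Fin (n + 1) → ℂ) :
    spin (extend s r) u = spin s (Fin.init u) + ((r : ℤ) : ℂ) * u (Fin.last n) := by
  rw [spin, spin, halfVec_extend, lin_extend]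
  push_cast
  ring

theorem sum_one_signs : ∑ _s : Fin n → ℤˣ, (1 : ℂ) = 2 ^ n := by
  simp

theorem sum_spin_two (x y : Fin n → ℂ) :
    ∑ s, spin s x * spin s y = 2 ^ n * (x ⬝ᵥ y) := by
  induction n with
  | zero => simp [spin, lin]
  | succ n ih =>
    rw [sum_signs_succ]
    have e : ∀ s : Fin n → ℤˣ, spin (extend s 1) x * spin (extend s 1) y
        + spin (extend s (-1)) x * spin (extend s (-1)) y =
        2 * (spin s (Fin.init x) * spin s (Fin.init y))
          + 2 * (x (Fin.last n) * y (Fin.last n)) * 1 := fun s => by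
      simp only [spin_extend]
      push_cast
      ring
    simp only [e, Finset.sum_add_distrib]
    rw [← Finset.mul_sum, ← Finset.mul_sum, ih, sum_one_signs, dot_init x y]
    ring

/-- Only monomials even in each sign survive. The three pairings each contain the diagonal terms
once, although these occur only once in total; hence the correction by `-2`. -/
theorem sum_spin_four (x y z w : Fin n → ℂ) :
    ∑ s, spin s x * spin s y * (spin s z * spin s w) =
      2 ^ n * ((x ⬝ᵥ y) * (z ⬝ᵥ w) + (x ⬝ᵥ z) * (y ⬝ᵥ w) + (x ⬝ᵥ w) * (y ⬝ᵥ z)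
        - 2 * ∑ m, x m * y m * (z m * w m)) := by
  induction n with
  | zero => simp [spin, lin]
  | succ n ih =>
    rw [sum_signs_succ]
    set l := Fin.last n
    have e : ∀ s : Fin n → ℤˣ,
        spin (extend s 1) x * spin (extend s 1) y * (spin (extend s 1) z * spin (extend s 1) w)
        + spin (extend s (-1)) x * spin (extend s (-1)) y
          * (spin (extend s (-1)) z * spin (extend s (-1)) w) =
        2 * (spin s (Fin.init x) * spin s (Fin.init y)
          * (spin s (Fin.init z) * spin s (Fin.init w)))
        + 2 * (x l * y l) * (spin s (Fin.init z) * spin s (Fin.init w))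
        + 2 * (x l * z l) * (spin s (Fin.init y) * spin s (Fin.init w))
        + 2 * (x l * w l) * (spin s (Fin.init y) * spin s (Fin.init z))
        + 2 * (y l * z l) * (spin s (Fin.init x) * spin s (Fin.init w))
        + 2 * (y l * w l) * (spin s (Fin.init x) * spin s (Fin.init z))
        + 2 * (z l * w l) * (spin s (Fin.init x) * spin s (Fin.init y))
        + 2 * (x l * y l * z l * w l) * 1 := fun s => by
      simp only [spin_extend]
      push_cast
      ring
    simp only [e, Finset.sum_add_distrib]
    simp only [← Finset.mul_sum, ih, sum_one_signs, sum_spin_two]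
    simp only [dot_init (n := n), Fin.sum_univ_castSucc]
    simp only [Fin.init]
    ring

/-- Here and in the next four lemmas a product of fewer linear factors than coordinates is weighted
by the product of all signs. Every monomial misses some sign, which then occurs to the first power
and sums to zero. Summing over the last sign lowers the degree by one or three. -/
theorem sum_signProd : ∑ s : Fin (n + 1) → ℤˣ, signProd s = 0 := by
  rw [sum_signs_succ]
  refine Finset.sum_eq_zero fun s _ => ?_
  simp only [signProd_extend]
  push_cast
  ring

theorem sum_signProd_spin_one (x : Fin (n + 2) → ℂ) : ∑ s, signProd s * spin s x = 0 := by
  rw [sum_signs_succ]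
  have e : ∀ s : Fin (n + 1) → ℤˣ, signProd (extend s 1) * spin (extend s 1) x
      + signProd (extend s (-1)) * spin (extend s (-1)) x =
      2 * x (Fin.last _) * signProd s := fun s => by
    simp only [signProd_extend, spin_extend]
    push_cast
    ring
  simp only [e, ← Finset.mul_sum, sum_signProd, mul_zero]

theorem sum_signProd_spin_two (x y : Fin (n + 3) → ℂ) :
    ∑ s, signProd s * (spin s x * spin s y) = 0 := by
  rw [sum_signs_succ]
  have e : ∀ s : Fin (n + 2) → ℤˣ,
      signProd (extend s 1) * (spin (extend s 1) x * spin (extend s 1) y)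
      + signProd (extend s (-1)) * (spin (extend s (-1)) x * spin (extend s (-1)) y) =
      2 * x (Fin.last _) * (signProd s * spin s (Fin.init y))
      + 2 * y (Fin.last _) * (signProd s * spin s (Fin.init x)) := fun s => by
    simp only [signProd_extend, spin_extend]
    push_cast
    ring
  simp only [e, Finset.sum_add_distrib]
  simp only [← Finset.mul_sum, sum_signProd_spin_one, mul_zero, add_zero]

theorem sum_signProd_spin_three (x y z : Fin (n + 4) → ℂ) :
    ∑ s, signProd s * (spin s x * (spin s y * spin s z)) = 0 := by
  rw [sum_signs_succ]
  set l := Fin.last (n + 3)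
  have e : ∀ s : Fin (n + 3) → ℤˣ,
      signProd (extend s 1) * (spin (extend s 1) x * (spin (extend s 1) y * spin (extend s 1) z))
      + signProd (extend s (-1)) * (spin (extend s (-1)) x *
        (spin (extend s (-1)) y * spin (extend s (-1)) z)) =
      2 * x l * (signProd s * (spin s (Fin.init y) * spin s (Fin.init z)))
      + 2 * y l * (signProd s * (spin s (Fin.init x) * spin s (Fin.init z)))
      + 2 * z l * (signProd s * (spin s (Fin.init x) * spin s (Fin.init y)))
      + 2 * (x l * y l * z l) * signProd s := fun s => by
    simp only [signProd_extend, spin_extend]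
    push_cast
    ring
  simp only [e, Finset.sum_add_distrib]
  simp only [← Finset.mul_sum, sum_signProd_spin_two, sum_signProd, mul_zero, add_zero]

theorem sum_signProd_spin_four (x y z w : Fin (n + 5) → ℂ) :
    ∑ s, signProd s * (spin s x * spin s y * (spin s z * spin s w)) = 0 := by
  rw [sum_signs_succ]
  set l := Fin.last (n + 4)
  have e : ∀ s : Fin (n + 4) → ℤˣ,
      signProd (extend s 1) * (spin (extend s 1) x * spin (extend s 1) y *
        (spin (extend s 1) z * spin (extend s 1) w))
      + signProd (extend s (-1)) * (spin (extend s (-1)) x * spin (extend s (-1)) y *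
        (spin (extend s (-1)) z * spin (extend s (-1)) w)) =
      2 * x l * (signProd s * (spin s (Fin.init y) * (spin s (Fin.init z) * spin s (Fin.init w))))
      + 2 * y l * (signProd s * (spin s (Fin.init x) * (spin s (Fin.init z) * spin s (Fin.init w))))
      + 2 * z l * (signProd s * (spin s (Fin.init x) * (spin s (Fin.init y) * spin s (Fin.init w))))
      + 2 * w l * (signProd s * (spin s (Fin.init x) * (spin s (Fin.init y) * spin s (Fin.init z))))
      + 2 * (x l * y l * z l) * (signProd s * spin s (Fin.init w))
      + 2 * (x l * y l * w l) * (signProd s * spin s (Fin.init z))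
      + 2 * (x l * z l * w l) * (signProd s * spin s (Fin.init y))
      + 2 * (y l * z l * w l) * (signProd s * spin s (Fin.init x)) := fun s => by
    simp only [signProd_extend, spin_extend]
    push_cast
    ring
  simp only [e, Finset.sum_add_distrib]
  simp only [← Finset.mul_sum, sum_signProd_spin_three, sum_signProd_spin_one, mul_zero, add_zero]

end SpinSums

/-! ### Half-integral vectors -/

section HalfVectors

variable {n : ℕ}

theorem halfVec_injective : Function.Injective (halfVec (n := n)) := fun s s' h => by
  funext i
  have := congrFun h i
  simp only [halfVec] at this
  have : ((s i : ℤ) : ℝ) = ((s' i : ℤ) : ℝ) := by linarith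
  exact Units.ext (by exact_mod_cast this)

theorem mem_halfVectors {S : Finset (Fin n → ℤˣ)} {x : Fin n → ℝ} :
    x ∈ halfVectors n S ↔ ∃ s ∈ S, halfVec s = x := by
  rw [halfVectors, Finset.mem_image]
  rfl

theorem sum_halfVectors (S : Finset (Fin n → ℤˣ)) (g : (Fin n → ℝ) → ℂ) :
    ∑ α ∈ halfVectors n S, g α = ∑ s ∈ S, g (halfVec s) :=
  Finset.sum_image fun _ _ _ _ h => halfVec_injective h

theorem halfVec_ne_intVec (i : Fin n) (s : Fin n → ℤˣ) (z : Fin n → ℤ) : halfVec s ≠ intVec z := by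
  intro h
  have := congrFun h i
  simp only [halfVec, intVec] at this
  have h2 : ((s i : ℤ) : ℝ) = 2 * (z i : ℤ) := by linarith
  have h3 : (s i : ℤ) = 2 * z i := by exact_mod_cast h2
  rcases Int.units_eq_one_or (s i) with h | h <;> rw [h] at h3 <;> simp at h3 <;> omega

theorem halfVec_dot (s : Fin n → ℤˣ) : halfVec s ⬝ᵥ halfVec s = n / 4 := by
  have : ∀ i, halfVec s i * halfVec s i = 1 / 4 := fun i => by
    rw [halfVec]
    linear_combination sign_sq (s i) / 4
  simp only [dotProduct, this, Finset.sum_const, Finset.card_univ, Fintype.card_fin, nsmul_eq_mul]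
  ring

/-- A sum of `n` signs is congruent to `n - 1` plus their product modulo `4`. -/
theorem four_dvd_sum_signs (s : Fin n → ℤˣ) :
    (4 : ℤ) ∣ ∑ i, (s i : ℤ) - (n - 1 + (∏ i, s i : ℤˣ)) := by
  induction n with
  | zero => simp
  | succ n ih =>
    rw [Fin.sum_univ_castSucc, Fin.prod_univ_castSucc]
    have h := ih (fun i => s i.castSucc)
    rcases Int.units_eq_one_or (∏ i : Fin n, s i.castSucc) with h1 | h1 <;>
      rcases Int.units_eq_one_or (s (Fin.last n)) with h2 | h2 <;>
      rw [h1] at h ⊢ <;> rw [h2] <;> push_cast at h ⊢ <;> simp at h ⊢ <;> omega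

/-- An odd vector whose square is the number of its coordinates is a sign vector. -/
theorem exists_signs_of_odd {z : Fin n → ℤ} (hodd : ∀ i, Odd (z i)) (h : z ⬝ᵥ z = n) :
    ∃ s : Fin n → ℤˣ, ∀ i, z i = (s i : ℤ) := by
  have hge : ∀ i, 1 ≤ z i * z i := fun i => by
    obtain ⟨k, hk⟩ := hodd i
    have : 0 < z i * z i := mul_self_pos.mpr (by omega)
    omega
  have h1 : ∑ i, (z i * z i - 1) = 0 := by
    rw [Finset.sum_sub_distrib]
    simp only [Finset.sum_const, Finset.card_univ, Fintype.card_fin, nsmul_eq_mul, mul_one]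
    rw [dotProduct] at h
    rw [h, sub_self]
  rw [Finset.sum_eq_zero_iff_of_nonneg fun i _ => by have := hge i; omega] at h1
  choose s hs using fun i => exists_sign_of_sq (z := z i) (by have := h1 i (Finset.mem_univ i); omega)
  exact ⟨s, fun i => (hs i).symm⟩

end HalfVectors

end ToricConnection

end

noncomputable section

open scoped Classical

namespace ToricConnection

open Matrix

attribute [local irreducible] pmRoots halfVectors rootsE8 rootsE7 rootsE6 rootsF4

/-- Flatness for simply laced root systems with the moments of a sphere. -/
theorem isFlat_iff_of_moments {N : ℕ} {R : Finset (Fin N → ℝ)} (hR : IsCrystallographic R)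
    (hlen : ∀ α ∈ R, α ⬝ᵥ α = 2) {ν C : ℝ} (h2 : HasSecondMoment R R ν)
    (h4 : HasFourthMoment R R C 0) (hC : 0 < C) (hne : 2 * ν ≠ 4 * C)
    (hind : ∃ α ∈ R, ∃ β ∈ R, ∀ s t : ℂ, s • cplx α = t • cplx β → s = 0 ∧ t = 0)
    {κ : (Fin N → ℝ) → ℂ} {a : LieAlg R →ₗ[ℂ] LieAlg R →ₗ[ℂ] ℂ}
    {b : LieAlg R →ₗ[ℂ] LieAlg R →ₗ[ℂ] LieAlg R} (hκ : IsMultiplicity R κ)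
    (ha : IsInvariantForm R a) (hb : IsEquivariantMap R b) {α : Fin N → ℝ} (hα : α ∈ R) :
    IsFlat R κ a b ↔ a = (C * ν / 24 * κ α ^ 2) • stdForm R :=
  isFlat_iff_of_sum hR ha hb (fun f hf => sum_coth_eq_of_pairSums hR (S := R) (T := ∅) (by simp)
    two_pos (k := κ α) (k' := 0) (fun β hβ => ⟨hlen β hβ,
      hκ.eq_of_fourthMoment hR (Finset.Subset.refl _) hlen hC le_rfl h4 hβ hα⟩) (by simp)
    (hasPairSum_of_moments (Finset.Subset.refl _) hlen h2 h4 (e := 0) (f := 0)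
      (fun m y _ z _ => by simp))
    (HasPairSum.empty_left _) (HasPairSum.empty_left _) (by push_cast; ring) hf)
    (fun β v hv h => eq_zero_of_orthogonal_of_moments hR (Finset.Subset.refl _) two_pos hlen h2 h4
      hne β.2 hv fun γ hγ => h ⟨γ, hγ⟩) hind

theorem exists_independent_of_pm {N : ℕ} {R : Finset (Fin N → ℝ)} {i j : Fin N} (hij : i ≠ j)
    (h1 : ε i + ε j ∈ R) (h2 : ε i - ε j ∈ R) :
    ∃ α ∈ R, ∃ β ∈ R, ∀ s t : ℂ, s • cplx α = t • cplx β → s = 0 ∧ t = 0 := by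
  refine ⟨_, h1, _, h2, fun s t hst => ?_⟩
  have e1 := congrFun hst i
  have e2 := congrFun hst j
  simp [cplx, ε_apply, hij, hij.symm] at e1 e2
  subst e1
  have : s = 0 := by linear_combination e2 / 2
  exact ⟨this, this⟩

/-! ### The lattice of type E_8 and its sublattices -/

section LatticeE

/-- The lattice spanned by the roots of `E_8`. -/
def latticeE8 : AddSubgroup (Fin 8 → ℝ) where
  carrier := {x | ∃ (p : Fin 8 → ℤ) (e : ℤ), (∀ i, x i = p i + e / 2) ∧ 2 ∣ ∑ i, p i}
  zero_mem' := ⟨0, 0, by simp, by simp⟩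
  add_mem' := by
    rintro x y ⟨p, e, hx, hp⟩ ⟨q, f, hy, hq⟩
    refine ⟨p + q, e + f, fun i => ?_, ?_⟩
    · rw [Pi.add_apply, hx, hy, Pi.add_apply]
      push_cast
      ring
    · simp only [Pi.add_apply, Finset.sum_add_distrib]
      exact dvd_add hp hq
  neg_mem' := by
    rintro x ⟨p, e, hx, hp⟩
    refine ⟨-p, -e, fun i => ?_, ?_⟩
    · rw [Pi.neg_apply, hx, Pi.neg_apply]
      push_cast
      ring
    · simp only [Pi.neg_apply, Finset.sum_neg_distrib]
      exact hp.neg_right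

theorem dot_of_coordinates {n : ℕ} {x y : Fin n → ℝ} {p q : Fin n → ℤ} {e f : ℤ}
    (hx : ∀ i, x i = p i + e / 2) (hy : ∀ i, y i = q i + f / 2) :
    x ⬝ᵥ y = ((p ⬝ᵥ q : ℤ) : ℝ) + (f * ((∑ i, p i : ℤ) : ℝ) + e * ((∑ i, q i : ℤ) : ℝ)) / 2
      + n * (e * f) / 4 := by
  have : ∀ i, x i * y i = (p i * q i : ℝ) + f / 2 * p i + e / 2 * q i + e * f / 4 := fun i => by
    rw [hx, hy]
    ring
  simp only [dotProduct, this, Finset.sum_add_distrib, Finset.sum_const, Finset.card_univ,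
    Fintype.card_fin, nsmul_eq_mul, ← Finset.mul_sum]
  push_cast
  ring

theorem exists_dot_eq_of_mem_latticeE8 {x y : Fin 8 → ℝ} (hx : x ∈ latticeE8)
    (hy : y ∈ latticeE8) : ∃ m : ℤ, x ⬝ᵥ y = m := by
  obtain ⟨p, e, hx, a, ha⟩ := hx
  obtain ⟨q, f, hy, b, hb⟩ := hy
  refine ⟨p ⬝ᵥ q + f * a + e * b + 2 * (e * f), ?_⟩
  rw [dot_of_coordinates hx hy, ha, hb]
  push_cast
  ring

theorem two_dvd_sum_of_dot {n : ℕ} {z : Fin n → ℤ} (h : 2 ∣ z ⬝ᵥ z) : 2 ∣ ∑ i, z i := by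
  have h1 : (2 : ℤ) ∣ ∑ i, (z i * z i - z i) :=
    Finset.dvd_sum fun i _ => by
      rw [show z i * z i - z i = (z i - 1) * z i by ring]
      rcases Int.even_or_odd (z i) with he | ho
      · exact he.two_dvd.mul_left _
      · exact (ho.sub_odd odd_one).two_dvd.mul_right _
  rw [Finset.sum_sub_distrib] at h1
  have := (dvd_sub_right h).mp h1
  exact this

/-- The parity of `e` separates integral from half-integral vectors. For the latter, length two
forces all coordinates to be `±1/2`, and the parity of `∑ p_i` corresponds to the product of the
signs by `four_dvd_sum_signs`. -/
theorem mem_rootsE8_iff {x : Fin 8 → ℝ} : x ∈ rootsE8 ↔ x ∈ latticeE8 ∧ x ⬝ᵥ x = 2 := by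
  rw [rootsE8, Finset.mem_union, mem_pmRoots, mem_halfVectors]
  simp only [Finset.mem_filter, Finset.mem_univ, true_and]
  constructor
  · rintro (⟨z, rfl, h⟩ | ⟨s, hs, rfl⟩)
    · exact ⟨⟨z, 0, by simp [intVec], two_dvd_sum_of_dot (by rw [h])⟩,
        by rw [intVec_dot, h]; norm_num⟩
    · refine ⟨⟨fun i => ((s i : ℤ) - 1) / 2, 1, fun i => ?_, ?_⟩, by rw [halfVec_dot]; norm_num⟩
      · rcases Int.units_eq_one_or (s i) with h | h <;> simp [halfVec, h]
        norm_num
      · have h4 := four_dvd_sum_signs s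
        have h2 : ∑ i, (s i : ℤ) = 2 * ∑ i, ((s i : ℤ) - 1) / 2 + 8 := by
          rw [Finset.mul_sum, show (8 : ℤ) = ∑ _i : Fin 8, 1 by simp, ← Finset.sum_add_distrib]
          refine Finset.sum_congr rfl fun i _ => ?_
          rcases Int.units_eq_one_or (s i) with h | h <;> simp [h]
        rw [hs, h2] at h4
        show 2 ∣ ∑ i, ((s i : ℤ) - 1) / 2
        generalize ∑ i, ((s i : ℤ) - 1) / 2 = c at *
        simp at h4
        omega
  · rintro ⟨⟨p, e, hx, hp⟩, h⟩
    rcases Int.even_or_odd' e with ⟨f, rfl | rfl⟩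
    · left
      have hx' : x = intVec (fun i => p i + f) := by
        ext i
        rw [hx, intVec]
        push_cast
        ring
      refine ⟨_, hx', ?_⟩
      rw [hx', intVec_dot] at h
      exact_mod_cast h
    · right
      have hx' : ∀ i, x i = ((2 * p i + (2 * f + 1) : ℤ) : ℝ) / 2 := fun i => by
        rw [hx]
        push_cast
        ring
      obtain ⟨s, hs⟩ := exists_signs_of_odd (z := fun i => 2 * p i + (2 * f + 1))
        (fun i => ⟨p i + f, by ring⟩) (by
          have : ∀ i, x i * x i = ((2 * p i + (2 * f + 1) : ℤ) : ℝ) *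
              ((2 * p i + (2 * f + 1) : ℤ) : ℝ) / 4 := fun i => by rw [hx']; ring
          simp only [dotProduct, this, ← Finset.sum_div] at h
          have h' : ∑ i, ((2 * p i + (2 * f + 1) : ℤ) : ℝ) * ((2 * p i + (2 * f + 1) : ℤ) : ℝ) =
              ((8 : ℕ) : ℝ) := by push_cast at h ⊢; linarith
          rw [dotProduct]
          exact_mod_cast h')
      refine ⟨s, ?_, funext fun i => by rw [halfVec, hx', ← hs i]⟩
      have h4 := four_dvd_sum_signs s
      have h2 : ∑ i, (s i : ℤ) = 2 * ∑ i, p i + 8 * (2 * f + 1) := by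
        simp only [← hs, Finset.sum_add_distrib, ← Finset.mul_sum]
        simp
        ring
      rw [h2] at h4
      rcases Int.units_eq_one_or (∏ i, s i) with h | h
      · exact h
      · rw [h] at h4
        push_cast at h4
        omega

theorem isCrystallographic_of_mem_iff {R : Finset (Fin 8 → ℝ)} (Λ : AddSubgroup (Fin 8 → ℝ))
    (h : ∀ x, x ∈ R ↔ (x ∈ latticeE8 ∧ x ⬝ᵥ x = 2) ∧ x ∈ Λ) : IsCrystallographic R :=
  IsCrystallographic.of_lattice (latticeE8 ⊓ Λ) (fun q => q = 2) (fun x => by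
      rw [h, AddSubgroup.mem_inf]
      tauto)
    (fun α hα β hβ => by
      obtain ⟨m, hm⟩ := exists_dot_eq_of_mem_latticeE8 ((h β).mp hβ).1.1 ((h α).mp hα).1.1
      exact ⟨m, by rw [hm, ((h α).mp hα).1.2]; ring⟩) (by norm_num)

theorem isCrystallographic_E8 : IsCrystallographic rootsE8 :=
  isCrystallographic_of_mem_iff ⊤ (fun x => by
    rw [mem_rootsE8_iff, and_iff_left (AddSubgroup.mem_top x)])

theorem isCrystallographic_E7 : IsCrystallographic rootsE7 :=
  isCrystallographic_of_mem_iff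
    { carrier := {x | x 6 = -x 7}
      zero_mem' := by simp
      add_mem' := fun {x y} (hx : x 6 = -x 7) (hy : y 6 = -y 7) => by
        show x 6 + y 6 = -(x 7 + y 7)
        linarith
      neg_mem' := fun {x} (hx : x 6 = -x 7) => by
        show -x 6 = - -x 7
        rw [hx] }
    (fun x => by rw [rootsE7, Finset.mem_filter, mem_rootsE8_iff]; rfl)

theorem isCrystallographic_E6 : IsCrystallographic rootsE6 :=
  isCrystallographic_of_mem_iff
    { carrier := {x | x 5 = x 6 ∧ x 6 = -x 7}
      zero_mem' := by simp
      add_mem' := fun {x y} (hx : x 5 = x 6 ∧ x 6 = -x 7) (hy : y 5 = y 6 ∧ y 6 = -y 7) => by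
        show x 5 + y 5 = x 6 + y 6 ∧ x 6 + y 6 = -(x 7 + y 7)
        exact ⟨by linarith [hx.1, hy.1], by linarith [hx.2, hy.2]⟩
      neg_mem' := fun {x} (hx : x 5 = x 6 ∧ x 6 = -x 7) => by
        show -x 5 = -x 6 ∧ -x 6 = - -x 7
        exact ⟨by rw [hx.1], by rw [hx.2]⟩ }
    (fun x => by rw [rootsE6, Finset.mem_filter, mem_rootsE8_iff]; rfl)

end LatticeE

/-! ### Moments in types E_6, E_7 and E_8 -/

section MomentsE

/-- The factor `(1 + signProd s)/2` is the indicator of an even number of minus signs, which makes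
the sum accessible to the moments over all sign vectors. -/
theorem sum_rootsE8 (g : (Fin 8 → ℝ) → ℂ) : ∑ α ∈ rootsE8, g α =
    ∑ α ∈ pmRoots 8, g α + ∑ s, (1 + signProd s) / 2 * g (halfVec s) := by
  rw [rootsE8, Finset.sum_union, sum_halfVectors, Finset.sum_filter]
  · congr 1
    refine Finset.sum_congr rfl fun s _ => ?_
    by_cases h : ∏ i, s i = 1
    · rw [if_pos h, signProd, h]
      push_cast
      ring
    · rw [if_neg h, signProd, (Int.units_eq_one_or _).resolve_left h]
      push_cast
      ring
  · rw [Finset.disjoint_left]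
    intro x h1 h2
    rw [mem_pmRoots] at h1
    rw [mem_halfVectors] at h2
    obtain ⟨z, rfl, -⟩ := h1
    obtain ⟨s, -, hs⟩ := h2
    exact halfVec_ne_intVec 0 s z hs

theorem lin_halfVec {n : ℕ} (s : Fin n → ℤˣ) (u : Fin n → ℂ) : lin (halfVec s) u = spin s u / 2 := by
  rw [spin]
  ring

theorem second_moment_rootsE8 (y z : Fin 8 → ℂ) :
    ∑ α ∈ rootsE8, lin α y * lin α z = 60 * (y ⬝ᵥ z) := by
  rw [sum_rootsE8, second_moment_pmRoots]
  have e : ∀ s : Fin 8 → ℤˣ, (1 + signProd s) / 2 * (lin (halfVec s) y * lin (halfVec s) z) =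
      1 / 8 * (spin s y * spin s z) + 1 / 8 * (signProd s * (spin s y * spin s z)) := fun s => by
    rw [lin_halfVec, lin_halfVec]
    ring
  simp only [e, Finset.sum_add_distrib, ← Finset.mul_sum, sum_spin_two,
    sum_signProd_spin_two (n := 5)]
  push_cast
  ring

/-- The coordinate terms cancel: the integral roots contribute `4 (8 - 4) = 16`, the half-integral
ones `-2 · 2⁸/32 = -16`. The sums weighted by `signProd` vanish since the degree is less than eight.
-/
theorem fourth_moment_rootsE8 (x y z : Fin 8 → ℂ) :
    ∑ α ∈ rootsE8, lin α x ^ 2 * (lin α y * lin α z) =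
      12 * ((x ⬝ᵥ x) * (y ⬝ᵥ z) + 2 * ((x ⬝ᵥ y) * (x ⬝ᵥ z))) := by
  rw [sum_rootsE8, fourth_moment_pmRoots]
  have e : ∀ s : Fin 8 → ℤˣ, (1 + signProd s) / 2 *
      (lin (halfVec s) x ^ 2 * (lin (halfVec s) y * lin (halfVec s) z)) =
      1 / 32 * (spin s x * spin s x * (spin s y * spin s z))
        + 1 / 32 * (signProd s * (spin s x * spin s x * (spin s y * spin s z))) := fun s => by
    rw [lin_halfVec, lin_halfVec, lin_halfVec]
    ring
  simp only [e, Finset.sum_add_distrib, ← Finset.mul_sum, sum_spin_four,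
    sum_signProd_spin_four (n := 3)]
  simp only [← pow_two]
  push_cast
  ring

/-- The last two coordinates are `(0, 0)`, `±(1, -1)` or `±(½, -½)`. In the last case their signs
have product `-1`, so the first six must have an odd number of minus signs. -/
theorem sum_rootsE7 (g : (Fin 8 → ℝ) → ℂ) : ∑ α ∈ rootsE7, g α =
    ∑ α ∈ pmRoots 6, g (extend (extend α 0) 0)
      + (g (extend (extend 0 1) (-1)) + g (extend (extend 0 (-1)) 1))
      + ∑ s : Fin 6 → ℤˣ, (1 - signProd s) / 2 *
        (g (extend (extend (halfVec s) (1 / 2)) (-1 / 2))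
          + g (extend (extend (halfVec s) (-1 / 2)) (1 / 2))) := by
  have h6 : ∀ (x : Fin 6 → ℝ) (r t : ℝ), extend (extend x r) t 6 = r := fun x r t => by
    rw [show (6 : Fin 8) = Fin.castSucc (Fin.last 6) from rfl, extend, Fin.snoc_castSucc, extend,
      Fin.snoc_last]
  have h7 : ∀ (x : Fin 6 → ℝ) (r t : ℝ), extend (extend x r) t 7 = t := fun x r t => by
    rw [show (7 : Fin 8) = Fin.last 7 from rfl, extend, Fin.snoc_last]
  rw [rootsE7, Finset.sum_filter, sum_rootsE8, sum_pmRoots_succ (n := 7), sum_pmRoots_succ (n := 6),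
    sum_unitRoots_succ (n := 6), sum_signs_succ, sum_signs_succ]
  simp only [halfVec_extend, h6, h7, signProd_extend]
  norm_num
  refine Finset.sum_congr rfl fun s _ => ?_
  ring

/-- The last three coordinates are `(q, q, -q)`, and `q = ±1` is too long for a root. For `q = ½`
their signs have product `-1`, for `q = -½` product `1`, which fixes the parity of the first five.
-/
theorem sum_rootsE6 (g : (Fin 8 → ℝ) → ℂ) : ∑ α ∈ rootsE6, g α =
    ∑ α ∈ pmRoots 5, g (extend (extend (extend α 0) 0) 0)
      + ∑ s : Fin 5 → ℤˣ, ((1 - signProd s) / 2 *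
          g (extend (extend (extend (halfVec s) (1 / 2)) (1 / 2)) (-1 / 2))
        + (1 + signProd s) / 2 *
          g (extend (extend (extend (halfVec s) (-1 / 2)) (-1 / 2)) (1 / 2))) := by
  have h5 : ∀ (x : Fin 5 → ℝ) (q r t : ℝ), extend (extend (extend x q) r) t 5 = q :=
    fun x q r t => by
    rw [show (5 : Fin 8) = Fin.castSucc (Fin.castSucc (Fin.last 5)) from rfl, extend,
      Fin.snoc_castSucc, extend, Fin.snoc_castSucc, extend, Fin.snoc_last]
  have h6 : ∀ (x : Fin 6 → ℝ) (r t : ℝ), extend (extend x r) t 6 = r := fun x r t => by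
    rw [show (6 : Fin 8) = Fin.castSucc (Fin.last 6) from rfl, extend, Fin.snoc_castSucc, extend,
      Fin.snoc_last]
  have h7 : ∀ (x : Fin 7 → ℝ) (t : ℝ), extend x t 7 = t := fun x t => by
    rw [show (7 : Fin 8) = Fin.last 7 from rfl, extend, Fin.snoc_last]
  rw [rootsE6, Finset.sum_filter, sum_rootsE8, sum_pmRoots_succ (n := 7), sum_pmRoots_succ (n := 6),
    sum_pmRoots_succ (n := 5), sum_unitRoots_succ (n := 6), sum_unitRoots_succ (n := 5),
    sum_unitRoots_succ (n := 5), sum_signs_succ,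
    sum_signs_succ, sum_signs_succ]
  simp only [halfVec_extend, ← extend_zero (n := 5), h5, h6, h7, signProd_extend]
  norm_num
  refine Finset.sum_congr rfl fun s _ => ?_
  ring

theorem mem_rootsE7_iff {x : Fin 8 → ℝ} : x ∈ rootsE7 ↔ x ∈ rootsE8 ∧ x 6 = -x 7 := by
  rw [rootsE7, Finset.mem_filter]

theorem mem_rootsE6_iff {x : Fin 8 → ℝ} :
    x ∈ rootsE6 ↔ x ∈ rootsE8 ∧ x 5 = x 6 ∧ x 6 = -x 7 := by
  rw [rootsE6, Finset.mem_filter]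

/-- A coordinate as a linear form. -/
abbrev coord {n : ℕ} (i : Fin n) : (Fin n → ℂ) →ₗ[ℂ] ℂ := LinearMap.proj i

theorem apply_eq_of_mem_lieAlg_E7 {u : Fin 8 → ℂ} (hu : u ∈ LieAlg rootsE7) : u 7 = -u 6 := by
  have := map_eq_zero_of_mem_lieAlg (φ := coord 6 + coord 7) (fun α hα => ?_) hu
  · exact eq_neg_of_add_eq_zero_right (a := u 6) this
  · rw [mem_rootsE7_iff] at hα
    have h := hα.2
    simp [coord, cplx, h]

theorem apply_eq_of_mem_lieAlg_E6 {u : Fin 8 → ℂ} (hu : u ∈ LieAlg rootsE6) :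
    u 6 = u 5 ∧ u 7 = -u 5 := by
  constructor
  · have := map_eq_zero_of_mem_lieAlg (φ := coord 6 - coord 5)
      (fun α hα => ?_) hu
    · exact sub_eq_zero.mp (show u 6 - u 5 = 0 from this)
    · rw [mem_rootsE6_iff] at hα
      have h := hα.2
      simp [coord, cplx, h.1]
  · have := map_eq_zero_of_mem_lieAlg (φ := coord 5 + coord 7)
      (fun α hα => ?_) hu
    · exact eq_neg_of_add_eq_zero_right (a := u 5) this
    · rw [mem_rootsE6_iff] at hα
      have h := hα.2
      simp [coord, cplx, h.1, h.2]

theorem dot_of_E7 {u v : Fin 8 → ℂ} (hu : u 7 = -u 6) (hv : v 7 = -v 6) :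
    u ⬝ᵥ v = (Fin.init (Fin.init u : Fin 7 → ℂ) : Fin 6 → ℂ) ⬝ᵥ Fin.init (Fin.init v : Fin 7 → ℂ)
      + 2 * (u 6 * v 6) := by
  rw [dot_init, dot_init]
  change _ + u 6 * v 6 + u 7 * v 7 = _
  rw [hu, hv]
  ring

theorem dot_of_E6 {u v : Fin 8 → ℂ} (hu : u 6 = u 5 ∧ u 7 = -u 5) (hv : v 6 = v 5 ∧ v 7 = -v 5) :
    u ⬝ᵥ v = (Fin.init (Fin.init (Fin.init u : Fin 7 → ℂ) : Fin 6 → ℂ) : Fin 5 → ℂ) ⬝ᵥ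
      Fin.init (Fin.init (Fin.init v : Fin 7 → ℂ) : Fin 6 → ℂ) + 3 * (u 5 * v 5) := by
  rw [dot_init, dot_init, dot_init]
  change _ + u 5 * v 5 + u 6 * v 6 + u 7 * v 7 = _
  rw [hu.1, hu.2, hv.1, hv.2]
  ring

theorem lin_extend_two {u : Fin 8 → ℂ} (hu : u 7 = -u 6) (x : Fin 6 → ℝ) (r t : ℝ) :
    lin (extend (extend x r) t) u =
      lin x (Fin.init (Fin.init u : Fin 7 → ℂ)) + (r - t) * u 6 := by
  rw [lin_extend, lin_extend]
  change _ + _ * u 6 + _ * u 7 = _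
  rw [hu]
  ring

theorem lin_extend_three {u : Fin 8 → ℂ} (hu : u 6 = u 5 ∧ u 7 = -u 5) (x : Fin 5 → ℝ)
    (q r t : ℝ) : lin (extend (extend (extend x q) r) t) u =
      lin x (Fin.init (Fin.init (Fin.init u : Fin 7 → ℂ) : Fin 6 → ℂ)) + (q + r - t) * u 5 := by
  rw [lin_extend, lin_extend, lin_extend]
  change _ + _ * u 5 + _ * u 6 + _ * u 7 = _
  rw [hu.1, hu.2]
  ring

/-- The shifts `±η`, `±ζ` act as one further coordinate with its sign, so this is `sum_spin_two` in
dimension `n + 1`. -/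
theorem sum_extend_spin_two {n : ℕ} (y z : Fin n → ℂ) (η ζ : ℂ) :
    ∑ s : Fin n → ℤˣ, ((spin s y + η) * (spin s z + ζ) + (spin s y - η) * (spin s z - ζ)) =
      2 ^ (n + 1) * (y ⬝ᵥ z + η * ζ) := by
  have h := sum_spin_two (extend y η) (extend z ζ)
  rw [sum_signs_succ, dot_init] at h
  simp only [spin_extend, extend, Fin.init_snoc, Fin.snoc_last] at h
  rw [← h]
  refine Finset.sum_congr rfl fun s _ => ?_
  push_cast
  ring

theorem sum_extend_spin_four {n : ℕ} (x y z : Fin n → ℂ) (ξ η ζ : ℂ) :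
    ∑ s : Fin n → ℤˣ, ((spin s x + ξ) ^ 2 * ((spin s y + η) * (spin s z + ζ))
      + (spin s x - ξ) ^ 2 * ((spin s y - η) * (spin s z - ζ))) =
      2 ^ (n + 1) * ((x ⬝ᵥ x + ξ * ξ) * (y ⬝ᵥ z + η * ζ)
        + 2 * ((x ⬝ᵥ y + ξ * η) * (x ⬝ᵥ z + ξ * ζ))
        - 2 * (∑ m, x m ^ 2 * (y m * z m) + ξ ^ 2 * (η * ζ))) := by
  have h := sum_spin_four (extend x ξ) (extend x ξ) (extend y η) (extend z ζ)
  rw [sum_signs_succ] at h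
  simp only [dot_init (n := n), Fin.sum_univ_castSucc, spin_extend, extend, Fin.init_snoc,
    Fin.snoc_last, Fin.snoc_castSucc] at h
  simp only [← pow_two] at h
  have e : ∀ s : Fin n → ℤˣ, (spin s x + ξ) ^ 2 * ((spin s y + η) * (spin s z + ζ))
      + (spin s x - ξ) ^ 2 * ((spin s y - η) * (spin s z - ζ)) =
      (spin s x + ((1 : ℤˣ) : ℤ) * ξ) ^ 2 *
        ((spin s y + ((1 : ℤˣ) : ℤ) * η) * (spin s z + ((1 : ℤˣ) : ℤ) * ζ))
      + (spin s x + ((-1 : ℤˣ) : ℤ) * ξ) ^ 2 *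
        ((spin s y + ((-1 : ℤˣ) : ℤ) * η) * (spin s z + ((-1 : ℤˣ) : ℤ) * ζ)) := fun s => by
    push_cast
    ring
  simp only [e, h]
  ring

theorem second_moment_rootsE7 {y z : Fin 8 → ℂ} (hy : y 7 = -y 6) (hz : z 7 = -z 6) :
    ∑ α ∈ rootsE7, lin α y * lin α z = 36 * (y ⬝ᵥ z) := by
  rw [sum_rootsE7, dot_of_E7 hy hz]
  simp only [lin_extend_two hy, lin_extend_two hz]
  generalize (Fin.init (Fin.init y : Fin 7 → ℂ) : Fin 6 → ℂ) = y'
  generalize (Fin.init (Fin.init z : Fin 7 → ℂ) : Fin 6 → ℂ) = z'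
  have h1 := second_moment_pmRoots y' z'
  -- On `𝔥` the last two coordinates of a vector are `y 6, -y 6`. Paired with the entries `(½, -½)`
  -- they give `y 6`, that is `2 y 6` in the normalisation of `spin`.
  have h2 := sum_extend_spin_two y' z' (2 * y 6) (2 * z 6)
  have h3 := sum_signProd_spin_two (n := 3) y' z'
  have h4 := sum_signProd (n := 5)
  have e1 : ∀ α : Fin 6 → ℝ, (lin α y' + (((0 : ℝ) : ℂ) - ((0 : ℝ) : ℂ)) * y 6) *
      (lin α z' + (((0 : ℝ) : ℂ) - ((0 : ℝ) : ℂ)) * z 6) = lin α y' * lin α z' := fun α => by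
    push_cast
    ring
  have e2 : ∀ s : Fin 6 → ℤˣ, (1 - signProd s) / 2 *
      ((lin (halfVec s) y' + (((1 / 2 : ℝ) : ℂ) - ((-1 / 2 : ℝ) : ℂ)) * y 6) *
        (lin (halfVec s) z' + (((1 / 2 : ℝ) : ℂ) - ((-1 / 2 : ℝ) : ℂ)) * z 6)
      + (lin (halfVec s) y' + (((-1 / 2 : ℝ) : ℂ) - ((1 / 2 : ℝ) : ℂ)) * y 6) *
        (lin (halfVec s) z' + (((-1 / 2 : ℝ) : ℂ) - ((1 / 2 : ℝ) : ℂ)) * z 6)) =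
      1 / 8 * ((spin s y' + 2 * y 6) * (spin s z' + 2 * z 6)
        + (spin s y' - 2 * y 6) * (spin s z' - 2 * z 6))
      - 1 / 4 * (signProd s * (spin s y' * spin s z')) - y 6 * z 6 * signProd s := fun s => by
    rw [lin_halfVec, lin_halfVec]
    push_cast
    ring
  simp only [e1, e2, h1, Finset.sum_sub_distrib, ← Finset.mul_sum, h2, h3, h4, lin_zero]
  push_cast
  ring

theorem fourth_moment_rootsE7 {x y z : Fin 8 → ℂ} (hx : x 7 = -x 6) (hy : y 7 = -y 6)
    (hz : z 7 = -z 6) : ∑ α ∈ rootsE7, lin α x ^ 2 * (lin α y * lin α z) =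
      8 * ((x ⬝ᵥ x) * (y ⬝ᵥ z) + 2 * ((x ⬝ᵥ y) * (x ⬝ᵥ z))) := by
  rw [sum_rootsE7, dot_of_E7 hx hx, dot_of_E7 hx hy, dot_of_E7 hx hz, dot_of_E7 hy hz]
  simp only [lin_extend_two hx, lin_extend_two hy, lin_extend_two hz]
  generalize (Fin.init (Fin.init x : Fin 7 → ℂ) : Fin 6 → ℂ) = x'
  generalize (Fin.init (Fin.init y : Fin 7 → ℂ) : Fin 6 → ℂ) = y'
  generalize (Fin.init (Fin.init z : Fin 7 → ℂ) : Fin 6 → ℂ) = z'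
  have h1 := fourth_moment_pmRoots x' y' z'
  have h2 := sum_extend_spin_four x' y' z' (2 * x 6) (2 * y 6) (2 * z 6)
  have h3 := sum_signProd_spin_four (n := 1) x' x' y' z'
  have h4 := sum_signProd (n := 5)
  have h5 := fun a b : Fin 6 → ℂ => sum_signProd_spin_two (n := 3) a b
  have e1 : ∀ α : Fin 6 → ℝ, (lin α x' + (((0 : ℝ) : ℂ) - ((0 : ℝ) : ℂ)) * x 6) ^ 2 *
      ((lin α y' + (((0 : ℝ) : ℂ) - ((0 : ℝ) : ℂ)) * y 6) *
      (lin α z' + (((0 : ℝ) : ℂ) - ((0 : ℝ) : ℂ)) * z 6)) =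
      lin α x' ^ 2 * (lin α y' * lin α z') := fun α => by
    push_cast
    ring
  have e2 : ∀ s : Fin 6 → ℤˣ, (1 - signProd s) / 2 *
      ((lin (halfVec s) x' + (((1 / 2 : ℝ) : ℂ) - ((-1 / 2 : ℝ) : ℂ)) * x 6) ^ 2 *
        ((lin (halfVec s) y' + (((1 / 2 : ℝ) : ℂ) - ((-1 / 2 : ℝ) : ℂ)) * y 6) *
        (lin (halfVec s) z' + (((1 / 2 : ℝ) : ℂ) - ((-1 / 2 : ℝ) : ℂ)) * z 6))
      + (lin (halfVec s) x' + (((-1 / 2 : ℝ) : ℂ) - ((1 / 2 : ℝ) : ℂ)) * x 6) ^ 2 *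
        ((lin (halfVec s) y' + (((-1 / 2 : ℝ) : ℂ) - ((1 / 2 : ℝ) : ℂ)) * y 6) *
        (lin (halfVec s) z' + (((-1 / 2 : ℝ) : ℂ) - ((1 / 2 : ℝ) : ℂ)) * z 6))) =
      1 / 32 * ((spin s x' + 2 * x 6) ^ 2 * ((spin s y' + 2 * y 6) * (spin s z' + 2 * z 6))
        + (spin s x' - 2 * x 6) ^ 2 * ((spin s y' - 2 * y 6) * (spin s z' - 2 * z 6)))
      - 1 / 16 * (signProd s * (spin s x' * spin s x' * (spin s y' * spin s z')))
      - 1 / 4 * (x 6 * x 6) * (signProd s * (spin s y' * spin s z'))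
      - 1 / 2 * (x 6 * y 6) * (signProd s * (spin s x' * spin s z'))
      - 1 / 2 * (x 6 * z 6) * (signProd s * (spin s x' * spin s y'))
      - 1 / 4 * (y 6 * z 6) * (signProd s * (spin s x' * spin s x'))
      - x 6 * x 6 * y 6 * z 6 * signProd s := fun s => by
    rw [lin_halfVec, lin_halfVec, lin_halfVec]
    push_cast
    ring
  simp only [e1, e2, h1, Finset.sum_sub_distrib, ← Finset.mul_sum, h2, h3, h4, h5, lin_zero]
  push_cast
  ring

theorem second_moment_rootsE6 {y z : Fin 8 → ℂ} (hy : y 6 = y 5 ∧ y 7 = -y 5)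
    (hz : z 6 = z 5 ∧ z 7 = -z 5) :
    ∑ α ∈ rootsE6, lin α y * lin α z = 24 * (y ⬝ᵥ z) := by
  rw [sum_rootsE6, dot_of_E6 hy hz]
  simp only [lin_extend_three hy, lin_extend_three hz]
  generalize (Fin.init (Fin.init (Fin.init y : Fin 7 → ℂ) : Fin 6 → ℂ) : Fin 5 → ℂ) = y'
  generalize (Fin.init (Fin.init (Fin.init z : Fin 7 → ℂ) : Fin 6 → ℂ) : Fin 5 → ℂ) = z'
  have h1 := second_moment_pmRoots y' z'
  -- Three equal coordinates up to sign, each paired with `½`, contribute `3 y 5` in the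
  -- normalisation of `spin`.
  have h2 := sum_extend_spin_two y' z' (3 * y 5) (3 * z 5)
  have h3 := fun a : Fin 5 → ℂ => sum_signProd_spin_one (n := 3) a
  have e1 : ∀ α : Fin 5 → ℝ,
      (lin α y' + (((0 : ℝ) : ℂ) + ((0 : ℝ) : ℂ) - ((0 : ℝ) : ℂ)) * y 5) *
      (lin α z' + (((0 : ℝ) : ℂ) + ((0 : ℝ) : ℂ) - ((0 : ℝ) : ℂ)) * z 5) =
      lin α y' * lin α z' := fun α => by
    push_cast
    ring
  have e2 : ∀ s : Fin 5 → ℤˣ, (1 - signProd s) / 2 *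
      ((lin (halfVec s) y' + (((1 / 2 : ℝ) : ℂ) + ((1 / 2 : ℝ) : ℂ) - ((-1 / 2 : ℝ) : ℂ)) * y 5) *
        (lin (halfVec s) z' + (((1 / 2 : ℝ) : ℂ) + ((1 / 2 : ℝ) : ℂ) - ((-1 / 2 : ℝ) : ℂ)) * z 5))
      + (1 + signProd s) / 2 *
      ((lin (halfVec s) y' + (((-1 / 2 : ℝ) : ℂ) + ((-1 / 2 : ℝ) : ℂ) - ((1 / 2 : ℝ) : ℂ)) * y 5) *
        (lin (halfVec s) z' + (((-1 / 2 : ℝ) : ℂ) + ((-1 / 2 : ℝ) : ℂ) - ((1 / 2 : ℝ) : ℂ)) * z 5))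
      = 1 / 8 * ((spin s y' + 3 * y 5) * (spin s z' + 3 * z 5)
        + (spin s y' - 3 * y 5) * (spin s z' - 3 * z 5))
      - 3 / 4 * y 5 * (signProd s * spin s z') - 3 / 4 * z 5 * (signProd s * spin s y') :=
      fun s => by
    rw [lin_halfVec, lin_halfVec]
    push_cast
    ring
  simp only [e1, e2, h1, Finset.sum_sub_distrib, ← Finset.mul_sum, h2, h3]
  push_cast
  ring

theorem fourth_moment_rootsE6 {x y z : Fin 8 → ℂ} (hx : x 6 = x 5 ∧ x 7 = -x 5)
    (hy : y 6 = y 5 ∧ y 7 = -y 5) (hz : z 6 = z 5 ∧ z 7 = -z 5) :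
    ∑ α ∈ rootsE6, lin α x ^ 2 * (lin α y * lin α z) =
      6 * ((x ⬝ᵥ x) * (y ⬝ᵥ z) + 2 * ((x ⬝ᵥ y) * (x ⬝ᵥ z))) := by
  rw [sum_rootsE6, dot_of_E6 hx hx, dot_of_E6 hx hy, dot_of_E6 hx hz, dot_of_E6 hy hz]
  simp only [lin_extend_three hx, lin_extend_three hy, lin_extend_three hz]
  generalize (Fin.init (Fin.init (Fin.init x : Fin 7 → ℂ) : Fin 6 → ℂ) : Fin 5 → ℂ) = x'
  generalize (Fin.init (Fin.init (Fin.init y : Fin 7 → ℂ) : Fin 6 → ℂ) : Fin 5 → ℂ) = y'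
  generalize (Fin.init (Fin.init (Fin.init z : Fin 7 → ℂ) : Fin 6 → ℂ) : Fin 5 → ℂ) = z'
  have h1 := fourth_moment_pmRoots x' y' z'
  have h2 := sum_extend_spin_four x' y' z' (3 * x 5) (3 * y 5) (3 * z 5)
  have h3 := fun a : Fin 5 → ℂ => sum_signProd_spin_one (n := 3) a
  have h4 := fun a b c : Fin 5 → ℂ => sum_signProd_spin_three (n := 1) a b c
  have e1 : ∀ α : Fin 5 → ℝ,
      (lin α x' + (((0 : ℝ) : ℂ) + ((0 : ℝ) : ℂ) - ((0 : ℝ) : ℂ)) * x 5) ^ 2 *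
      ((lin α y' + (((0 : ℝ) : ℂ) + ((0 : ℝ) : ℂ) - ((0 : ℝ) : ℂ)) * y 5) *
      (lin α z' + (((0 : ℝ) : ℂ) + ((0 : ℝ) : ℂ) - ((0 : ℝ) : ℂ)) * z 5)) =
      lin α x' ^ 2 * (lin α y' * lin α z') := fun α => by
    push_cast
    ring
  have e2 : ∀ s : Fin 5 → ℤˣ, (1 - signProd s) / 2 *
      ((lin (halfVec s) x'
          + (((1 / 2 : ℝ) : ℂ) + ((1 / 2 : ℝ) : ℂ) - ((-1 / 2 : ℝ) : ℂ)) * x 5) ^ 2 *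
        ((lin (halfVec s) y'
          + (((1 / 2 : ℝ) : ℂ) + ((1 / 2 : ℝ) : ℂ) - ((-1 / 2 : ℝ) : ℂ)) * y 5) *
        (lin (halfVec s) z'
          + (((1 / 2 : ℝ) : ℂ) + ((1 / 2 : ℝ) : ℂ) - ((-1 / 2 : ℝ) : ℂ)) * z 5)))
      + (1 + signProd s) / 2 *
      ((lin (halfVec s) x'
          + (((-1 / 2 : ℝ) : ℂ) + ((-1 / 2 : ℝ) : ℂ) - ((1 / 2 : ℝ) : ℂ)) * x 5) ^ 2 *
        ((lin (halfVec s) y'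
          + (((-1 / 2 : ℝ) : ℂ) + ((-1 / 2 : ℝ) : ℂ) - ((1 / 2 : ℝ) : ℂ)) * y 5) *
        (lin (halfVec s) z'
          + (((-1 / 2 : ℝ) : ℂ) + ((-1 / 2 : ℝ) : ℂ) - ((1 / 2 : ℝ) : ℂ)) * z 5)))
      = 1 / 32 * ((spin s x' + 3 * x 5) ^ 2 * ((spin s y' + 3 * y 5) * (spin s z' + 3 * z 5))
        + (spin s x' - 3 * x 5) ^ 2 * ((spin s y' - 3 * y 5) * (spin s z' - 3 * z 5)))
      - 3 / 8 * x 5 * (signProd s * (spin s x' * (spin s y' * spin s z')))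
      - 3 / 16 * y 5 * (signProd s * (spin s x' * (spin s x' * spin s z')))
      - 3 / 16 * z 5 * (signProd s * (spin s x' * (spin s x' * spin s y')))
      - 27 / 16 * (x 5 * x 5 * y 5) * (signProd s * spin s z')
      - 27 / 16 * (x 5 * x 5 * z 5) * (signProd s * spin s y')
      - 27 / 8 * (x 5 * y 5 * z 5) * (signProd s * spin s x') := fun s => by
    rw [lin_halfVec, lin_halfVec, lin_halfVec]
    push_cast
    ring
  simp only [e1, e2, h1, Finset.sum_sub_distrib, ← Finset.mul_sum, h2, h3, h4]
  push_cast
  ring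

end MomentsE

end ToricConnection

end

noncomputable section

open scoped Classical

namespace ToricConnection

open Matrix

attribute [local irreducible] pmRoots halfVectors rootsE8 rootsE7 rootsE6 rootsF4

/-! ### Types E_6, E_7 and E_8 -/

section TypeE

theorem HasSecondMoment.of_lin {N : ℕ} {R A : Finset (Fin N → ℝ)} {ν : ℝ}
    (h : ∀ y ∈ LieAlg R, ∀ z ∈ LieAlg R, ∑ α ∈ A, lin α y * lin α z = (ν : ℂ) * (y ⬝ᵥ z)) :
    HasSecondMoment R A ν := h

theorem HasFourthMoment.of_lin {N : ℕ} {R B : Finset (Fin N → ℝ)} {C : ℝ}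
    (h : ∀ x ∈ LieAlg R, ∀ y ∈ LieAlg R, ∀ z ∈ LieAlg R, ∑ β ∈ B, lin β x ^ 2 * (lin β y * lin β z) =
      (C : ℂ) * ((x ⬝ᵥ x) * (y ⬝ᵥ z) + 2 * ((x ⬝ᵥ y) * (x ⬝ᵥ z)))) :
    HasFourthMoment R B C 0 := fun α hα y hy z hz => by
  simp only [ofReal_dot_eq_lin]
  rw [h _ (Submodule.subset_span ⟨α, hα, rfl⟩) y hy z hz]
  simp [lin]

theorem rootsE8_dot {α : Fin 8 → ℝ} (h : α ∈ rootsE8) : α ⬝ᵥ α = 2 := (mem_rootsE8_iff.mp h).2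

theorem pmRoots_subset_rootsE8 {α : Fin 8 → ℝ} (h : α ∈ pmRoots 8) : α ∈ rootsE8 := by
  rw [rootsE8, Finset.mem_union]
  exact Or.inl h

/-- The simple root `½ (ε_1 - ε_2 - ε_3 - ε_4 - ε_5 - ε_6 - ε_7 + ε_8)`. -/
theorem spinRoot_mem_rootsE8 :
    ![1 / 2, -1 / 2, -1 / 2, -1 / 2, -1 / 2, -1 / 2, -1 / 2, 1 / 2] ∈ rootsE8 := by
  rw [mem_rootsE8_iff]
  refine ⟨⟨![0, -1, -1, -1, -1, -1, -1, 0], 1, fun i => ?_, ?_⟩, ?_⟩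
  · fin_cases i <;> norm_num
  · simp [Fin.sum_univ_eight]
  · simp [dotProduct, Fin.sum_univ_eight]
    norm_num

theorem spinRoot_mem_rootsE7 :
    ![1 / 2, -1 / 2, -1 / 2, -1 / 2, -1 / 2, -1 / 2, -1 / 2, 1 / 2] ∈ rootsE7 := by
  rw [mem_rootsE7_iff]
  exact ⟨spinRoot_mem_rootsE8, show (-1 / 2 : ℝ) = -(1 / 2) by norm_num⟩

theorem spinRoot_mem_rootsE6 :
    ![1 / 2, -1 / 2, -1 / 2, -1 / 2, -1 / 2, -1 / 2, -1 / 2, 1 / 2] ∈ rootsE6 := by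
  rw [mem_rootsE6_iff]
  exact ⟨spinRoot_mem_rootsE8, show (-1 / 2 : ℝ) = -1 / 2 from rfl,
    show (-1 / 2 : ℝ) = -(1 / 2) by norm_num⟩

theorem isFlat_iff_E8 {κ : (Fin 8 → ℝ) → ℂ} {a : LieAlg rootsE8 →ₗ[ℂ] LieAlg rootsE8 →ₗ[ℂ] ℂ}
    {b : LieAlg rootsE8 →ₗ[ℂ] LieAlg rootsE8 →ₗ[ℂ] LieAlg rootsE8} (hκ : IsMultiplicity rootsE8 κ)
    (ha : IsInvariantForm rootsE8 a) (hb : IsEquivariantMap rootsE8 b) {k : ℂ}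
    (hk : k = κ ![1 / 2, -1 / 2, -1 / 2, -1 / 2, -1 / 2, -1 / 2, -1 / 2, 1 / 2]) :
    IsFlat rootsE8 κ a b ↔ a = (30 * k ^ 2) • stdForm rootsE8 := by
  have h01 : (0 : Fin 8) ≠ 1 := by decide
  have := isFlat_iff_of_moments isCrystallographic_E8 (fun β hβ => rootsE8_dot hβ)
    (HasSecondMoment.of_lin (ν := 60) fun y _ z _ => by
      rw [second_moment_rootsE8]; push_cast; ring)
    (HasFourthMoment.of_lin (C := 12) fun x _ y _ z _ => by
      rw [fourth_moment_rootsE8]; push_cast; ring) (by norm_num) (by norm_num)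
    (exists_independent_of_pm h01 (pmRoots_subset_rootsE8 (add_mem_pmRoots h01))
      (pmRoots_subset_rootsE8 (sub_mem_pmRoots h01))) hκ ha hb spinRoot_mem_rootsE8
  rw [hk, this]
  norm_num

theorem isFlat_iff_E7 {κ : (Fin 8 → ℝ) → ℂ} {a : LieAlg rootsE7 →ₗ[ℂ] LieAlg rootsE7 →ₗ[ℂ] ℂ}
    {b : LieAlg rootsE7 →ₗ[ℂ] LieAlg rootsE7 →ₗ[ℂ] LieAlg rootsE7} (hκ : IsMultiplicity rootsE7 κ)
    (ha : IsInvariantForm rootsE7 a) (hb : IsEquivariantMap rootsE7 b) {k : ℂ}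
    (hk : k = κ ![1 / 2, -1 / 2, -1 / 2, -1 / 2, -1 / 2, -1 / 2, -1 / 2, 1 / 2]) :
    IsFlat rootsE7 κ a b ↔ a = (12 * k ^ 2) • stdForm rootsE7 := by
  have h01 : (0 : Fin 8) ≠ 1 := by decide
  have := isFlat_iff_of_moments isCrystallographic_E7
    (fun β hβ => rootsE8_dot (mem_rootsE7_iff.mp hβ).1)
    (HasSecondMoment.of_lin (ν := 36) fun y hy z hz => by
      rw [second_moment_rootsE7 (apply_eq_of_mem_lieAlg_E7 hy) (apply_eq_of_mem_lieAlg_E7 hz)]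
      push_cast; ring)
    (HasFourthMoment.of_lin (C := 8) fun x hx y hy z hz => by
      rw [fourth_moment_rootsE7 (apply_eq_of_mem_lieAlg_E7 hx) (apply_eq_of_mem_lieAlg_E7 hy)
        (apply_eq_of_mem_lieAlg_E7 hz)]
      push_cast; ring) (by norm_num) (by norm_num)
    (exists_independent_of_pm h01
      (mem_rootsE7_iff.mpr ⟨pmRoots_subset_rootsE8 (add_mem_pmRoots h01), by simp [ε_apply]⟩)
      (mem_rootsE7_iff.mpr ⟨pmRoots_subset_rootsE8 (sub_mem_pmRoots h01), by simp [ε_apply]⟩))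
    hκ ha hb spinRoot_mem_rootsE7
  rw [hk, this]
  norm_num

theorem isFlat_iff_E6 {κ : (Fin 8 → ℝ) → ℂ} {a : LieAlg rootsE6 →ₗ[ℂ] LieAlg rootsE6 →ₗ[ℂ] ℂ}
    {b : LieAlg rootsE6 →ₗ[ℂ] LieAlg rootsE6 →ₗ[ℂ] LieAlg rootsE6} (hκ : IsMultiplicity rootsE6 κ)
    (ha : IsInvariantForm rootsE6 a) (hb : IsEquivariantMap rootsE6 b) {k : ℂ}
    (hk : k = κ ![1 / 2, -1 / 2, -1 / 2, -1 / 2, -1 / 2, -1 / 2, -1 / 2, 1 / 2]) :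
    IsFlat rootsE6 κ a b ↔ a = (6 * k ^ 2) • stdForm rootsE6 := by
  have h01 : (0 : Fin 8) ≠ 1 := by decide
  have := isFlat_iff_of_moments isCrystallographic_E6
    (fun β hβ => rootsE8_dot (mem_rootsE6_iff.mp hβ).1)
    (HasSecondMoment.of_lin (ν := 24) fun y hy z hz => by
      rw [second_moment_rootsE6 (apply_eq_of_mem_lieAlg_E6 hy) (apply_eq_of_mem_lieAlg_E6 hz)]
      push_cast; ring)
    (HasFourthMoment.of_lin (C := 6) fun x hx y hy z hz => by
      rw [fourth_moment_rootsE6 (apply_eq_of_mem_lieAlg_E6 hx) (apply_eq_of_mem_lieAlg_E6 hy)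
        (apply_eq_of_mem_lieAlg_E6 hz)]
      push_cast; ring) (by norm_num) (by norm_num)
    (exists_independent_of_pm h01
      (mem_rootsE6_iff.mpr ⟨pmRoots_subset_rootsE8 (add_mem_pmRoots h01), by simp [ε_apply]⟩)
      (mem_rootsE6_iff.mpr ⟨pmRoots_subset_rootsE8 (sub_mem_pmRoots h01), by simp [ε_apply]⟩))
    hκ ha hb spinRoot_mem_rootsE6
  rw [hk, this]
  norm_num

end TypeE

/-! ### Type F_4 -/

section TypeF

/-- The short roots of `F_4`. -/
def shortRootsF4 : Finset (Fin 4 → ℝ) := unitRoots 4 1 ∪ halfVectors 4 Finset.univ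

theorem rootsF4_eq : rootsF4 = shortRootsF4 ∪ pmRoots 4 := by
  rw [rootsF4, rootsB_eq, shortRootsF4, Finset.union_assoc, Finset.union_comm]

/-- The lattice spanned by the roots of `F_4`. -/
def latticeF4 : AddSubgroup (Fin 4 → ℝ) where
  carrier := {x | ∃ (p : Fin 4 → ℤ) (e : ℤ), ∀ i, x i = p i + e / 2}
  zero_mem' := ⟨0, 0, by simp⟩
  add_mem' := by
    rintro x y ⟨p, e, hx⟩ ⟨q, f, hy⟩
    refine ⟨p + q, e + f, fun i => ?_⟩
    rw [Pi.add_apply, hx, hy, Pi.add_apply]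
    push_cast
    ring
  neg_mem' := by
    rintro x ⟨p, e, hx⟩
    refine ⟨-p, -e, fun i => ?_⟩
    rw [Pi.neg_apply, hx, Pi.neg_apply]
    push_cast
    ring

theorem shortRootsF4_dot {x : Fin 4 → ℝ} (h : x ∈ shortRootsF4) : x ⬝ᵥ x = 1 := by
  rcases Finset.mem_union.mp h with h | h
  · rw [unitRoots_dot h]; norm_num
  · rw [mem_halfVectors] at h
    obtain ⟨s, -, rfl⟩ := h
    rw [halfVec_dot]; norm_num

theorem mem_latticeF4_of_int {z : Fin 4 → ℤ} : intVec z ∈ latticeF4 := ⟨z, 0, by simp [intVec]⟩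

/-- The point is that a half-integral vector never has squared length `2`: a sum of four odd squares
is `4` modulo `8`, hence never `8`. -/
theorem mem_rootsF4_iff {x : Fin 4 → ℝ} :
    x ∈ rootsF4 ↔ x ∈ latticeF4 ∧ (x ⬝ᵥ x = 1 ∨ x ⬝ᵥ x = 2) := by
  rw [rootsF4_eq, Finset.mem_union]
  constructor
  · rintro (h | h)
    · refine ⟨?_, Or.inl (shortRootsF4_dot h)⟩
      rcases Finset.mem_union.mp h with h | h
      · obtain ⟨z, rfl, -⟩ := mem_unitRoots.mp h
        rw [one_smul]
        exact mem_latticeF4_of_int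
      · rw [mem_halfVectors] at h
        obtain ⟨s, -, rfl⟩ := h
        refine ⟨fun i => ((s i : ℤ) - 1) / 2, 1, fun i => ?_⟩
        rcases Int.units_eq_one_or (s i) with h | h <;> simp [halfVec, h]
        norm_num
    · refine ⟨?_, Or.inr (pmRoots_dot h)⟩
      obtain ⟨z, rfl, -⟩ := mem_pmRoots.mp h
      exact mem_latticeF4_of_int
  · rintro ⟨⟨p, e, hx⟩, h⟩
    rcases Int.even_or_odd' e with ⟨f, rfl | rfl⟩
    · have hx' : x = intVec (fun i => p i + f) := by
        ext i
        rw [hx, intVec]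
        push_cast
        ring
      generalize (fun i => p i + f) = z at hx'
      subst hx'
      rw [intVec_dot] at h
      refine h.imp (fun h => ?_) (fun h => ?_)
      · exact Finset.mem_union_left _ (mem_unitRoots.mpr ⟨z, by rw [one_smul], by exact_mod_cast h⟩)
      · exact mem_pmRoots.mpr ⟨z, rfl, by exact_mod_cast h⟩
    · left
      have hx' : ∀ i, x i = ((2 * p i + (2 * f + 1) : ℤ) : ℝ) / 2 := fun i => by
        rw [hx]
        push_cast
        ring
      have hodd : ∀ i, Odd (2 * p i + (2 * f + 1)) := fun i => ⟨p i + f, by ring⟩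
      generalize hz : (fun i => 2 * p i + (2 * f + 1)) = z
      have hx'' : ∀ i, x i = (z i : ℝ) / 2 := fun i => by rw [hx', ← hz]
      have hodd' : ∀ i, Odd (z i) := fun i => by rw [← hz]; exact hodd i
      have hdot : x ⬝ᵥ x = ((z ⬝ᵥ z : ℤ) : ℝ) / 4 := by
        simp only [dotProduct, hx'', Int.cast_sum, Finset.sum_div]
        refine Finset.sum_congr rfl fun i _ => ?_
        push_cast
        ring
      have h4 : z ⬝ᵥ z = (4 : ℕ) := by
        have h8 : (8 : ℤ) ∣ z ⬝ᵥ z - 4 := by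
          have : z ⬝ᵥ z - 4 = ∑ i, (z i * z i - 1) := by
            simp [dotProduct, Finset.sum_sub_distrib]
          rw [this]
          refine Finset.dvd_sum fun i _ => ?_
          rw [← pow_two]
          exact Int.eight_dvd_sq_sub_one_of_odd (hodd' i)
        rcases h with h | h <;> rw [hdot] at h
        · have : ((z ⬝ᵥ z : ℤ) : ℝ) = 4 := by linarith
          exact_mod_cast this
        · have : ((z ⬝ᵥ z : ℤ) : ℝ) = 8 := by linarith
          have : z ⬝ᵥ z = 8 := by exact_mod_cast this
          rw [this] at h8
          norm_num at h8
      obtain ⟨s, hs⟩ := exists_signs_of_odd hodd' h4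
      refine Finset.mem_union_right _ ?_
      rw [mem_halfVectors]
      exact ⟨s, Finset.mem_univ _, funext fun i => by rw [halfVec, hx'', ← hs i]⟩

theorem isCrystallographic_F4 : IsCrystallographic rootsF4 := by
  refine IsCrystallographic.of_lattice latticeF4 (fun q => q = 1 ∨ q = 2) (fun _ => mem_rootsF4_iff)
    (fun α hα β hβ => ?_) (by norm_num)
  obtain ⟨⟨q, f, hy⟩, -⟩ := mem_rootsF4_iff.mp hβ
  rw [rootsF4_eq, Finset.mem_union] at hα
  rcases hα with h | h
  · obtain ⟨⟨p, e, hx⟩, -⟩ := mem_rootsF4_iff.mp (by rw [rootsF4_eq]; exact Finset.mem_union_left _ h)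
    refine ⟨2 * (q ⬝ᵥ p) + (e * ∑ i, q i + f * ∑ i, p i) + 2 * (f * e), ?_⟩
    rw [shortRootsF4_dot h, dot_of_coordinates hy hx]
    push_cast
    ring
  · obtain ⟨z, rfl, hz⟩ := mem_pmRoots.mp h
    -- A long root is integral with even coordinate sum, so its inner product with a half-integral
    -- vector is an integer.
    obtain ⟨c, hc⟩ := two_dvd_sum_of_dot (z := z) (by rw [hz])
    refine ⟨q ⬝ᵥ z + f * c, ?_⟩
    rw [intVec_dot, hz, dot_of_coordinates hy (y := intVec z) (q := z) (f := 0)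
      (by simp [intVec]), hc]
    push_cast
    ring

theorem sum_shortRootsF4 (g : (Fin 4 → ℝ) → ℂ) :
    ∑ α ∈ shortRootsF4, g α = ∑ α ∈ unitRoots 4 1, g α + ∑ s, g (halfVec s) := by
  rw [shortRootsF4, Finset.sum_union, sum_halfVectors]
  rw [Finset.disjoint_left]
  intro x h1 h2
  rw [mem_unitRoots] at h1
  rw [mem_halfVectors] at h2
  obtain ⟨z, rfl, -⟩ := h1
  obtain ⟨s, -, hs⟩ := h2
  rw [one_smul] at hs
  exact halfVec_ne_intVec 0 s z hs

theorem hasSecondMoment_shortRootsF4 : HasSecondMoment rootsF4 shortRootsF4 6 :=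
  HasSecondMoment.of_lin fun y _ z _ => by
    rw [sum_shortRootsF4, second_moment_unitRoots one_ne_zero]
    have e : ∀ s : Fin 4 → ℤˣ, lin (halfVec s) y * lin (halfVec s) z =
        1 / 4 * (spin s y * spin s z) := fun s => by
      rw [lin_halfVec, lin_halfVec]
      ring
    simp only [e, ← Finset.mul_sum, sum_spin_two]
    push_cast
    ring

/-- The coordinate terms `2` of the unit vectors and `-2 · 2⁴/16` of the half-integral vectors
cancel. -/
theorem hasFourthMoment_shortRootsF4 : HasFourthMoment rootsF4 shortRootsF4 1 0 :=
  HasFourthMoment.of_lin fun x _ y _ z _ => by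
    rw [sum_shortRootsF4, fourth_moment_unitRoots one_ne_zero]
    have e : ∀ s : Fin 4 → ℤˣ, lin (halfVec s) x ^ 2 * (lin (halfVec s) y * lin (halfVec s) z) =
        1 / 16 * (spin s x * spin s x * (spin s y * spin s z)) := fun s => by
      rw [lin_halfVec, lin_halfVec, lin_halfVec]
      ring
    simp only [e, ← Finset.mul_sum, sum_spin_four]
    simp only [← pow_two]
    push_cast
    ring

theorem hasFourthMoment_longRootsF4 : HasFourthMoment rootsF4 (pmRoots 4) 4 0 := by
  convert hasFourthMoment_pmRoots rootsF4 using 1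
  norm_num

/-- With `ℓ = 1` the pair sums are `6` (short), `24` (mixed) and `96` (long). In the notation of the
theorem `hc` becomes `48 k'² + 144 k k' + 96 k² = 48 (k + k') (2 k + k')`. -/
theorem isFlat_iff_F4 {κ : (Fin 4 → ℝ) → ℂ} {a : LieAlg rootsF4 →ₗ[ℂ] LieAlg rootsF4 →ₗ[ℂ] ℂ}
    {b : LieAlg rootsF4 →ₗ[ℂ] LieAlg rootsF4 →ₗ[ℂ] LieAlg rootsF4} (hκ : IsMultiplicity rootsF4 κ)
    (ha : IsInvariantForm rootsF4 a) (hb : IsEquivariantMap rootsF4 b) {α β : Fin 4 → ℝ}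
    (hα : α ∈ pmRoots 4) (hβ : β ∈ shortRootsF4) :
    IsFlat rootsF4 κ a b ↔
      a = ((κ α + κ β) * (2 * κ α + κ β)) • stdForm rootsF4 := by
  have hR := isCrystallographic_F4
  have hS : shortRootsF4 ⊆ rootsF4 := by
    rw [rootsF4_eq]
    exact Finset.subset_union_left
  have hT : pmRoots 4 ⊆ rootsF4 := by
    rw [rootsF4_eq]
    exact Finset.subset_union_right
  have hlS : ∀ γ ∈ shortRootsF4, γ ⬝ᵥ γ = 1 := fun γ h => shortRootsF4_dot h
  have hlT : ∀ γ ∈ pmRoots 4, γ ⬝ᵥ γ = 2 := fun γ h => pmRoots_dot h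
  have hT2 := hasSecondMoment_pmRoots rootsF4
  refine isFlat_iff_of_sum hR ha hb (fun f hf => sum_coth_eq_of_pairSums hR rootsF4_eq one_pos
    (k := κ β) (k' := κ α)
    (fun γ hγ => ⟨hlS γ hγ,
      hκ.eq_of_fourthMoment hR hS hlS one_pos le_rfl hasFourthMoment_shortRootsF4 hγ hβ⟩)
    (fun γ hγ => ⟨by rw [hlT γ hγ]; norm_num,
      hκ.eq_of_fourthMoment hR hT hlT four_pos le_rfl hasFourthMoment_longRootsF4 hγ hα⟩)
    (hasPairSum_of_moments hS hlS hasSecondMoment_shortRootsF4 hasFourthMoment_shortRootsF4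
      (e := 0) (f := 0) (fun m y _ z _ => by simp))
    (hasPairSum_of_moments hT hlT hT2 hasFourthMoment_shortRootsF4
      (e := 0) (f := 0) (fun m y _ z _ => by simp))
    (hasPairSum_of_moments hT hlT hT2 hasFourthMoment_longRootsF4
      (e := 0) (f := 0) (fun m y _ z _ => by simp)) (by push_cast; ring) hf) ?_
    (exists_independent_pmRoots (by norm_num) hT)
  rintro ⟨γ, hγ⟩ v hv h
  have h' : ∀ δ ∈ rootsF4, γ ⬝ᵥ δ = 0 → asForm rootsF4 δ v = 0 := fun δ hδ => h ⟨δ, hδ⟩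
  rw [rootsF4_eq, Finset.mem_union] at hγ
  rcases hγ with h1 | h1
  · exact eq_zero_of_orthogonal_of_moments hR hS one_pos hlS hasSecondMoment_shortRootsF4
      hasFourthMoment_shortRootsF4 (by norm_num) h1 hv h'
  · exact eq_zero_of_orthogonal_of_moments hR hT two_pos hlT hT2
      hasFourthMoment_longRootsF4 (by norm_num) h1 hv h'

theorem longRoot_mem_F4 : ![0, 1, -1, 0] ∈ pmRoots 4 :=
  mem_pmRoots.mpr ⟨![0, 1, -1, 0], by ext i; fin_cases i <;> simp [intVec],
    by simp [dotProduct, Fin.sum_univ_four]⟩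

theorem shortRoot_mem_F4 : ![1 / 2, -1 / 2, -1 / 2, -1 / 2] ∈ shortRootsF4 := by
  refine Finset.mem_union_right _ ?_
  rw [mem_halfVectors]
  exact ⟨![1, -1, -1, -1], Finset.mem_univ _, by ext i; fin_cases i <;> simp [halfVec]⟩

end TypeF

end ToricConnection

end

open ToricConnection in
theorem mainTheorem6 :
    -- Type `A_n`, with `k` the multiplicity of `α_1 = ε_1 - ε_2`
    (∀ (n : ℕ) (_hn : 1 ≤ n) (κ : (Fin (n + 1) → ℝ) → ℂ) (k' : ℂ)
      (a : LieAlg (rootsA n) →ₗ[ℂ] LieAlg (rootsA n) →ₗ[ℂ] ℂ),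
      IsMultiplicity (rootsA n) κ → IsInvariantForm (rootsA n) a →
      (a = (((n : ℂ) + 1) / 4 * (κ (ε ⟨0, by omega⟩ - ε ⟨1, by omega⟩) ^ 2 - k' ^ 2)) •
          stdForm (rootsA n) →
        IsFlat (rootsA n) κ a (bA n k')) ∧
      (2 ≤ n → IsFlat (rootsA n) κ a (bA n k') →
        a = (((n : ℂ) + 1) / 4 * (κ (ε ⟨0, by omega⟩ - ε ⟨1, by omega⟩) ^ 2 - k' ^ 2)) •
          stdForm (rootsA n))) ∧
    -- Type `B_n`, with `k`, `k'` the multiplicities of `α_1 = ε_1 - ε_2` and `α_n = ε_n`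
    (∀ (n : ℕ) (_hn : 2 ≤ n) (κ : (Fin n → ℝ) → ℂ)
      (a : LieAlg (rootsB n) →ₗ[ℂ] LieAlg (rootsB n) →ₗ[ℂ] ℂ)
      (b : LieAlg (rootsB n) →ₗ[ℂ] LieAlg (rootsB n) →ₗ[ℂ] LieAlg (rootsB n)) (k k' : ℂ),
      IsMultiplicity (rootsB n) κ → IsInvariantForm (rootsB n) a → IsEquivariantMap (rootsB n) b →
      k = κ (ε ⟨0, by omega⟩ - ε ⟨1, by omega⟩) → k' = κ (ε ⟨n - 1, by omega⟩) →
      (IsFlat (rootsB n) κ a b ↔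
        a = (((n : ℂ) - 2) * k ^ 2 + k * k') • stdForm (rootsB n))) ∧
    -- Type `C_n`, with `k`, `k'` the multiplicities of `α_1 = ε_1 - ε_2` and `α_n = 2 ε_n`
    (∀ (n : ℕ) (_hn : 2 ≤ n) (κ : (Fin n → ℝ) → ℂ)
      (a : LieAlg (rootsC n) →ₗ[ℂ] LieAlg (rootsC n) →ₗ[ℂ] ℂ)
      (b : LieAlg (rootsC n) →ₗ[ℂ] LieAlg (rootsC n) →ₗ[ℂ] LieAlg (rootsC n)) (k k' : ℂ),
      IsMultiplicity (rootsC n) κ → IsInvariantForm (rootsC n) a → IsEquivariantMap (rootsC n) b →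
      k = κ (ε ⟨0, by omega⟩ - ε ⟨1, by omega⟩) → k' = κ ((2 : ℝ) • ε ⟨n - 1, by omega⟩) →
      (IsFlat (rootsC n) κ a b ↔
        a = (((n : ℂ) - 2) * k ^ 2 + 2 * k * k') • stdForm (rootsC n))) ∧
    -- Type `D_n`, with `k` the multiplicity of `α_1 = ε_1 - ε_2`
    (∀ (n : ℕ) (_hn : 4 ≤ n) (κ : (Fin n → ℝ) → ℂ)
      (a : LieAlg (rootsD n) →ₗ[ℂ] LieAlg (rootsD n) →ₗ[ℂ] ℂ)
      (b : LieAlg (rootsD n) →ₗ[ℂ] LieAlg (rootsD n) →ₗ[ℂ] LieAlg (rootsD n)) (k : ℂ),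
      IsMultiplicity (rootsD n) κ → IsInvariantForm (rootsD n) a → IsEquivariantMap (rootsD n) b →
      k = κ (ε ⟨0, by omega⟩ - ε ⟨1, by omega⟩) →
      (IsFlat (rootsD n) κ a b ↔ a = (((n : ℂ) - 2) * k ^ 2) • stdForm (rootsD n))) ∧
    -- Types `E_6`, `E_7`, `E_8`, with `k` the multiplicity of
    -- `α_1 = ½ (ε_1 - ε_2 - ε_3 - ε_4 - ε_5 - ε_6 - ε_7 + ε_8)`
    (∀ (κ : (Fin 8 → ℝ) → ℂ)
      (a : LieAlg rootsE6 →ₗ[ℂ] LieAlg rootsE6 →ₗ[ℂ] ℂ)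
      (b : LieAlg rootsE6 →ₗ[ℂ] LieAlg rootsE6 →ₗ[ℂ] LieAlg rootsE6) (k : ℂ),
      IsMultiplicity rootsE6 κ → IsInvariantForm rootsE6 a → IsEquivariantMap rootsE6 b →
      k = κ ![1 / 2, -1 / 2, -1 / 2, -1 / 2, -1 / 2, -1 / 2, -1 / 2, 1 / 2] →
      (IsFlat rootsE6 κ a b ↔ a = (6 * k ^ 2) • stdForm rootsE6)) ∧
    (∀ (κ : (Fin 8 → ℝ) → ℂ)
      (a : LieAlg rootsE7 →ₗ[ℂ] LieAlg rootsE7 →ₗ[ℂ] ℂ)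
      (b : LieAlg rootsE7 →ₗ[ℂ] LieAlg rootsE7 →ₗ[ℂ] LieAlg rootsE7) (k : ℂ),
      IsMultiplicity rootsE7 κ → IsInvariantForm rootsE7 a → IsEquivariantMap rootsE7 b →
      k = κ ![1 / 2, -1 / 2, -1 / 2, -1 / 2, -1 / 2, -1 / 2, -1 / 2, 1 / 2] →
      (IsFlat rootsE7 κ a b ↔ a = (12 * k ^ 2) • stdForm rootsE7)) ∧
    (∀ (κ : (Fin 8 → ℝ) → ℂ)
      (a : LieAlg rootsE8 →ₗ[ℂ] LieAlg rootsE8 →ₗ[ℂ] ℂ)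
      (b : LieAlg rootsE8 →ₗ[ℂ] LieAlg rootsE8 →ₗ[ℂ] LieAlg rootsE8) (k : ℂ),
      IsMultiplicity rootsE8 κ → IsInvariantForm rootsE8 a → IsEquivariantMap rootsE8 b →
      k = κ ![1 / 2, -1 / 2, -1 / 2, -1 / 2, -1 / 2, -1 / 2, -1 / 2, 1 / 2] →
      (IsFlat rootsE8 κ a b ↔ a = (30 * k ^ 2) • stdForm rootsE8)) ∧
    -- Type `F_4`, with `k`, `k'` the multiplicities of the long root `α_1 = ε_2 - ε_3` and of the
    -- short root `α_4 = ½ (ε_1 - ε_2 - ε_3 - ε_4)`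
    (∀ (κ : (Fin 4 → ℝ) → ℂ)
      (a : LieAlg rootsF4 →ₗ[ℂ] LieAlg rootsF4 →ₗ[ℂ] ℂ)
      (b : LieAlg rootsF4 →ₗ[ℂ] LieAlg rootsF4 →ₗ[ℂ] LieAlg rootsF4) (k k' : ℂ),
      IsMultiplicity rootsF4 κ → IsInvariantForm rootsF4 a → IsEquivariantMap rootsF4 b →
      k = κ ![0, 1, -1, 0] → k' = κ ![1 / 2, -1 / 2, -1 / 2, -1 / 2] →
      (IsFlat rootsF4 κ a b ↔ a = ((k + k') * (2 * k + k')) • stdForm rootsF4)) ∧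
    -- Type `G_2`, with `k`, `k'` the multiplicities of the short root `α_1 = ε_1 - ε_2` and of the
    -- long root `α_2 = -2 ε_1 + ε_2 + ε_3`
    (∀ (κ : (Fin 3 → ℝ) → ℂ)
      (a : LieAlg rootsG2 →ₗ[ℂ] LieAlg rootsG2 →ₗ[ℂ] ℂ)
      (b : LieAlg rootsG2 →ₗ[ℂ] LieAlg rootsG2 →ₗ[ℂ] LieAlg rootsG2) (k k' : ℂ),
      IsMultiplicity rootsG2 κ → IsInvariantForm rootsG2 a → IsEquivariantMap rootsG2 b →
      k = κ ![1, -1, 0] → k' = κ ![-2, 1, 1] →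
      (IsFlat rootsG2 κ a b ↔ a = (3 / 4 * (k + 3 * k') * (k + k')) • stdForm rootsG2)) := by
  refine ⟨fun n hn κ k' a hκ ha => ?_, fun n hn κ a b k k' hκ ha hb hk hk' => ?_,
    fun n hn κ a b k k' hκ ha hb hk hk' => ?_, fun n hn κ a b k hκ ha hb hk => ?_,
    fun κ a b k hκ ha hb hk => ?_, fun κ a b k hκ ha hb hk => ?_, fun κ a b k hκ ha hb hk => ?_,
    fun κ a b k k' hκ ha hb hk hk' => ?_, fun κ a b k k' hκ ha hb hk hk' => ?_⟩
  · have hα : (ε ⟨0, by omega⟩ - ε ⟨1, by omega⟩ : Fin (n + 1) → ℝ) ∈ rootsA n :=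
      sub_mem_rootsA (by simp)
    exact ⟨isFlat_A hn hκ hα k', fun h2 => eq_smul_stdForm_of_isFlat_A h2 hκ hα k' ha⟩
  · rw [hk, hk']
    exact isFlat_iff_B hn hκ ha hb (sub_mem_pmRoots (by simp))
      (by simpa using smul_mem_unitRoots 1 (⟨n - 1, by omega⟩ : Fin n))
  · rw [hk, hk']
    exact isFlat_iff_C hn hκ ha hb (sub_mem_pmRoots (by simp)) (smul_mem_unitRoots 2 _)
  · exact isFlat_iff_D hn hκ ha hb (sub_mem_pmRoots (by simp)) hk
  · exact isFlat_iff_E6 hκ ha hb hk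
  · exact isFlat_iff_E7 hκ ha hb hk
  · exact isFlat_iff_E8 hκ ha hb hk
  · rw [hk, hk']
    exact isFlat_iff_F4 hκ ha hb longRoot_mem_F4 shortRoot_mem_F4
  · rw [hk, hk']
    exact isFlat_iff_G2 hκ ha hb shortRoot_mem_G2 longRoot_mem_G2
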